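/- Let $d\in\mathbb{N}$, $\kappa>0$, $\omega\in\mathbb{R}$, $c\in\mathbb{R}^d$, and assume one of the following. (A) $1\le d\le 5$ and $\omega>\max\{|c|^2/4,\ |c|^2/(8\kappa)\}$. (B) $3\le d\le 5$, $0<\kappa<1/2$, $\omega=|c|^2/(8\kappa)$ and $c\neq 0$. (C) $d=5$, $\kappa>1/2$, $\omega=|c|^2/4$ and $c\ne 0$. Let $X_{\omega,c}$ be the real vector space of pairs $(u,v)$ of complex-valued functions on $\mathbb{R}^d$ (modulo null sets) such that $(e^{-\frac i2 c\cdot x}u,\ e^{-\frac{i}{2\kappa}c\cdot x}v)$ belongs to $H^1\times H^1$ in case (A), to $H^1\times\dot H^1$ in case (B), and to $\dot H^1\times H^1$ in case (C), where $\dot H^1(\mathbb{R}^d)=\{f\in L^{2d/(d-2)}:\nabla f\in L^2\}$ for $d\ge3$. On $X_{\omega,c}$ consider the action $$S_{\omega,c}(u,v)=\tfrac12\|\nabla(e^{-\frac i2c\cdot x}u)\|_{L^2}^2+\tfrac12\Bigl(\omega-\tfrac{|c|^2}{4}\Bigr)\|u\|_{L^2}^2+\tfrac\kappa2\|\nabla(e^{-\frac{i}{2\kappa}c\cdot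 x}v)\|_{L^2}^2+\Bigl(\omega-\tfrac{|c|^2}{8\kappa}\Bigr)\|v\|_{L^2}^2-\operatorname{Re}\int_{\mathbb{R}^d}u^2\overline v\,dx,$$ where a term with vanishing coefficient is omitted. On $H^1\times H^1$ this is $E+\omega Q+c\cdot P$, with the energy $E=\frac12\|\nabla u\|_{L^2}^2+\frac\kappa2\|\nabla v\|_{L^2}^2-\operatorname{Re}\int u^2\overline v$, the charge $Q=\frac12\|u\|_{L^2}^2+\|v\|_{L^2}^2$ and the momentum $P=\frac12\operatorname{Re}\int i\nabla u\,\overline u+\frac12\operatorname{Re}\int i\nabla v\,\overline v$. Its critical points are the solutions in $X_{\omega,c}$ of the stationary system $$-\Delta\phi+\omega\phi+ic\cdot\nabla\phi-2\psi\overline\phi=0,\qquad -\kappa\Delta\psi+2\omega\psi+ic\cdot\nabla\psi-\phi^2=0 .$$ Let - $\mathcal A_{\omega,c}=\{(\phi,\psi)\in X_{\omega,c}\setminus\{(0,0)\}:\ S_{\omega,c}'(\phi,\psi)=0\}$; - $\mathcal G_{\omega,c}=\{(\phi,\psi)\in\mathcal A_{\omega,c}:\ S_{\omega,c}(\phi,\psi)\le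 S_{\omega,c}(\zeta,\eta)\text{ for all }(\zeta,\eta)\in\mathcal A_{\omega,c}\}$ (ground states); - $\mathcal K_{\omega,c}=\{(\phi,\psi)\in X_{\omega,c}\setminus\{(0,0)\}:\ \partial_\lambda S_{\omega,c}(\lambda\phi,\lambda\psi)|_{\lambda=1}=0\}$ (Nehari manifold); - $\mathcal M_{\omega,c}=\{(\phi,\psi)\in\mathcal K_{\omega,c}:\ S_{\omega,c}(\phi,\psi)=\inf_{\mathcal K_{\omega,c}}S_{\omega,c}\}$. Then $\mathcal G_{\omega,c}=\mathcal M_{\omega,c}\neq\emptyset$. In particular nontrivial traveling waves exist: for every $(\phi,\psi)\in\mathcal G_{\omega,c}$ the pair $u(t,x)=e^{i\omega t}\phi(x-ct)$, $v(t,x)=e^{2i\omega t}\psi(x-ct)$ solves $$i\partial_tu+\Delta u=-2v\overline u,\qquad i\partial_tv+\kappa\Delta v=-u^2$$ in the sense of distributions on $\mathbb{R}\times\mathbb{R}^d$. -/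

import Mathlib

open MeasureTheory Laplacian
open scoped ComplexConjugate

namespace QuadraticNLS

noncomputable section

/-- The space `ℝ^d` with its Euclidean norm and Lebesgue measure. -/
abbrev Space (d : ℕ) : Type := EuclideanSpace ℝ (Fin d)

/-- `g` is the weak partial derivative `∂_j f`: both are locally integrable and
`∫ (∂_j χ) f = - ∫ χ g` for every test function `χ`. -/
def HasWeakPartial {d : ℕ} (j : Fin d) (f g : Space d → ℂ) : Prop :=
  LocallyIntegrable f ∧ LocallyIntegrable g ∧
    ∀ χ : Space d → ℝ, ContDiff ℝ (⊤ : ℕ∞) χ → HasCompactSupport χ →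
      ∫ x, fderiv ℝ χ x (EuclideanSpace.single j 1) • f x = - ∫ x, χ x • g x

open scoped Classical in
/-- A representative of the weak partial derivative `∂_j f` (unique up to null sets, see
`HasWeakPartial.ae_eq`), and `0` when there is none. -/
def weakPartial {d : ℕ} (j : Fin d) (f : Space d → ℂ) : Space d → ℂ :=
  if h : ∃ g, HasWeakPartial j f g then h.choose else 0

/-- Membership in the Sobolev space `H¹(ℝ^d)` of complex-valued functions. -/
def IsH1 {d : ℕ} (f : Space d → ℂ) : Prop :=
  MemLp f 2 ∧ ∀ j : Fin d, ∃ g, HasWeakPartial j f g ∧ MemLp g 2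

/-- Membership in the homogeneous Sobolev space `Ḣ¹(ℝ^d)`, `d ≥ 3`: the functions in `L^{2*}`,
`2* = 2d/(d-2)`, whose weak gradient is in `L²`. -/
def IsHDot1 {d : ℕ} (f : Space d → ℂ) : Prop :=
  MemLp f (ENNReal.ofReal (2 * (d : ℝ) / ((d : ℝ) - 2))) ∧
    ∀ j : Fin d, ∃ g, HasWeakPartial j f g ∧ MemLp g 2

/-- `‖f‖²_{L²}`. -/
def massSq {d : ℕ} (f : Space d → ℂ) : ℝ := ∫ x, ‖f x‖ ^ 2

/-- `‖∇f‖²_{L²}`. -/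
def gradSq {d : ℕ} (f : Space d → ℂ) : ℝ := ∑ j : Fin d, ∫ x, ‖weakPartial j f x‖ ^ 2

/-- The function `x ↦ e^{i b·x} f(x)`. -/
def modulate {d : ℕ} (b : Space d) (f : Space d → ℂ) : Space d → ℂ :=
  fun x => Complex.exp (Complex.I * ((inner ℝ b x : ℝ) : ℂ)) * f x

/-- A pair `(u, v)` of functions on `ℝ^d`, representing a pair of functions modulo null sets. -/
abbrev Pair (d : ℕ) : Type := (Space d → ℂ) × (Space d → ℂ)

/-- `Re ∫ u² v̄`. -/
def interaction {d : ℕ} (p : Pair d) : ℝ := (∫ x, p.1 x ^ 2 * conj (p.2 x)).re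

/-- The energy `½‖∇u‖² + (κ/2)‖∇v‖² - Re ∫ u² v̄`. -/
def energy {d : ℕ} (κ : ℝ) (p : Pair d) : ℝ :=
  1 / 2 * gradSq p.1 + κ / 2 * gradSq p.2 - interaction p

/-- The charge `½‖u‖² + ‖v‖²`. -/
def charge {d : ℕ} (p : Pair d) : ℝ := 1 / 2 * massSq p.1 + massSq p.2

/-- The `j`-th component `½ (i∂_j u, u) + ½ (i∂_j v, v)` of the momentum, where
`(f, g) = Re ∫ f ḡ`. -/
def momentum {d : ℕ} (p : Pair d) (j : Fin d) : ℝ :=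
  1 / 2 * (∫ x, Complex.I * weakPartial j p.1 x * conj (p.1 x)).re +
    1 / 2 * (∫ x, Complex.I * weakPartial j p.2 x * conj (p.2 x)).re

/-- The quadratic part
`½‖∇(e^{-ic·x/2}u)‖² + ½(ω - |c|²/4)‖u‖² + (κ/2)‖∇(e^{-ic·x/(2κ)}v)‖² + (ω - |c|²/(8κ))‖v‖²`
of the action. -/
def quadraticPart {d : ℕ} (κ ω : ℝ) (c : Space d) (p : Pair d) : ℝ :=
  1 / 2 * gradSq (modulate (-(1 / 2 : ℝ) • c) p.1) + 1 / 2 * (ω - ‖c‖ ^ 2 / 4) * massSq p.1 +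
    κ / 2 * gradSq (modulate (-(1 / (2 * κ)) • c) p.2) + (ω - ‖c‖ ^ 2 / (8 * κ)) * massSq p.2

/-- The action `S_{ω,c}`. It is the functional `E + ω Q + c · P` on `H¹ × H¹`
(`action_eq_energy_charge_momentum`), written in the form which also makes sense on the larger
space `X_{ω,c}` of the zero mass cases, where `Q` and `P` need not be finite. -/
def action {d : ℕ} (κ ω : ℝ) (c : Space d) (p : Pair d) : ℝ :=
  quadraticPart κ ω c p - interaction p

/-- Positive mass: `ω > max (|c|²/4, |c|²/(8κ))`. -/
def CaseA {d : ℕ} (κ ω : ℝ) (c : Space d) : Prop :=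
  0 < κ ∧ max (‖c‖ ^ 2 / 4) (‖c‖ ^ 2 / (8 * κ)) < ω

/-- Zero mass in the second component: `0 < κ < 1/2`, `ω = |c|²/(8κ)`, `c ≠ 0`. -/
def CaseB {d : ℕ} (κ ω : ℝ) (c : Space d) : Prop :=
  0 < κ ∧ κ < 1 / 2 ∧ ω = ‖c‖ ^ 2 / (8 * κ) ∧ c ≠ 0

/-- Zero mass in the first component: `κ > 1/2`, `ω = |c|²/4`, `c ≠ 0`. -/
def CaseC {d : ℕ} (κ ω : ℝ) (c : Space d) : Prop :=
  1 / 2 < κ ∧ ω = ‖c‖ ^ 2 / 4 ∧ c ≠ 0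

/-- `H¹ × H¹`, `H¹ × Ḣ¹`, `Ḣ¹ × H¹` in the (mutually exclusive) cases A, B, C. -/
def tildeX {d : ℕ} (κ ω : ℝ) (c : Space d) : Set (Pair d) :=
  {p | (CaseA κ ω c ∧ IsH1 p.1 ∧ IsH1 p.2) ∨ (CaseB κ ω c ∧ IsH1 p.1 ∧ IsHDot1 p.2) ∨
    (CaseC κ ω c ∧ IsHDot1 p.1 ∧ IsH1 p.2)}

/-- The space `X_{ω,c}` of the `(u, v)` with `(e^{-ic·x/2}u, e^{-ic·x/(2κ)}v)` in the space
`tildeX`. -/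
def spaceX {d : ℕ} (κ ω : ℝ) (c : Space d) : Set (Pair d) :=
  {p | (modulate (-(1 / 2 : ℝ) • c) p.1, modulate (-(1 / (2 * κ)) • c) p.2) ∈ tildeX κ ω c}

/-- `p` is the zero element, as a pair of functions modulo null sets. -/
def IsNull {d : ℕ} (p : Pair d) : Prop := p.1 =ᵐ[volume] 0 ∧ p.2 =ᵐ[volume] 0

/-- Nontrivial solutions `(φ, ψ) ∈ X_{ω,c}` of the stationary system, i.e. nontrivial critical
points of the action on the real vector space `X_{ω,c}`. -/
def criticalPoints {d : ℕ} (κ ω : ℝ) (c : Space d) : Set (Pair d) :=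
  {p | p ∈ spaceX κ ω c ∧ ¬ IsNull p ∧
    ∀ q ∈ spaceX κ ω c, HasDerivAt (fun s : ℝ => action κ ω c (p + s • q)) 0 0}

/-- Ground states: nontrivial solutions of least action among all nontrivial solutions. -/
def groundStates {d : ℕ} (κ ω : ℝ) (c : Space d) : Set (Pair d) :=
  {p | p ∈ criticalPoints κ ω c ∧ ∀ q ∈ criticalPoints κ ω c, action κ ω c p ≤ action κ ω c q}

/-- The Nehari functional `K_{ω,c}(u, v) = ∂_l S_{ω,c}(l u, l v)` at `l = 1`; it equals
`2 L_{ω,c} - 3 N` with the quadratic part `L` and the cubic part `N` of the action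
(`nehari_eq`). -/
def nehari {d : ℕ} (κ ω : ℝ) (c : Space d) (p : Pair d) : ℝ :=
  deriv (fun l : ℝ => action κ ω c (l • p)) 1

/-- The Nehari manifold. -/
def nehariManifold {d : ℕ} (κ ω : ℝ) (c : Space d) : Set (Pair d) :=
  {p | p ∈ spaceX κ ω c ∧ ¬ IsNull p ∧ nehari κ ω c p = 0}

/-- Minimizers on the Nehari manifold: its points at which the action equals the infimum (greatest
lower bound) of the action over it. -/
def nehariMinimizers {d : ℕ} (κ ω : ℝ) (c : Space d) : Set (Pair d) :=
  {p | p ∈ nehariManifold κ ω c ∧ IsGLB (action κ ω c '' nehariManifold κ ω c) (action κ ω c p)}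

/-- `(u, v)` solves `i∂_t u + Δu = -2 v ū`, `i∂_t v + κΔv = -u²` on `ℝ × ℝ^d` in the sense of
distributions. -/
def IsNLSSolution {d : ℕ} (κ : ℝ) (u v : ℝ × Space d → ℂ) : Prop :=
  LocallyIntegrable u ∧ LocallyIntegrable v ∧
  LocallyIntegrable (fun z => v z * conj (u z)) ∧ LocallyIntegrable (fun z => u z ^ 2) ∧
  ∀ χ : ℝ × Space d → ℂ, ContDiff ℝ (⊤ : ℕ∞) χ → HasCompactSupport χ →
    (∫ z, u z * (-Complex.I * fderiv ℝ χ z (1, 0) + Δ (fun y => χ (z.1, y)) z.2)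
      = ∫ z, -2 * (v z * conj (u z)) * χ z) ∧
    (∫ z, v z * (-Complex.I * fderiv ℝ χ z (1, 0) + (κ : ℂ) * Δ (fun y => χ (z.1, y)) z.2)
      = ∫ z, -(u z ^ 2) * χ z)

/-- The traveling wave `(t, x) ↦ e^{iωt} φ(x - ct)`. -/
def travelingWave {d : ℕ} (ω : ℝ) (c : Space d) (φ : Space d → ℂ) : ℝ × Space d → ℂ :=
  fun z => Complex.exp (Complex.I * ((ω * z.1 : ℝ) : ℂ)) * φ (z.2 - z.1 • c)

/-! ### The weak derivative is unique, and the two forms of the action and of the Nehari functional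
agree -/

theorem HasWeakPartial.ae_eq {d : ℕ} {j : Fin d} {f g g' : Space d → ℂ}
    (h : HasWeakPartial j f g) (h' : HasWeakPartial j f g') : g =ᵐ[volume] g' := by
  refine ae_eq_of_integral_contDiff_smul_eq h.2.1 h'.2.1 fun χ h1 h2 => ?_
  have := h.2.2 χ h1 h2
  rw [h'.2.2 χ h1 h2] at this
  exact (neg_injective this).symm

theorem HasWeakPartial.weakPartial {d : ℕ} {j : Fin d} {f g : Space d → ℂ}
    (h : HasWeakPartial j f g) : weakPartial j f =ᵐ[volume] g := by
  have hex : ∃ g, HasWeakPartial j f g := ⟨g, h⟩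
  unfold QuadraticNLS.weakPartial
  rw [dif_pos hex]
  exact hex.choose_spec.ae_eq h

theorem HasWeakPartial.const_smul {d : ℕ} {j : Fin d} {f g : Space d → ℂ}
    (h : HasWeakPartial j f g) (l : ℝ) : HasWeakPartial j (l • f) (l • g) := by
  refine ⟨h.1.smul l, h.2.1.smul l, fun χ h1 h2 => ?_⟩
  have := h.2.2 χ h1 h2
  simp only [Pi.smul_apply, smul_comm _ l, integral_smul, this, smul_neg]

theorem gradSq_smul {d : ℕ} (f : Space d → ℂ) (l : ℝ) : gradSq (l • f) = l ^ 2 * gradSq f := by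
  unfold gradSq
  rw [Finset.mul_sum]
  refine Finset.sum_congr rfl fun j _ => ?_
  have key : QuadraticNLS.weakPartial j (l • f) =ᵐ[volume] l • QuadraticNLS.weakPartial j f := by
    by_cases hl : l = 0
    · subst hl
      have h0 : HasWeakPartial j (0 : Space d → ℂ) 0 :=
        ⟨locallyIntegrable_zero, locallyIntegrable_zero, by simp⟩
      simpa using h0.weakPartial
    by_cases hf : ∃ g, HasWeakPartial j f g
    · obtain ⟨g, hg⟩ := hf
      refine (hg.const_smul l).weakPartial.trans ?_
      filter_upwards [hg.weakPartial] with x hx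
      simp [hx]
    · have hf' : ¬ ∃ g, HasWeakPartial j (l • f) g := by
        rintro ⟨g, hg⟩
        apply hf
        refine ⟨l⁻¹ • g, ?_⟩
        simpa [smul_smul, hl] using hg.const_smul l⁻¹
      unfold QuadraticNLS.weakPartial
      rw [dif_neg hf, dif_neg hf']
      simp
  rw [← integral_const_mul]
  refine integral_congr_ae ?_
  filter_upwards [key] with x hx
  simp [hx, mul_pow]

theorem action_smul {d : ℕ} (κ ω : ℝ) (c : Space d) (p : Pair d) (l : ℝ) :
    action κ ω c (l • p) = l ^ 2 * quadraticPart κ ω c p - l ^ 3 * interaction p := by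
  have h1 : ∀ (b : Space d) (f : Space d → ℂ), modulate b (l • f) = l • modulate b f := by
    intro b f
    ext x
    simp only [modulate, Pi.smul_apply, Complex.real_smul]
    ring
  have h2 : ∀ f : Space d → ℂ, massSq (l • f) = l ^ 2 * massSq f := by
    intro f
    simp [massSq, ← integral_const_mul, mul_pow]
  have h3 : interaction (l • p) = l ^ 3 * interaction p := by
    unfold interaction
    rw [← Complex.re_ofReal_mul, ← integral_const_mul]
    congr 2
    ext x
    simp only [Prod.smul_fst, Prod.smul_snd, Pi.smul_apply, Complex.real_smul, map_mul,
      Complex.conj_ofReal]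
    push_cast
    ring
  unfold action quadraticPart
  simp only [Prod.smul_fst, Prod.smul_snd, h1, h2, h3, gradSq_smul]
  ring

theorem nehari_eq {d : ℕ} (κ ω : ℝ) (c : Space d) (p : Pair d) :
    nehari κ ω c p = 2 * quadraticPart κ ω c p - 3 * interaction p := by
  unfold nehari
  simp only [action_smul]
  have := (((hasDerivAt_pow 2 (1 : ℝ)).mul_const (quadraticPart κ ω c p)).sub
    ((hasDerivAt_pow 3 (1 : ℝ)).mul_const (interaction p))).deriv
  simpa [Pi.sub_def] using this

theorem HasWeakPartial.modulate {d : ℕ} {j : Fin d} {f g : Space d → ℂ}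
    (h : HasWeakPartial j f g) (b : Space d) :
    HasWeakPartial j (modulate b f)
      (QuadraticNLS.modulate b (fun x => g x + Complex.I * (b j : ℂ) * f x)) := by
  have hmod : ∀ F : Space d → ℂ, LocallyIntegrable F →
      LocallyIntegrable (QuadraticNLS.modulate b F) := by
    intro F hF
    refine hF.mono ?_ (Filter.Eventually.of_forall fun x => ?_)
    · refine AEStronglyMeasurable.mul (Continuous.aestronglyMeasurable ?_) hF.aestronglyMeasurable
      fun_prop
    · simp [QuadraticNLS.modulate, Complex.norm_exp]
  have hbf : LocallyIntegrable (fun x => Complex.I * (b j : ℂ) * f x) := by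
    simpa [Pi.smul_def] using h.1.smul (Complex.I * (b j : ℂ))
  refine ⟨hmod _ h.1, hmod _ (h.2.1.add hbf), fun χ h1 h2 => ?_⟩
  have hin : ∀ x, HasFDerivAt (fun x : Space d => inner ℝ b x) (innerSL ℝ b) x :=
    fun x => (innerSL ℝ b).hasFDerivAt
  have hbj : inner ℝ b (EuclideanSpace.single j (1 : ℝ)) = b j := by
    simp [EuclideanSpace.inner_single_right]
  have hχ : ∀ x, HasFDerivAt χ (fderiv ℝ χ x) x := fun x =>
    (h1.differentiable (by simp) x).hasFDerivAt
  have hdχ : Continuous (fun x => fderiv ℝ χ x (EuclideanSpace.single j 1)) :=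
    (h1.continuous_fderiv (by simp)).clm_apply continuous_const
  have hsχ : HasCompactSupport (fun x => fderiv ℝ χ x (EuclideanSpace.single j 1)) :=
    (h2.fderiv (𝕜 := ℝ)).comp_left
      (g := fun L : Space d →L[ℝ] ℝ => L (EuclideanSpace.single j 1)) (by simp)
  have hint : ∀ (a : Space d → ℝ) (k : Space d → ℝ) (F : Space d → ℂ), Continuous a →
      HasCompactSupport a → Continuous k → LocallyIntegrable F →
      Integrable (fun x => (a x * k x) • F x) := by
    intro a k F ha hs hk hF
    exact hF.integrable_smul_left_of_hasCompactSupport (ha.mul hk) (hs.mul_right)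
  have hic : ContDiff ℝ (⊤ : ℕ∞) (fun x : Space d => (inner ℝ b x : ℝ)) :=
    (innerSL ℝ b).contDiff
  have hcos : ContDiff ℝ (⊤ : ℕ∞) (fun x : Space d => Real.cos (inner ℝ b x)) :=
    Real.contDiff_cos.comp hic
  have hsin : ContDiff ℝ (⊤ : ℕ∞) (fun x : Space d => Real.sin (inner ℝ b x)) :=
    Real.contDiff_sin.comp hic
  have e1 := h.2.2 _ (h1.mul hcos) h2.mul_right
  have e2 := h.2.2 _ (h1.mul hsin) h2.mul_right
  have d1 : ∀ x, fderiv ℝ (fun x => χ x * Real.cos (inner ℝ b x)) x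
      (EuclideanSpace.single j 1) =
      fderiv ℝ χ x (EuclideanSpace.single j 1) * Real.cos (inner ℝ b x) -
        χ x * Real.sin (inner ℝ b x) * b j := by
    intro x
    refine (congrArg (fun L : Space d →L[ℝ] ℝ => L (EuclideanSpace.single j 1))
      ((hχ x).mul (hin x).cos).fderiv).trans ?_
    simp [hbj]
    ring
  have d2 : ∀ x, fderiv ℝ (fun x => χ x * Real.sin (inner ℝ b x)) x
      (EuclideanSpace.single j 1) =
      fderiv ℝ χ x (EuclideanSpace.single j 1) * Real.sin (inner ℝ b x) +
        χ x * Real.cos (inner ℝ b x) * b j := by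
    intro x
    refine (congrArg (fun L : Space d →L[ℝ] ℝ => L (EuclideanSpace.single j 1))
      ((hχ x).mul (hin x).sin).fderiv).trans ?_
    simp [hbj]
    ring
  simp only [d1] at e1
  simp only [d2] at e2
  have i1 := hint _ _ f hdχ hsχ hcos.continuous h.1
  have i2 := hint _ _ f hdχ hsχ hsin.continuous h.1
  have i3 : Integrable (fun x => b j • ((χ x * Real.sin (inner ℝ b x)) • f x)) :=
    (hint _ _ f h1.continuous h2 hsin.continuous h.1).smul (b j)
  have i4 : Integrable (fun x => b j • ((χ x * Real.cos (inner ℝ b x)) • f x)) :=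
    (hint _ _ f h1.continuous h2 hcos.continuous h.1).smul (b j)
  have i5 := hint _ _ g h1.continuous h2 hcos.continuous h.2.1
  have i6 := hint _ _ g h1.continuous h2 hsin.continuous h.2.1
  have E1 : (∫ x, (fderiv ℝ χ x (EuclideanSpace.single j 1) * Real.cos (inner ℝ b x)) • f x) -
      (∫ x, b j • ((χ x * Real.sin (inner ℝ b x)) • f x)) =
      - ∫ x, (χ x * Real.cos (inner ℝ b x)) • g x := by
    rw [← e1, ← integral_sub i1 i3]
    refine integral_congr_ae (Filter.Eventually.of_forall fun x => ?_)
    simp only [Complex.real_smul]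
    push_cast
    ring
  have E2 : (∫ x, (fderiv ℝ χ x (EuclideanSpace.single j 1) * Real.sin (inner ℝ b x)) • f x) +
      (∫ x, b j • ((χ x * Real.cos (inner ℝ b x)) • f x)) =
      - ∫ x, (χ x * Real.sin (inner ℝ b x)) • g x := by
    rw [← e2, ← integral_add i2 i4]
    refine integral_congr_ae (Filter.Eventually.of_forall fun x => ?_)
    simp only [Complex.real_smul]
    push_cast
    ring
  have hexp : ∀ x, Complex.exp (Complex.I * ((inner ℝ b x : ℝ) : ℂ)) =
      (Real.cos (inner ℝ b x) : ℂ) + (Real.sin (inner ℝ b x) : ℂ) * Complex.I := by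
    intro x
    rw [mul_comm, Complex.exp_mul_I]
    push_cast
    rfl
  have L : ∫ x, fderiv ℝ χ x (EuclideanSpace.single j 1) • QuadraticNLS.modulate b f x =
      (∫ x, (fderiv ℝ χ x (EuclideanSpace.single j 1) * Real.cos (inner ℝ b x)) • f x) +
      Complex.I *
        ∫ x, (fderiv ℝ χ x (EuclideanSpace.single j 1) * Real.sin (inner ℝ b x)) • f x := by
    rw [← integral_const_mul, ← integral_add i1 (i2.const_mul _)]
    refine integral_congr_ae (Filter.Eventually.of_forall fun x => ?_)
    simp only [QuadraticNLS.modulate, hexp, Complex.real_smul]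
    push_cast
    ring
  have R : ∫ x, χ x • QuadraticNLS.modulate b (fun x => g x + Complex.I * (b j : ℂ) * f x) x =
      ((∫ x, (χ x * Real.cos (inner ℝ b x)) • g x) +
        Complex.I * ∫ x, (χ x * Real.sin (inner ℝ b x)) • g x) +
      (Complex.I * (∫ x, b j • ((χ x * Real.cos (inner ℝ b x)) • f x)) -
        ∫ x, b j • ((χ x * Real.sin (inner ℝ b x)) • f x)) := by
    rw [← integral_const_mul, ← integral_const_mul, ← integral_add i5 (i6.const_mul _),
      ← integral_sub (i4.const_mul _) i3]
    refine Eq.trans ?_ (integral_add (i5.add (i6.const_mul Complex.I))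
      ((i4.const_mul Complex.I).sub i3))
    refine integral_congr_ae (Filter.Eventually.of_forall fun x => ?_)
    simp only [QuadraticNLS.modulate, hexp, Complex.real_smul]
    push_cast
    linear_combination ((χ x : ℂ) * Complex.sin (inner ℝ b x : ℝ) * b j * f x) * Complex.I_sq
  rw [L, R]
  linear_combination E1 + Complex.I * E2

theorem gradSq_modulate {d : ℕ} {f : Space d → ℂ} (hf : IsH1 f) (b : Space d) :
    gradSq (modulate b f) = gradSq f + ‖b‖ ^ 2 * massSq f -
      2 * ∑ j, b j * (∫ x, Complex.I * weakPartial j f x * conj (f x)).re := by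
  have hj : ∀ j, ∫ x, ‖weakPartial j (modulate b f) x‖ ^ 2 =
      (∫ x, ‖weakPartial j f x‖ ^ 2) + b j ^ 2 * massSq f -
        2 * (b j * (∫ x, Complex.I * weakPartial j f x * conj (f x)).re) := by
    intro j
    obtain ⟨g, hg, hg2⟩ := hf.2 j
    have hw := hg.weakPartial
    have hw2 : MemLp (weakPartial j f) 2 := hg2.ae_eq hw.symm
    have i1 : Integrable (fun x => ‖weakPartial j f x‖ ^ 2) :=
      hw2.integrable_norm_pow (by norm_num)
    have i2 : Integrable (fun x => ‖f x‖ ^ 2) := hf.1.integrable_norm_pow (by norm_num)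
    have i3 : Integrable (fun x => Complex.I * weakPartial j f x * conj (f x)) := by
      have hc : MemLp (fun x => conj (f x)) 2 := hf.1.star
      have := (MemLp.integrable_mul hw2 hc).const_mul Complex.I
      simpa [mul_assoc] using this
    have hre : (∫ x, Complex.I * weakPartial j f x * conj (f x)).re =
        ∫ x, (Complex.I * weakPartial j f x * conj (f x)).re := (integral_re i3).symm
    rw [hre, massSq, ← integral_const_mul, ← integral_const_mul, ← integral_const_mul,
      ← integral_add i1 (i2.const_mul _)]
    refine Eq.trans ?_ (integral_sub (i1.add (i2.const_mul (b j ^ 2)))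
      ((i3.re.const_mul (b j)).const_mul 2))
    refine integral_congr_ae ?_
    filter_upwards [(hg.modulate b).weakPartial, hw] with x hx hx'
    simp only [hx, hx', modulate, norm_mul]
    have : ‖Complex.exp (Complex.I * ((inner ℝ b x : ℝ) : ℂ))‖ = 1 := by simp [Complex.norm_exp]
    rw [this, one_mul]
    simp only [← Complex.normSq_eq_norm_sq, Complex.normSq_apply]
    simp
    ring
  unfold gradSq
  simp only [hj, Finset.sum_sub_distrib, Finset.sum_add_distrib, ← Finset.sum_mul,
    ← Finset.mul_sum]
  rw [EuclideanSpace.norm_sq_eq]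
  simp

theorem action_eq_energy_charge_momentum {d : ℕ} {κ : ℝ} (hκ : 0 < κ) (ω : ℝ) (c : Space d)
    {p : Pair d} (h1 : IsH1 p.1) (h2 : IsH1 p.2) :
    action κ ω c p = energy κ p + ω * charge p + ∑ j, c j * momentum p j := by
  have s : ∀ (a : ℝ) (F : Fin d → ℝ), ∑ j, (a • c) j * F j = a * ∑ j, c j * F j := by
    intro a F
    simp [Finset.mul_sum, mul_assoc]
  have m : ∑ j, c j * momentum p j =
      1 / 2 * (∑ j, c j * (∫ x, Complex.I * weakPartial j p.1 x * conj (p.1 x)).re) +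
      1 / 2 * (∑ j, c j * (∫ x, Complex.I * weakPartial j p.2 x * conj (p.2 x)).re) := by
    rw [Finset.mul_sum, Finset.mul_sum, ← Finset.sum_add_distrib]
    refine Finset.sum_congr rfl fun j _ => ?_
    unfold momentum
    ring
  rw [m]
  unfold action quadraticPart energy charge
  rw [gradSq_modulate h1, gradSq_modulate h2, s, s]
  simp only [norm_smul, mul_pow, Real.norm_eq_abs, sq_abs]
  field_simp
  ring

end

end QuadraticNLS

open QuadraticNLS

/-!
Write `L` for the quadratic part of the action and `N = Re ∫ u² v̄`, so that `S = L - N`, where `L`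
is homogeneous of degree two and `N` of degree three. After the modulations by `e^{-ic·x/2}` and
`e^{-ic·x/(2κ)}` the form `L` is a sum of two Sobolev energies `‖∇f‖² + m ‖f‖²` (`sobEnergy`), with
masses `m ≥ 0` of which at least one is positive; the three regimes are instances of one abstract
problem (`PairSetting`, `exists_pairSetting`). On the Nehari manifold `2L = 3N` and `S = L/3`, so
by homogeneity minimizing the action there amounts to finding the best constant `M` in `N ≤ M
L^{3/2}`. By the Sobolev inequalities `M` is finite; a bump function shows `M > 0`.

The constant is attained (`PairSetting.exists_maximizer`), by concentration compactness. A
maximizing sequence with `L ≤ 1` does not vanish in the subcritical norm of a massive component,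
hence, after translations (which change the modulated components only by phases), a fixed
mollification of that component stays away from zero at the origin (`exists_bump_eLpNorm_le`,
`PairSetting.exists_translation`). A subsequence then converges in `L²` on bounded sets to a
nonzero limit `z`, along which `L` splits by weak convergence in a Hilbert space
(`exists_subseq_sobolev`) and `N` splits by a Brezis–Lieb argument
(`InteractionExponents.tendsto_interaction_split`). With `t = L z` this gives `1 ≤ t^{3/2} + (1 -
t)^{3/2}`, so `t = 1` and `z` is a maximizer. The massless component is handled in a weighted `L²`
space (`MassExponent.exists_weight`).

Minimizers on the Nehari manifold are the points of it where `N = M L^{3/2}`. There the nonnegative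
function `M L^{3/2} - N` has a minimum, and its derivative is that of the action, so minimizers are
critical points; conversely every critical point lies on the Nehari manifold. Hence the ground
states are exactly the minimizers (`groundStates_eq_nehariMinimizers`).

Testing criticality with smooth compactly supported pairs gives the weak form of the stationary
system (`PairSetting.isWeakStationary`). For the evolution equation a test function on space-time
is pulled back to the moving frame by the measure-preserving shear `(t, y) ↦ (t, y + t c)`; on each
time slice the stationary equation applies, and the remaining time derivative integrates to zero
(`IsWeakStationary.integral_travelingWave`).
-/

namespace QuadraticNLS

/-! ### Calculus of weak derivatives -/

section

variable {d : ℕ} {j : Fin d} {f g f' g' : Space d → ℂ}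

theorem continuous_fderiv_single {F : Type*} [NormedAddCommGroup F] [NormedSpace ℝ F]
    {χ : Space d → F} (h : ContDiff ℝ (⊤ : ℕ∞) χ) (j : Fin d) :
    Continuous (fun x => fderiv ℝ χ x (EuclideanSpace.single j 1)) :=
  (h.continuous_fderiv (by simp)).clm_apply continuous_const

theorem contDiff_fderiv_single {F : Type*} [NormedAddCommGroup F] [NormedSpace ℝ F]
    {χ : Space d → F} (h : ContDiff ℝ (⊤ : ℕ∞) χ) (j : Fin d) :
    ContDiff ℝ (⊤ : ℕ∞) (fun x => fderiv ℝ χ x (EuclideanSpace.single j 1)) :=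
  (h.fderiv_right (m := (⊤ : ℕ∞)) (by simp)).clm_apply contDiff_const

theorem hasCompactSupport_fderiv_single {F : Type*} [NormedAddCommGroup F] [NormedSpace ℝ F]
    {χ : Space d → F} (h : HasCompactSupport χ) (j : Fin d) :
    HasCompactSupport (fun x => fderiv ℝ χ x (EuclideanSpace.single j 1)) :=
  (h.fderiv (𝕜 := ℝ)).comp_left
    (g := fun L : Space d →L[ℝ] F => L (EuclideanSpace.single j 1)) (by simp)

theorem HasWeakPartial.congr (h : HasWeakPartial j f g) (hf : f =ᵐ[volume] f')
    (hg : g =ᵐ[volume] g') : HasWeakPartial j f' g' := by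
  refine ⟨h.1.congr hf, h.2.1.congr hg, fun χ h1 h2 => ?_⟩
  rw [integral_congr_ae (g := fun x => fderiv ℝ χ x (EuclideanSpace.single j 1) • f x),
    integral_congr_ae (f := fun x => χ x • g' x) (g := fun x => χ x • g x), h.2.2 χ h1 h2]
  · filter_upwards [hg] with x hx using by rw [hx]
  · filter_upwards [hf] with x hx using by rw [hx]

theorem HasWeakPartial.add (h : HasWeakPartial j f g) (h' : HasWeakPartial j f' g') :
    HasWeakPartial j (f + f') (g + g') := by
  refine ⟨h.1.add h'.1, h.2.1.add h'.2.1, fun χ h1 h2 => ?_⟩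
  have hd := continuous_fderiv_single h1 j
  have hs := hasCompactSupport_fderiv_single h2 j
  simp only [Pi.add_apply, smul_add]
  rw [integral_add (h.1.integrable_smul_left_of_hasCompactSupport hd hs)
      (h'.1.integrable_smul_left_of_hasCompactSupport hd hs),
    integral_add (h.2.1.integrable_smul_left_of_hasCompactSupport h1.continuous h2)
      (h'.2.1.integrable_smul_left_of_hasCompactSupport h1.continuous h2),
    h.2.2 χ h1 h2, h'.2.2 χ h1 h2]
  ring

theorem HasWeakPartial.const_mul (h : HasWeakPartial j f g) (z : ℂ) :
    HasWeakPartial j (fun x => z * f x) (fun x => z * g x) := by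
  refine ⟨h.1.smul z, h.2.1.smul z, fun χ h1 h2 => ?_⟩
  have := h.2.2 χ h1 h2
  simp only [← mul_smul_comm, integral_const_mul, this, mul_neg]

theorem HasWeakPartial.neg (h : HasWeakPartial j f g) : HasWeakPartial j (-f) (-g) := by
  simpa using h.const_smul (-1)

theorem HasWeakPartial.sub (h : HasWeakPartial j f g) (h' : HasWeakPartial j f' g') :
    HasWeakPartial j (f - f') (g - g') := by
  simpa [sub_eq_add_neg] using h.add h'.neg

theorem locallyIntegrable_comp_add_right (h : LocallyIntegrable f) (y : Space d) :
    LocallyIntegrable (fun x => f (x + y)) := by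
  have := (locallyIntegrable_map_homeomorph (Homeomorph.addRight y) (f := f)
    (μ := (volume : Measure (Space d)))).1
  simp only [Homeomorph.coe_addRight, map_add_right_eq_self] at this
  exact this h

theorem HasWeakPartial.comp_add_right (h : HasWeakPartial j f g) (y : Space d) :
    HasWeakPartial j (fun x => f (x + y)) (fun x => g (x + y)) := by
  refine ⟨locallyIntegrable_comp_add_right h.1 y, locallyIntegrable_comp_add_right h.2.1 y,
    fun χ h1 h2 => ?_⟩
  have h1' : ContDiff ℝ (⊤ : ℕ∞) (fun x => χ (x - y)) := h1.comp (by fun_prop)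
  have h2' : HasCompactSupport (fun x => χ (x - y)) := by
    simpa [sub_eq_add_neg, Function.comp_def] using
      h2.comp_homeomorph (Homeomorph.addRight (-y))
  have := h.2.2 _ h1' h2'
  simp only [fderiv_comp_sub] at this
  rw [← integral_add_right_eq_self _ y, ← integral_add_right_eq_self (fun x => χ (x - y) • g x) y]
    at this
  simpa using this

/-- The product rule for a smooth real factor. -/
theorem HasWeakPartial.smooth_smul (h : HasWeakPartial j f g) {ζ : Space d → ℝ}
    (hζ : ContDiff ℝ (⊤ : ℕ∞) ζ) :
    HasWeakPartial j (fun x => ζ x • f x)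
      (fun x => ζ x • g x + fderiv ℝ ζ x (EuclideanSpace.single j 1) • f x) := by
  have hd := continuous_fderiv_single hζ j
  have l1 : LocallyIntegrable (fun x => ζ x • f x) := by
    rw [← locallyIntegrableOn_univ] at *
    exact h.1.locallyIntegrableOn _ |>.continuousOn_smul (s := Set.univ)
      isOpen_univ.isLocallyClosed hζ.continuous.continuousOn
  have l2 : LocallyIntegrable (fun x => ζ x • g x) := by
    rw [← locallyIntegrableOn_univ] at *
    exact h.2.1.locallyIntegrableOn _ |>.continuousOn_smul (s := Set.univ)
      isOpen_univ.isLocallyClosed hζ.continuous.continuousOn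
  have l3 : LocallyIntegrable (fun x => fderiv ℝ ζ x (EuclideanSpace.single j 1) • f x) := by
    rw [← locallyIntegrableOn_univ] at *
    exact h.1.locallyIntegrableOn _ |>.continuousOn_smul (s := Set.univ)
      isOpen_univ.isLocallyClosed hd.continuousOn
  refine ⟨l1, l2.add l3, fun χ h1 h2 => ?_⟩
  have := h.2.2 _ (h1.mul hζ) h2.mul_right
  have d1 : ∀ x, fderiv ℝ (fun x => χ x * ζ x) x (EuclideanSpace.single j 1) =
      fderiv ℝ χ x (EuclideanSpace.single j 1) * ζ x +
        χ x * fderiv ℝ ζ x (EuclideanSpace.single j 1) := by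
    intro x
    rw [fderiv_fun_mul (h1.differentiable (by simp) x) (hζ.differentiable (by simp) x)]
    simp
    ring
  have i1 := l1.integrable_smul_left_of_hasCompactSupport (continuous_fderiv_single h1 j)
    (hasCompactSupport_fderiv_single h2 j)
  have i2 := l3.integrable_smul_left_of_hasCompactSupport h1.continuous h2
  have i3 := l2.integrable_smul_left_of_hasCompactSupport h1.continuous h2
  simp only [d1, add_smul, mul_smul] at this
  rw [integral_add i1 i2] at this
  simp only [smul_add]
  rw [integral_add i3 i2]
  linear_combination this

/-- Complex-valued test functions may be used as well. -/
theorem HasWeakPartial.integral_complex (h : HasWeakPartial j f g) {η : Space d → ℂ}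
    (h1 : ContDiff ℝ (⊤ : ℕ∞) η) (h2 : HasCompactSupport η) :
    ∫ x, fderiv ℝ η x (EuclideanSpace.single j 1) * f x = - ∫ x, η x * g x := by
  have r1 : ContDiff ℝ (⊤ : ℕ∞) (fun x => (η x).re) := Complex.reCLM.contDiff.comp h1
  have m1 : ContDiff ℝ (⊤ : ℕ∞) (fun x => (η x).im) := Complex.imCLM.contDiff.comp h1
  have r2 : HasCompactSupport (fun x => (η x).re) := h2.comp_left (g := Complex.re) rfl
  have m2 : HasCompactSupport (fun x => (η x).im) := h2.comp_left (g := Complex.im) rfl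
  have dr : ∀ x, fderiv ℝ (fun x => (η x).re) x (EuclideanSpace.single j 1) =
      (fderiv ℝ η x (EuclideanSpace.single j 1)).re := by
    intro x
    have := (Complex.reCLM.hasFDerivAt.comp x
      (h1.differentiable (by simp) x).hasFDerivAt).fderiv
    exact congrArg (fun L : Space d →L[ℝ] ℝ => L (EuclideanSpace.single j 1)) this
  have dm : ∀ x, fderiv ℝ (fun x => (η x).im) x (EuclideanSpace.single j 1) =
      (fderiv ℝ η x (EuclideanSpace.single j 1)).im := by
    intro x
    have := (Complex.imCLM.hasFDerivAt.comp x
      (h1.differentiable (by simp) x).hasFDerivAt).fderiv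
    exact congrArg (fun L : Space d →L[ℝ] ℝ => L (EuclideanSpace.single j 1)) this
  have e1 := h.2.2 _ r1 r2
  have e2 := h.2.2 _ m1 m2
  have key : ∀ (a : Space d → ℂ) (b : Space d → ℂ), LocallyIntegrable b → Continuous a →
      HasCompactSupport a → ∫ x, a x * b x = (∫ x, (a x).re • b x) +
        Complex.I * ∫ x, (a x).im • b x := by
    intro a b hb ha hs
    have i1 : Integrable (fun x => (a x).re • b x) :=
      hb.integrable_smul_left_of_hasCompactSupport (Complex.continuous_re.comp ha)
        (hs.comp_left (g := Complex.re) rfl)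
    have i2 : Integrable (fun x => (a x).im • b x) :=
      hb.integrable_smul_left_of_hasCompactSupport (Complex.continuous_im.comp ha)
        (hs.comp_left (g := Complex.im) rfl)
    rw [← integral_const_mul, ← integral_add i1 (i2.const_mul _)]
    refine integral_congr_ae (Filter.Eventually.of_forall fun x => ?_)
    simp only [Complex.real_smul]
    nth_rewrite 1 [← Complex.re_add_im (a x)]
    ring
  rw [key _ _ h.1 (continuous_fderiv_single h1 j) (hasCompactSupport_fderiv_single h2 j),
    key _ _ h.2.1 h1.continuous h2]
  simp only [← dr, ← dm]
  rw [e1, e2]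
  ring

theorem hasWeakPartial_of_contDiff {η : Space d → ℂ} (h1 : ContDiff ℝ (⊤ : ℕ∞) η) (j : Fin d) :
    HasWeakPartial j η (fun x => fderiv ℝ η x (EuclideanSpace.single j 1)) := by
  have c := continuous_fderiv_single h1 j
  refine ⟨h1.continuous.locallyIntegrable, c.locallyIntegrable, fun χ h3 h4 => ?_⟩
  have := integral_smul_fderiv_eq_neg_fderiv_smul_of_integrable (μ := (volume : Measure (Space d)))
    (f := χ) (g := η) (v := EuclideanSpace.single j 1)
    (h1.continuous.locallyIntegrable.integrable_smul_left_of_hasCompactSupport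
      (continuous_fderiv_single h3 j) (hasCompactSupport_fderiv_single h4 j))
    (c.locallyIntegrable.integrable_smul_left_of_hasCompactSupport h3.continuous h4)
    (h1.continuous.locallyIntegrable.integrable_smul_left_of_hasCompactSupport h3.continuous h4)
    (fun x _ => h3.differentiable (by simp) x) (fun x _ => h1.differentiable (by simp) x)
  rw [this, neg_neg]

/-- The weak gradient of `f` exists and is square integrable. -/
def HasL2Grad (f : Space d → ℂ) : Prop := ∀ j : Fin d, ∃ g, HasWeakPartial j f g ∧ MemLp g 2

theorem HasL2Grad.hasWeakPartial (h : HasL2Grad f) (j : Fin d) :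
    HasWeakPartial j f (weakPartial j f) := by
  obtain ⟨g, hg, -⟩ := h j
  exact hg.congr (Filter.EventuallyEq.refl _ _) hg.weakPartial.symm

theorem HasL2Grad.memLp (h : HasL2Grad f) (j : Fin d) : MemLp (weakPartial j f) 2 := by
  obtain ⟨g, hg, hg2⟩ := h j
  exact hg2.ae_eq hg.weakPartial.symm

theorem HasL2Grad.add (h : HasL2Grad f) (h' : HasL2Grad f') : HasL2Grad (f + f') := fun j =>
  ⟨_, (h.hasWeakPartial j).add (h'.hasWeakPartial j), (h.memLp j).add (h'.memLp j)⟩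

theorem HasL2Grad.sub (h : HasL2Grad f) (h' : HasL2Grad f') : HasL2Grad (f - f') := fun j =>
  ⟨_, (h.hasWeakPartial j).sub (h'.hasWeakPartial j), (h.memLp j).sub (h'.memLp j)⟩

theorem HasL2Grad.const_smul (h : HasL2Grad f) (s : ℝ) : HasL2Grad (s • f) := fun j =>
  ⟨_, (h.hasWeakPartial j).const_smul s, (h.memLp j).const_smul s⟩

theorem HasL2Grad.const_mul (h : HasL2Grad f) (z : ℂ) : HasL2Grad (fun x => z * f x) := fun j =>
  ⟨_, (h.hasWeakPartial j).const_mul z, (h.memLp j).const_mul z⟩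

theorem HasL2Grad.comp_add_right (h : HasL2Grad f) (y : Space d) :
    HasL2Grad (fun x => f (x + y)) := fun j =>
  ⟨_, (h.hasWeakPartial j).comp_add_right y,
    (h.memLp j).comp_measurePreserving (measurePreserving_add_right volume y)⟩

end

/-! ### Mollification -/

section

theorem eLpNorm_two_sq {α E : Type*} [MeasurableSpace α] [NormedAddCommGroup E] (μ : Measure α)
    (f : α → E) : eLpNorm f 2 μ ^ 2 = ∫⁻ x, ‖f x‖ₑ ^ 2 ∂μ := by
  have := eLpNorm_nnreal_pow_eq_lintegral (μ := μ) (f := f) (p := 2) (by norm_num)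
  simpa using this

theorem ENNReal_le_of_sq_le {a b : ENNReal} (h : a ^ 2 ≤ b ^ 2) : a ≤ b := by
  by_contra! hc
  exact absurd h (not_le.2 (ENNReal.pow_lt_pow_left (by norm_num) hc))

/-- Minkowski's inequality: the `L²` norm of an average of functions is at most the supremum of
their `L²` norms. -/
theorem eLpNorm_two_average_le {α T E : Type*} [MeasurableSpace α] [MeasurableSpace T]
    [NormedAddCommGroup E] [NormedSpace ℝ E] {μ : Measure α} [SFinite μ] {ν : Measure T}
    [IsProbabilityMeasure ν] {F : α → T → E}
    (hF : AEStronglyMeasurable (Function.uncurry F) (μ.prod ν)) {K : ENNReal}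
    (hK : ∀ᵐ t ∂ν, eLpNorm (fun x => F x t) 2 μ ≤ K) :
    eLpNorm (fun x => ∫ t, F x t ∂ν) 2 μ ≤ K := by
  refine ENNReal_le_of_sq_le ?_
  have hm : AEMeasurable (Function.uncurry fun x t => ‖F x t‖ₑ ^ 2) (μ.prod ν) :=
    hF.enorm.pow_const 2
  calc eLpNorm (fun x => ∫ t, F x t ∂ν) 2 μ ^ 2 = ∫⁻ x, ‖∫ t, F x t ∂ν‖ₑ ^ 2 ∂μ :=
        eLpNorm_two_sq _ _
    _ ≤ ∫⁻ x, ∫⁻ t, ‖F x t‖ₑ ^ 2 ∂ν ∂μ := by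
        refine lintegral_mono_ae ?_
        filter_upwards [hF.prodMk_left] with x hx
        rw [← eLpNorm_two_sq]
        gcongr
        refine (enorm_integral_le_lintegral_enorm _).trans ?_
        rw [← eLpNorm_one_eq_lintegral_enorm]
        exact eLpNorm_le_eLpNorm_of_exponent_le (by norm_num) hx
    _ = ∫⁻ t, ∫⁻ x, ‖F x t‖ₑ ^ 2 ∂μ ∂ν := lintegral_lintegral_swap hm
    _ ≤ ∫⁻ t, K ^ 2 ∂ν := by
        refine lintegral_mono_ae ?_
        filter_upwards [hK] with t ht
        rw [← eLpNorm_two_sq]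
        gcongr
    _ = K ^ 2 := by simp

variable {d : ℕ} {j : Fin d} {f g f' g' : Space d → ℂ}

/-- The mollification of `f` by a normalized bump function. -/
noncomputable def mollify (φ : ContDiffBump (0 : Space d)) (f : Space d → ℂ) : Space d → ℂ :=
  convolution (φ.normed volume) f (ContinuousLinearMap.lsmul ℝ ℝ) volume

/-- The probability measure whose density is a normalized bump function. -/
noncomputable def bumpMeasure (φ : ContDiffBump (0 : Space d)) : Measure (Space d) :=
  volume.withDensity (fun y => ENNReal.ofReal (φ.normed volume y))

theorem measurable_bump (φ : ContDiffBump (0 : Space d)) :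
    Measurable (fun y => ENNReal.ofReal (φ.normed volume y)) :=
  (φ.continuous_normed.measurable).ennreal_ofReal

instance (φ : ContDiffBump (0 : Space d)) : IsProbabilityMeasure (bumpMeasure φ) := by
  constructor
  rw [bumpMeasure, withDensity_apply _ MeasurableSet.univ, Measure.restrict_univ,
    ← ofReal_integral_eq_lintegral_ofReal φ.integrable_normed
      (Filter.Eventually.of_forall φ.nonneg_normed), φ.integral_normed]
  simp

theorem integral_bumpMeasure (φ : ContDiffBump (0 : Space d)) (F : Space d → ℂ) :
    ∫ y, F y ∂(bumpMeasure φ) = ∫ y, φ.normed volume y • F y := by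
  rw [bumpMeasure, integral_withDensity_eq_integral_toReal_smul (measurable_bump φ)
    (Filter.Eventually.of_forall fun _ => ENNReal.ofReal_lt_top)]
  simp [ENNReal.toReal_ofReal (φ.nonneg_normed _)]

theorem mollify_eq (φ : ContDiffBump (0 : Space d)) (f : Space d → ℂ) (x : Space d) :
    mollify φ f x = ∫ y, φ.normed volume (x - y) • f y := by
  rw [mollify, convolution_lsmul_swap]

theorem mollify_eq_average (φ : ContDiffBump (0 : Space d)) (f : Space d → ℂ) (x : Space d) :
    mollify φ f x = ∫ y, f (x - y) ∂(bumpMeasure φ) := by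
  rw [mollify, convolution_lsmul, integral_bumpMeasure]

theorem contDiff_mollify (φ : ContDiffBump (0 : Space d)) (hf : LocallyIntegrable f) :
    ContDiff ℝ (⊤ : ℕ∞) (mollify φ f) :=
  φ.hasCompactSupport_normed.contDiff_convolution_left _ φ.contDiff_normed hf

theorem hasCompactSupport_mollify (φ : ContDiffBump (0 : Space d)) (hf : HasCompactSupport f) :
    HasCompactSupport (mollify φ f) :=
  φ.hasCompactSupport_normed.convolution _ hf

/-- Mollification commutes with weak derivatives. -/
theorem fderiv_mollify (φ : ContDiffBump (0 : Space d)) (h : HasWeakPartial j f g) (x : Space d) :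
    fderiv ℝ (mollify φ f) x (EuclideanSpace.single j 1) = mollify φ g x := by
  have hφ : ContDiff ℝ (⊤ : ℕ∞) (φ.normed volume) := φ.contDiff_normed
  have hs : HasCompactSupport (φ.normed volume) := φ.hasCompactSupport_normed
  have h1 := (hs.hasFDerivAt_convolution_left (ContinuousLinearMap.lsmul ℝ ℝ)
    (φ.contDiff_normed (n := 1)) h.1 x).fderiv
  rw [mollify, h1, convolution_eq_swap]
  have i1 : Integrable (fun t => ((ContinuousLinearMap.lsmul ℝ ℝ).precompL (Space d))
      (fderiv ℝ (φ.normed volume) (x - t)) (f t)) := by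
    have c : Continuous (fun t => fderiv ℝ (φ.normed volume) (x - t)) :=
      (hφ.continuous_fderiv (by simp)).comp (by fun_prop)
    have := (hs.fderiv (𝕜 := ℝ)).convolutionExists_left
      ((ContinuousLinearMap.lsmul ℝ ℝ : ℝ →L[ℝ] ℂ →L[ℝ] ℂ).precompL (Space d))
      (hφ.continuous_fderiv (by simp)) h.1 x
    exact this.integrable_swap
  rw [ContinuousLinearMap.integral_apply i1, mollify_eq]
  have h2 := h.2.2 (fun t => φ.normed volume (x - t)) (hφ.comp (by fun_prop)) (by
    have := hs.comp_homeomorph (Homeomorph.subLeft x)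
    simpa [Function.comp_def] using this)
  have e : ∀ t, fderiv ℝ (fun t => φ.normed volume (x - t)) t (EuclideanSpace.single j 1) =
      - fderiv ℝ (φ.normed volume) (x - t) (EuclideanSpace.single j 1) := by
    intro t
    have a1 : HasFDerivAt (fun t : Space d => x - t) (-ContinuousLinearMap.id ℝ (Space d)) t := by
      simpa using (hasFDerivAt_id t).const_sub x
    have a2 := ((hφ.differentiable (by simp) (x - t)).hasFDerivAt.comp t a1).fderiv
    exact (congrArg (fun L : Space d →L[ℝ] ℝ => L (EuclideanSpace.single j 1)) a2).trans (by simp)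
  simp only [e, neg_smul, integral_neg] at h2
  rw [neg_inj] at h2
  exact h2

theorem aestronglyMeasurable_sub_bump (φ : ContDiffBump (0 : Space d))
    (hf : AEStronglyMeasurable f volume) :
    AEStronglyMeasurable (Function.uncurry fun x y : Space d => f (x - y))
      (volume.prod (bumpMeasure φ)) :=
  hf.comp_quasiMeasurePreserving (quasiMeasurePreserving_sub volume (bumpMeasure φ))

theorem eLpNorm_comp_sub_right (hf : AEStronglyMeasurable f volume) (y : Space d)
    (p : ENNReal) : eLpNorm (fun x => f (x - y)) p volume = eLpNorm f p volume :=
  eLpNorm_comp_measurePreserving hf (measurePreserving_sub_right volume y)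

theorem eLpNorm_mollify_le (φ : ContDiffBump (0 : Space d))
    (hf : AEStronglyMeasurable f volume) :
    eLpNorm (mollify φ f) 2 volume ≤ eLpNorm f 2 volume := by
  have : mollify φ f = fun x => ∫ y, f (x - y) ∂(bumpMeasure φ) :=
    funext fun x => mollify_eq_average φ f x
  rw [this]
  exact eLpNorm_two_average_le (aestronglyMeasurable_sub_bump φ hf)
    (Filter.Eventually.of_forall fun y => (eLpNorm_comp_sub_right hf y 2).le)

/-- A sequence of bump functions shrinking to the origin. -/
noncomputable def bumpSeq (d : ℕ) (n : ℕ) : ContDiffBump (0 : Space d) where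
  rIn := 1 / (n + 1)
  rOut := 2 / (n + 1)
  rIn_pos := by positivity
  rIn_lt_rOut := by gcongr; norm_num

theorem tendsto_bumpSeq_rOut (d : ℕ) :
    Filter.Tendsto (fun n => (bumpSeq d n).rOut) Filter.atTop (nhds 0) := by
  have := (tendsto_one_div_add_atTop_nhds_zero_nat (𝕜 := ℝ)).const_mul 2
  simpa [bumpSeq, div_eq_mul_inv] using this

theorem ae_tendsto_mollify (hf : LocallyIntegrable f) :
    ∀ᵐ x, Filter.Tendsto (fun n => mollify (bumpSeq d n) f x) Filter.atTop (nhds (f x)) :=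
  ContDiffBump.ae_convolution_tendsto_right_of_locallyIntegrable (K := 2)
    (tendsto_bumpSeq_rOut d)
    (Filter.Eventually.of_forall fun n => by simp [bumpSeq, div_eq_mul_inv]) hf

theorem abs_apply_le_norm (y : Space d) (j : Fin d) : |y j| ≤ ‖y‖ := by
  have := PiLp.norm_apply_le y j
  simpa using this

/-- The sum of the `L²` norms of the partial derivatives bounds that of any directional
derivative. -/
theorem eLpNorm_fderiv_apply_le {f : Space d → ℂ} (hf : ContDiff ℝ (⊤ : ℕ∞) f) (y : Space d) :
    eLpNorm (fun x => fderiv ℝ f x y) 2 volume ≤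
      ENNReal.ofReal ‖y‖ *
        ∑ j, eLpNorm (fun x => fderiv ℝ f x (EuclideanSpace.single j 1)) 2 volume := by
  have e : (fun x => fderiv ℝ f x y) =
      ∑ j, y j • fun x => fderiv ℝ f x (EuclideanSpace.single j 1) := by
    ext x
    have hy : y = ∑ j, y j • EuclideanSpace.single j (1 : ℝ) := by
      conv_lhs => rw [← (EuclideanSpace.basisFun (Fin d) ℝ).sum_repr y]
      simp
    conv_lhs => rw [hy]
    simp
  rw [e, Finset.mul_sum]
  refine (eLpNorm_sum_le (fun j _ => ?_) (by norm_num)).trans (Finset.sum_le_sum fun j _ => ?_)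
  · exact (continuous_fderiv_single hf j).aestronglyMeasurable.const_smul _
  · refine (eLpNorm_const_smul_le).trans ?_
    gcongr
    rw [← ofReal_norm]
    exact ENNReal.ofReal_le_ofReal (abs_apply_le_norm y j)

/-- The smooth case: the difference is an average of directional derivatives along the segment from
`x - y` to `x`. -/
theorem eLpNorm_translate_sub_le_of_contDiff (hf : ContDiff ℝ (⊤ : ℕ∞) f) (y : Space d) :
    eLpNorm (fun x => f (x - y) - f x) 2 volume ≤ ENNReal.ofReal ‖y‖ *
      ∑ j, eLpNorm (fun x => fderiv ℝ f x (EuclideanSpace.single j 1)) 2 volume := by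
  let ν : Measure ℝ := volume.restrict (Set.Ioc 0 1)
  have : IsProbabilityMeasure ν := ⟨by simp [ν]⟩
  have hc : Continuous (fun z : Space d × ℝ => fderiv ℝ f (z.1 - z.2 • y) (-y)) :=
    ((hf.continuous_fderiv (by simp)).comp (by fun_prop)).clm_apply continuous_const
  have e : (fun x => f (x - y) - f x) = fun x => ∫ t, fderiv ℝ f (x - t • y) (-y) ∂ν := by
    ext x
    have h1 : ∀ t ∈ Set.uIcc (0 : ℝ) 1, HasDerivAt (fun t : ℝ => f (x - t • y))
        (fderiv ℝ f (x - t • y) (-y)) t := by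
      intro t _
      have a1 : HasDerivAt (fun t : ℝ => x - t • y) (-y) t := by
        simpa using ((hasDerivAt_id t).smul_const y).const_sub x
      exact (hf.differentiable (by simp) _).hasFDerivAt.comp_hasDerivAt t a1
    have hc' : Continuous (fun t : ℝ => fderiv ℝ f (x - t • y) (-y)) :=
      hc.comp (by fun_prop : Continuous fun t : ℝ => (x, t))
    have := intervalIntegral.integral_eq_sub_of_hasDerivAt h1 (hc'.intervalIntegrable 0 1)
    rw [intervalIntegral.integral_of_le zero_le_one] at this
    rw [this]
    simp
  rw [e]
  refine eLpNorm_two_average_le (F := fun x t => fderiv ℝ f (x - t • y) (-y))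
    hc.aestronglyMeasurable (Filter.Eventually.of_forall fun t => ?_)
  have hc2 : Continuous (fun x => fderiv ℝ f x (-y)) :=
    (hf.continuous_fderiv (by simp)).clm_apply continuous_const
  rw [eLpNorm_comp_sub_right hc2.aestronglyMeasurable (t • y) 2]
  simpa using eLpNorm_fderiv_apply_le hf (-y)

/-- Translations are Lipschitz in `L²` on functions with square integrable gradient. -/
theorem eLpNorm_translate_sub_le {f : Space d → ℂ} (hf : HasL2Grad f) (hfi : LocallyIntegrable f)
    (y : Space d) :
    eLpNorm (fun x => f (x - y) - f x) 2 volume ≤ ENNReal.ofReal ‖y‖ *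
      ∑ j, eLpNorm (weakPartial j f) 2 volume := by
  have hae := ae_tendsto_mollify hfi
  have hae' :=
    (measurePreserving_sub_right (volume : Measure (Space d)) y).quasiMeasurePreserving.ae hae
  refine (Lp.eLpNorm_lim_le_liminf_eLpNorm
    (f := fun n x => mollify (bumpSeq d n) f (x - y) - mollify (bumpSeq d n) f x)
    (fun n => ?_) _ ?_).trans ?_
  · have := (contDiff_mollify (bumpSeq d n) hfi).continuous
    exact Continuous.aestronglyMeasurable (by fun_prop)
  · filter_upwards [hae, hae'] with x h1 h2 using h2.sub h1
  · refine Filter.liminf_le_of_le (by isBoundedDefault) fun b hb => ?_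
    obtain ⟨n, hn⟩ := hb.exists
    refine hn.trans ((eLpNorm_translate_sub_le_of_contDiff
      (contDiff_mollify (bumpSeq d n) hfi) y).trans ?_)
    gcongr with j
    simp only [fderiv_mollify _ (hf.hasWeakPartial j)]
    exact eLpNorm_mollify_le _ (hf.memLp j).1

/-- The mollification error is controlled by the gradient. -/
theorem eLpNorm_mollify_sub_le {f : Space d → ℂ} (hf : HasL2Grad f) (hfi : LocallyIntegrable f)
    (φ : ContDiffBump (0 : Space d)) :
    eLpNorm (mollify φ f - f) 2 volume ≤ ENNReal.ofReal φ.rOut *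
      ∑ j, eLpNorm (weakPartial j f) 2 volume := by
  have e : mollify φ f - f = fun x => ∫ y, (f (x - y) - f x) ∂(bumpMeasure φ) := by
    ext x
    have hi : Integrable (fun y => f (x - y)) (bumpMeasure φ) := by
      rw [bumpMeasure, integrable_withDensity_iff_integrable_smul' (measurable_bump φ)
        (Filter.Eventually.of_forall fun _ => ENNReal.ofReal_lt_top)]
      simp only [ENNReal.toReal_ofReal (φ.nonneg_normed _)]
      have := (φ.hasCompactSupport_normed (μ := volume)).convolutionExists_left
        (ContinuousLinearMap.lsmul ℝ ℝ) φ.continuous_normed hfi x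
      exact this.integrable
    rw [integral_sub hi (integrable_const _)]
    simp [mollify_eq_average]
  rw [e]
  refine eLpNorm_two_average_le (F := fun x y => f (x - y) - f x) ?_ ?_
  · exact (aestronglyMeasurable_sub_bump φ hfi.aestronglyMeasurable).sub
      hfi.aestronglyMeasurable.comp_fst
  · rw [bumpMeasure, ae_withDensity_iff (measurable_bump φ)]
    refine Filter.Eventually.of_forall fun y hy => ?_
    refine (eLpNorm_translate_sub_le hf hfi y).trans ?_
    gcongr
    have : y ∈ Function.support (φ.normed volume) := by
      intro h0
      simp [h0] at hy
    rw [φ.support_normed_eq] at this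
    exact (mem_ball_zero_iff.1 this).le

end

/-! ### Sobolev inequalities -/

section

variable {d : ℕ}

theorem opNorm_le_sum_single {F : Type*} [NormedAddCommGroup F] [NormedSpace ℝ F]
    (L : Space d →L[ℝ] F) : ‖L‖ ≤ ∑ j, ‖L (EuclideanSpace.single j 1)‖ := by
  refine L.opNorm_le_bound (Finset.sum_nonneg fun _ _ => norm_nonneg _) fun y => ?_
  have hy : y = ∑ j, y j • EuclideanSpace.single j (1 : ℝ) := by
    conv_lhs => rw [← (EuclideanSpace.basisFun (Fin d) ℝ).sum_repr y]
    simp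
  conv_lhs => rw [hy]
  rw [map_sum, Finset.sum_mul]
  refine (norm_sum_le _ _).trans (Finset.sum_le_sum fun j _ => ?_)
  rw [map_smul, norm_smul, mul_comm]
  gcongr
  exact abs_apply_le_norm y j

theorem eLpNorm_fderiv_le_sum {u : Space d → ℂ} (hu : ContDiff ℝ (⊤ : ℕ∞) u) :
    eLpNorm (fderiv ℝ u) 2 volume ≤
      ∑ j, eLpNorm (fun x => fderiv ℝ u x (EuclideanSpace.single j 1)) 2 volume := by
  have h1 : eLpNorm (fderiv ℝ u) 2 volume ≤
      eLpNorm (∑ j, fun x => ‖fderiv ℝ u x (EuclideanSpace.single j 1)‖) 2 volume := by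
    refine eLpNorm_mono_real fun x => ?_
    simpa using opNorm_le_sum_single (fderiv ℝ u x)
  refine h1.trans ((eLpNorm_sum_le (fun j _ => ?_) (by norm_num)).trans
    (Finset.sum_le_sum fun j _ => ?_))
  · exact (continuous_fderiv_single hu j).norm.aestronglyMeasurable
  · exact (eLpNorm_norm _).le

/-- The Sobolev inequality for test functions, in the homogeneous form. -/
theorem exists_eLpNorm_le_grad (hd : 3 ≤ d) : ∃ C : NNReal, ∀ u : Space d → ℂ,
    ContDiff ℝ (⊤ : ℕ∞) u → HasCompactSupport u →
    eLpNorm u (ENNReal.ofReal (2 * (d : ℝ) / ((d : ℝ) - 2))) volume ≤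
      C * ∑ j, eLpNorm (fun x => fderiv ℝ u x (EuclideanSpace.single j 1)) 2 volume := by
  have hd' : (3 : ℝ) ≤ d := by exact_mod_cast hd
  refine ⟨SNormLESNormFDerivOfEqConst ℂ (volume : Measure (Space d)) (2 : NNReal),
    fun u h1 h2 => ?_⟩
  have := eLpNorm_le_eLpNorm_fderiv_of_eq (volume : Measure (Space d))
    (h1.of_le (by exact_mod_cast le_top)) h2
    (p := 2) (p' := (2 * (d : ℝ) / ((d : ℝ) - 2)).toNNReal) (by norm_num)
    (by simp only [finrank_euclideanSpace, Fintype.card_fin]; omega) (by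
      rw [Real.coe_toNNReal _ (by apply div_nonneg <;> linarith)]
      simp only [finrank_euclideanSpace, Fintype.card_fin]
      have : (d : ℝ) - 2 ≠ 0 := by linarith
      have : (d : ℝ) ≠ 0 := by linarith
      push_cast
      field_simp)
  refine this.trans ?_
  gcongr
  exact eLpNorm_fderiv_le_sum h1

theorem eLpNorm_prod_mul {α β : Type*} [MeasurableSpace α] [MeasurableSpace β]
    {μ : Measure α} {ν : Measure β} [SFinite ν] {p : NNReal} (hp : p ≠ 0) {f : α → ℝ} {g : β → ℝ}
    (hf : AEStronglyMeasurable f μ) (hg : AEStronglyMeasurable g ν) :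
    eLpNorm (fun z : α × β => f z.1 * g z.2) p (μ.prod ν) = eLpNorm f p μ * eLpNorm g p ν := by
  have hp' : 0 < (p : ℝ) := by exact_mod_cast pos_iff_ne_zero.2 hp
  apply (ENNReal.rpow_left_injective hp'.ne')
  simp only
  rw [ENNReal.mul_rpow_of_nonneg _ _ hp'.le, eLpNorm_nnreal_pow_eq_lintegral hp,
    eLpNorm_nnreal_pow_eq_lintegral hp, eLpNorm_nnreal_pow_eq_lintegral hp,
    ← lintegral_prod_mul (hf.enorm.pow_const _) (hg.enorm.pow_const _)]
  refine lintegral_congr fun z => ?_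
  rw [enorm_mul, ENNReal.mul_rpow_of_nonneg _ _ hp'.le]

/-- The Sobolev inequality for test functions in dimension at most three, in the inhomogeneous form.
It is the three-dimensional inequality for the product with a fixed bump function of the
remaining variables. -/
theorem exists_eLpNorm_six_le (hd : d ≤ 3) : ∃ C : NNReal, ∀ u : Space d → ℂ,
    ContDiff ℝ (⊤ : ℕ∞) u → HasCompactSupport u →
    eLpNorm u 6 volume ≤ C * (eLpNorm u 2 volume +
      ∑ j, eLpNorm (fun x => fderiv ℝ u x (EuclideanSpace.single j 1)) 2 volume) := by
  let φ : ContDiffBump (0 : Space (3 - d)) := ⟨1, 2, by norm_num, by norm_num⟩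
  let μ : Measure (Space d × Space (3 - d)) := volume.prod volume
  have hφ : ContDiff ℝ (⊤ : ℕ∞) φ := φ.contDiff
  have hφs : HasCompactSupport φ := φ.hasCompactSupport
  let S := SNormLESNormFDerivOfEqConst ℂ μ (2 : NNReal)
  have m2 : MemLp φ 2 volume := φ.continuous.memLp_of_hasCompactSupport hφs
  have m6 : MemLp φ 6 volume := φ.continuous.memLp_of_hasCompactSupport hφs
  have m2' : MemLp (fderiv ℝ φ) 2 volume :=
    (hφ.continuous_fderiv (by simp)).memLp_of_hasCompactSupport (hφs.fderiv (𝕜 := ℝ))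
  have p6 : eLpNorm φ 6 volume ≠ 0 := by
    intro h0
    rw [eLpNorm_eq_zero_iff m6.1 (by norm_num)] at h0
    have := congrFun ((φ.continuous.ae_eq_iff_eq _ continuous_zero).1 h0) 0
    simp [φ.one_of_mem_closedBall (x := 0) (by simp [φ.rIn_pos.le])] at this
  set a := eLpNorm φ 2 volume
  set b := eLpNorm (fderiv ℝ φ) 2 volume
  set e := eLpNorm φ 6 volume
  have hfin : e⁻¹ * (S * (a + b)) ≠ ⊤ := by
    refine ENNReal.mul_ne_top (ENNReal.inv_ne_top.2 p6) (ENNReal.mul_ne_top ENNReal.coe_ne_top ?_)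
    exact ENNReal.add_ne_top.2 ⟨m2.2.ne, m2'.2.ne⟩
  refine ⟨(e⁻¹ * (S * (a + b))).toNNReal, fun u h1 h2 => ?_⟩
  rw [ENNReal.coe_toNNReal hfin]
  let F : Space d × Space (3 - d) → ℂ := fun z => φ z.2 • u z.1
  have hF : ContDiff ℝ (⊤ : ℕ∞) F := (hφ.comp contDiff_snd).smul (h1.comp contDiff_fst)
  have hFs : HasCompactSupport F := by
    refine HasCompactSupport.intro (h2.isCompact.prod hφs.isCompact) fun z hz => ?_
    by_cases hz1 : z.1 ∈ tsupport u
    · have : z.2 ∉ tsupport φ := fun h => hz ⟨hz1, h⟩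
      simp [F, image_eq_zero_of_notMem_tsupport this]
    · simp [F, image_eq_zero_of_notMem_tsupport hz1]
  have key := eLpNorm_le_eLpNorm_fderiv_of_eq μ (hF.of_le (by exact_mod_cast le_top)) hFs
    (p := 2) (p' := 6) (by norm_num)
    (by simp only [Module.finrank_prod, finrank_euclideanSpace, Fintype.card_fin]; omega) (by
      have : Module.finrank ℝ (Space d × Space (3 - d)) = 3 := by
        simp only [Module.finrank_prod, finrank_euclideanSpace, Fintype.card_fin]; omega
      rw [this]; norm_num)
  have e1 : eLpNorm F 6 μ = eLpNorm u 6 volume * e := by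
    have := eLpNorm_prod_mul (μ := (volume : Measure (Space d)))
      (ν := (volume : Measure (Space (3 - d)))) (p := 6) (by norm_num)
      h1.continuous.norm.aestronglyMeasurable φ.continuous.norm.aestronglyMeasurable
    simp only [eLpNorm_norm] at this
    rw [← eLpNorm_norm F]
    simpa [F, norm_smul, mul_comm, e, μ] using this
  have e2 : eLpNorm (fderiv ℝ F) 2 μ ≤
      eLpNorm (fderiv ℝ u) 2 volume * a + eLpNorm u 2 volume * b := by
    have hb : ∀ z, ‖fderiv ℝ F z‖ ≤ ‖fderiv ℝ u z.1‖ * ‖φ z.2‖ + ‖u z.1‖ * ‖fderiv ℝ φ z.2‖ := by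
      intro z
      have d1 : HasFDerivAt (fun z : Space d × Space (3 - d) => φ z.2)
          ((fderiv ℝ φ z.2).comp (ContinuousLinearMap.snd ℝ _ _)) z :=
        (hφ.differentiable (by simp) z.2).hasFDerivAt.comp z hasFDerivAt_snd
      have d2 : HasFDerivAt (fun z : Space d × Space (3 - d) => u z.1)
          ((fderiv ℝ u z.1).comp (ContinuousLinearMap.fst ℝ _ _)) z :=
        (h1.differentiable (by simp) z.1).hasFDerivAt.comp z hasFDerivAt_fst
      have d3 : fderiv ℝ F z = _ := (d1.smul d2).fderiv
      rw [d3]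
      refine (norm_add_le _ _).trans (add_le_add ?_ ?_)
      · rw [norm_smul, mul_comm]
        gcongr
        refine (ContinuousLinearMap.opNorm_comp_le _ _).trans ?_
        exact mul_le_of_le_one_right (norm_nonneg _) (ContinuousLinearMap.norm_fst_le _ _ _)
      · rw [ContinuousLinearMap.norm_smulRight_apply, mul_comm]
        gcongr
        refine (ContinuousLinearMap.opNorm_comp_le _ _).trans ?_
        exact mul_le_of_le_one_right (norm_nonneg _) (ContinuousLinearMap.norm_snd_le _ _ _)
    refine (eLpNorm_mono_real hb).trans ?_
    have c1 := h1.continuous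
    have c2 := h1.continuous_fderiv (by simp)
    have c3 := hφ.continuous_fderiv (by simp)
    refine (eLpNorm_add_le (f := fun z : Space d × Space (3 - d) => ‖fderiv ℝ u z.1‖ * ‖φ z.2‖)
      (g := fun z => ‖u z.1‖ * ‖fderiv ℝ φ z.2‖) (Continuous.aestronglyMeasurable (by fun_prop))
      (Continuous.aestronglyMeasurable (by fun_prop)) (by norm_num)).trans ?_
    refine add_le_add (le_of_eq ?_) (le_of_eq ?_)
    · have := eLpNorm_prod_mul (μ := (volume : Measure (Space d)))
        (ν := (volume : Measure (Space (3 - d)))) (p := 2) (by norm_num)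
        c2.norm.aestronglyMeasurable φ.continuous.norm.aestronglyMeasurable
      simpa only [eLpNorm_norm, ENNReal.coe_ofNat] using this
    · have := eLpNorm_prod_mul (μ := (volume : Measure (Space d)))
        (ν := (volume : Measure (Space (3 - d)))) (p := 2) (by norm_num)
        c1.norm.aestronglyMeasurable c3.norm.aestronglyMeasurable
      simpa only [eLpNorm_norm, ENNReal.coe_ofNat] using this
  have key' : eLpNorm u 6 volume * e ≤
      S * (eLpNorm (fderiv ℝ u) 2 volume * a + eLpNorm u 2 volume * b) := by
    rw [← e1]
    have key2 : eLpNorm F 6 μ ≤ S * eLpNorm (fderiv ℝ F) 2 μ := by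
      simpa only [ENNReal.coe_ofNat] using key
    exact key2.trans (mul_le_mul_right e2 _)
  have h6 : eLpNorm u 6 volume = e⁻¹ * (eLpNorm u 6 volume * e) := by
    rw [mul_comm, mul_assoc, ENNReal.mul_inv_cancel p6 m6.2.ne, mul_one]
  rw [h6, mul_assoc]
  refine mul_le_mul_right (key'.trans ?_) _
  rw [mul_assoc]
  refine mul_le_mul_right ?_ _
  set D := ∑ j, eLpNorm (fun x => fderiv ℝ u x (EuclideanSpace.single j 1)) 2 volume
  have hD : eLpNorm (fderiv ℝ u) 2 volume ≤ D := eLpNorm_fderiv_le_sum h1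
  calc eLpNorm (fderiv ℝ u) 2 volume * a + eLpNorm u 2 volume * b
      ≤ (eLpNorm u 2 volume + D) * a + (eLpNorm u 2 volume + D) * b := by
        gcongr
        · exact hD.trans le_add_self
        · exact le_self_add
    _ = (a + b) * (eLpNorm u 2 volume + D) := by ring

end

/-! ### Cutoffs, and Sobolev inequalities beyond test functions -/

section

variable {d : ℕ}

theorem tendsto_eLpNorm_indicator_zero {α E : Type*} [MeasurableSpace α] [NormedAddCommGroup E]
    {μ : Measure α} {f : α → E} {p : ENNReal} (hp0 : p ≠ 0) (hp : p ≠ ⊤) (hf : MemLp f p μ)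
    {s : ℕ → Set α} (hs : ∀ n, NullMeasurableSet (s n) μ)
    (hlim : ∀ x, ∀ᶠ n in Filter.atTop, x ∉ s n) :
    Filter.Tendsto (fun n => eLpNorm ((s n).indicator f) p μ) Filter.atTop (nhds 0) := by
  have hp' : 0 < p.toReal := ENNReal.toReal_pos hp0 hp
  have h1 : Filter.Tendsto (fun n => ∫⁻ x, ‖(s n).indicator f x‖ₑ ^ p.toReal ∂μ) Filter.atTop
      (nhds (∫⁻ _, 0 ∂μ)) := by
    refine tendsto_lintegral_of_dominated_convergence' (fun x => ‖f x‖ₑ ^ p.toReal)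
      (fun n => ((hf.1.indicator₀ (hs n)).enorm.pow_const _)) (fun n => ?_) ?_ ?_
    · refine Filter.Eventually.of_forall fun x => ?_
      simp only
      gcongr
      exact enorm_indicator_le_enorm_self f x
    · exact (lintegral_rpow_enorm_lt_top_of_eLpNorm_lt_top hp0 hp hf.2).ne
    · refine Filter.Eventually.of_forall fun x => ?_
      refine tendsto_const_nhds.congr' ?_
      filter_upwards [hlim x] with n hn
      simp [hn, hp']
  simp only [lintegral_zero] at h1
  simp only [eLpNorm_eq_lintegral_rpow_enorm_toReal hp0 hp]
  have := (ENNReal.continuous_rpow_const (y := 1 / p.toReal)).tendsto 0 |>.comp h1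
  simpa [Function.comp_def, hp'] using this

/-- Smooth cutoffs: equal to one on the ball of radius `k + 1` and supported in the ball of twice
that radius. -/
noncomputable def cutoff (d k : ℕ) : Space d → ℝ := fun x =>
  (⟨1, 2, by norm_num, by norm_num⟩ : ContDiffBump (0 : Space d)) (((k : ℝ) + 1)⁻¹ • x)

theorem contDiff_cutoff (d k : ℕ) : ContDiff ℝ (⊤ : ℕ∞) (cutoff d k) :=
  ContDiff.comp (ContDiffBump.contDiff _) (by fun_prop)

theorem cutoff_eq_one {k : ℕ} {x : Space d} (h : ‖x‖ ≤ k + 1) : cutoff d k x = 1 := by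
  refine ContDiffBump.one_of_mem_closedBall _ ?_
  have hk : (0 : ℝ) < (k : ℝ) + 1 := by positivity
  simp only [mem_closedBall_zero_iff, norm_smul, norm_inv, Real.norm_eq_abs, abs_of_pos hk]
  rw [inv_mul_le_iff₀ hk]
  linarith

theorem cutoff_eq_zero {k : ℕ} {x : Space d} (h : 2 * (k + 1) ≤ ‖x‖) : cutoff d k x = 0 := by
  refine ContDiffBump.zero_of_le_dist _ ?_
  have hk : (0 : ℝ) < (k : ℝ) + 1 := by positivity
  simp only [dist_zero_right, norm_smul, norm_inv, Real.norm_eq_abs, abs_of_pos hk]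
  rw [le_inv_mul_iff₀ hk]
  linarith

theorem cutoff_nonneg (k : ℕ) (x : Space d) : 0 ≤ cutoff d k x := ContDiffBump.nonneg _

theorem cutoff_le_one (k : ℕ) (x : Space d) : cutoff d k x ≤ 1 := ContDiffBump.le_one _

theorem hasCompactSupport_cutoff (d k : ℕ) : HasCompactSupport (cutoff d k) := by
  refine HasCompactSupport.intro (isCompact_closedBall (0 : Space d) (2 * (k + 1))) fun x hx => ?_
  refine cutoff_eq_zero ?_
  simp only [mem_closedBall_zero_iff, not_le] at hx
  exact hx.le

theorem exists_norm_fderiv_cutoff_le (d : ℕ) : ∃ K : ℝ, 0 ≤ K ∧ ∀ (k : ℕ) (j : Fin d) (x : Space d),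
    ‖fderiv ℝ (cutoff d k) x (EuclideanSpace.single j 1)‖ ≤
      (Metric.closedBall (0 : Space d) (2 * (k + 1)) \ Metric.ball 0 (k + 1)).indicator
        (fun _ => K / (k + 1)) x := by
  let φ : ContDiffBump (0 : Space d) := ⟨1, 2, by norm_num, by norm_num⟩
  have hφ : ContDiff ℝ (⊤ : ℕ∞) φ := φ.contDiff
  obtain ⟨K, hK⟩ := (hφ.continuous_fderiv (by simp)).bounded_above_of_compact_support
    (φ.hasCompactSupport.fderiv (𝕜 := ℝ))
  have hK0 : 0 ≤ K := (norm_nonneg _).trans (hK 0)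
  refine ⟨K, hK0, fun k j x => ?_⟩
  have hk : (0 : ℝ) < (k : ℝ) + 1 := by positivity
  by_cases hx : x ∈ Metric.closedBall (0 : Space d) (2 * (k + 1)) \ Metric.ball 0 (k + 1)
  · rw [Set.indicator_of_mem hx]
    have h1 : HasFDerivAt (fun x : Space d => ((k : ℝ) + 1)⁻¹ • x)
        (((k : ℝ) + 1)⁻¹ • ContinuousLinearMap.id ℝ (Space d)) x := by
      exact (((k : ℝ) + 1)⁻¹ • ContinuousLinearMap.id ℝ (Space d)).hasFDerivAt (x := x)
    have h2 : HasFDerivAt (cutoff d k) _ x :=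
      (hφ.differentiable (by simp) (((k : ℝ) + 1)⁻¹ • x)).hasFDerivAt.comp x h1
    rw [h2.fderiv]
    simp only [ContinuousLinearMap.comp_apply, smul_apply,
      ContinuousLinearMap.id_apply, map_smul, norm_smul, norm_inv, Real.norm_eq_abs, abs_of_pos hk]
    rw [div_eq_inv_mul]
    gcongr
    refine ((fderiv ℝ φ _).le_opNorm _).trans ?_
    simpa using hK (((k : ℝ) + 1)⁻¹ • x)
  · rw [Set.indicator_of_notMem hx]
    have : fderiv ℝ (cutoff d k) x = 0 := by
      by_cases h1 : x ∈ Metric.ball (0 : Space d) (k + 1)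
      · have : cutoff d k =ᶠ[nhds x] fun _ => 1 := by
          filter_upwards [Metric.isOpen_ball.mem_nhds h1] with y hy
          exact cutoff_eq_one (mem_ball_zero_iff.1 hy).le
        rw [this.fderiv_eq]
        simp
      · have h2 : x ∈ (Metric.closedBall (0 : Space d) (2 * (k + 1)))ᶜ := fun h => hx ⟨h, h1⟩
        have : cutoff d k =ᶠ[nhds x] fun _ => 0 := by
          filter_upwards [Metric.isClosed_closedBall.isOpen_compl.mem_nhds h2] with y hy
          simp only [Set.mem_compl_iff, mem_closedBall_zero_iff, not_le] at hy
          exact cutoff_eq_zero hy.le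
        rw [this.fderiv_eq]
        simp
    simp [this]

/-- The mass parameter `m` and the integrability exponent `P` of a Sobolev space: either the
massive space `H¹`, or the massless space `Ḣ¹` in dimension at least three. -/
def MassExponent (d : ℕ) (m : ℝ) (P : ENNReal) : Prop :=
  (0 < m ∧ P = 2) ∨ (m = 0 ∧ 3 ≤ d ∧ P = ENNReal.ofReal (2 * (d : ℝ) / ((d : ℝ) - 2)))

theorem two_le_critical (hd : 3 ≤ d) : (2 : ℝ) ≤ 2 * (d : ℝ) / ((d : ℝ) - 2) := by
  have hd' : (3 : ℝ) ≤ d := by exact_mod_cast hd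
  rw [le_div_iff₀ (by linarith)]
  linarith

theorem MassExponent.two_le {m : ℝ} {P : ENNReal} (h : MassExponent d m P) : 2 ≤ P := by
  rcases h with ⟨-, rfl⟩ | ⟨-, hd, rfl⟩
  · exact le_rfl
  · rw [show (2 : ENNReal) = ENNReal.ofReal 2 by simp]
    exact ENNReal.ofReal_le_ofReal (two_le_critical hd)

theorem MassExponent.nonneg {m : ℝ} {P : ENNReal} (h : MassExponent d m P) : 0 ≤ m := by
  rcases h with ⟨h, -⟩ | ⟨rfl, -⟩
  · exact h.le
  · exact le_rfl

theorem locallyIntegrable_of_memLp {f : Space d → ℂ} {P : ENNReal} (hP : 1 ≤ P)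
    (hf : MemLp f P) : LocallyIntegrable f :=
  hf.locallyIntegrable hP

theorem holderTriple_critical (hd : 3 ≤ d) :
    ENNReal.HolderTriple (ENNReal.ofReal d) (ENNReal.ofReal (2 * (d : ℝ) / ((d : ℝ) - 2))) 2 := by
  have hd' : (3 : ℝ) ≤ d := by exact_mod_cast hd
  have h2 : (0 : ℝ) < d - 2 := by linarith
  constructor
  rw [← ENNReal.ofReal_inv_of_pos (by linarith), ← ENNReal.ofReal_inv_of_pos (by positivity),
    ← ENNReal.ofReal_add (by positivity) (by positivity),
    show (2 : ENNReal) = ENNReal.ofReal 2 by simp,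
    ← ENNReal.ofReal_inv_of_pos (by norm_num)]
  congr 1
  field_simp
  ring

/-- The commutator term of the cutoff vanishes in `L²` in the limit. In the massive case because the
gradient of the cutoff is `O(1/k)`; in the massless case by Hölder's inequality, since that gradient
is bounded in `L^d` and `f` is small in `L^{2*}` on its support. -/
theorem tendsto_eLpNorm_fderiv_cutoff_smul {m : ℝ} {P : ENNReal} (h : MassExponent d m P)
    {f : Space d → ℂ} (hf : MemLp f P) (j : Fin d) :
    Filter.Tendsto (fun k => eLpNorm (fun x =>
      fderiv ℝ (cutoff d k) x (EuclideanSpace.single j 1) • f x) 2 volume)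
      Filter.atTop (nhds 0) := by
  obtain ⟨K, hK0, hK⟩ := exists_norm_fderiv_cutoff_le d
  rcases h with ⟨-, rfl⟩ | ⟨-, hd, rfl⟩
  · have hle : ∀ k : ℕ, eLpNorm (fun x =>
        fderiv ℝ (cutoff d k) x (EuclideanSpace.single j 1) • f x) 2 volume ≤
        ENNReal.ofReal (K / (k + 1)) * eLpNorm f 2 volume := by
      intro k
      refine eLpNorm_le_mul_eLpNorm_of_ae_le_mul (Filter.Eventually.of_forall fun x => ?_) 2
      rw [norm_smul]
      gcongr
      refine (hK k j x).trans (Set.indicator_le_self' (fun _ _ => by positivity) x)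
    have hlim : Filter.Tendsto (fun k : ℕ => ENNReal.ofReal (K / (k + 1)) * eLpNorm f 2 volume)
        Filter.atTop (nhds 0) := by
      have h1 : Filter.Tendsto (fun k : ℕ => K / ((k : ℝ) + 1)) Filter.atTop (nhds 0) := by
        simpa [div_eq_mul_inv] using
          (tendsto_one_div_add_atTop_nhds_zero_nat (𝕜 := ℝ)).const_mul K
      have h2 := ENNReal.tendsto_ofReal h1
      have := ENNReal.Tendsto.mul_const h2 (Or.inr hf.2.ne)
      simpa using this
    exact tendsto_of_tendsto_of_tendsto_of_le_of_le tendsto_const_nhds hlim (fun _ => zero_le) hle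
  · have hd' : (3 : ℝ) ≤ d := by exact_mod_cast hd
    have hn : Nonempty (Fin d) := ⟨⟨0, by omega⟩⟩
    set P := ENNReal.ofReal (2 * (d : ℝ) / ((d : ℝ) - 2))
    have hP0 : P ≠ 0 := by
      have := two_le_critical hd
      simp only [P, ne_eq, ENNReal.ofReal_eq_zero, not_le]
      linarith
    have := holderTriple_critical hd
    -- The `L^d` norm of the gradient of the cutoff is scale invariant, hence bounded in `k`.
    have hgrad : ∀ k : ℕ, eLpNorm (fun x => fderiv ℝ (cutoff d k) x (EuclideanSpace.single j 1))
        (ENNReal.ofReal d) volume ≤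
        ENNReal.ofReal (2 * K) * volume (Metric.closedBall (0 : Space d) 1) ^ (1 / (d : ℝ)) := by
      intro k
      have hk : (0 : ℝ) < (k : ℝ) + 1 := by positivity
      calc _ ≤ eLpNorm ((Metric.closedBall (0 : Space d) (2 * (k + 1))).indicator
            (fun _ => K / ((k : ℝ) + 1))) (ENNReal.ofReal d) volume := by
            refine eLpNorm_mono_real fun x => (hK k j x).trans ?_
            exact Set.indicator_le_indicator_of_subset Set.sdiff_subset (fun _ => by positivity) x
        _ = ENNReal.ofReal (K / (k + 1)) *
            volume (Metric.closedBall (0 : Space d) (2 * (k + 1))) ^ (1 / (d : ℝ)) := by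
            rw [eLpNorm_indicator_const Metric.isClosed_closedBall.measurableSet
              (by simp; omega) (by simp), ENNReal.toReal_ofReal (by linarith),
              Real.enorm_of_nonneg (by positivity)]
        _ = _ := by
            rw [Measure.addHaar_closedBall' _ _ (by positivity)]
            rw [ENNReal.mul_rpow_of_nonneg _ _ (by positivity), ← mul_assoc]
            congr 1
            rw [ENNReal.ofReal_rpow_of_nonneg (by positivity) (by positivity),
              ← ENNReal.ofReal_mul (by positivity)]
            congr 1
            rw [finrank_euclideanSpace, Fintype.card_fin, one_div,
              Real.pow_rpow_inv_natCast (by positivity) (by omega)]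
            field_simp
    have htail := tendsto_eLpNorm_indicator_zero (μ := (volume : Measure (Space d))) hP0
      ENNReal.ofReal_ne_top hf (s := fun k : ℕ => (Metric.ball (0 : Space d) (k + 1))ᶜ)
      (fun k => Metric.isOpen_ball.measurableSet.compl.nullMeasurableSet) (fun x => by
        obtain ⟨N, hN⟩ := exists_nat_gt ‖x‖
        filter_upwards [Filter.eventually_ge_atTop N] with n hn
        have : (N : ℝ) ≤ n := by exact_mod_cast hn
        simp only [Set.mem_compl_iff, mem_ball_zero_iff, not_not]
        linarith)
    have hfin : ENNReal.ofReal (2 * K) * volume (Metric.closedBall (0 : Space d) 1) ^ (1 / (d : ℝ))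
        ≠ ⊤ := ENNReal.mul_ne_top ENNReal.ofReal_ne_top
      (ENNReal.rpow_ne_top_of_nonneg (by positivity) measure_closedBall_lt_top.ne)
    have hlim := ENNReal.Tendsto.const_mul htail (Or.inr hfin)
    rw [mul_zero] at hlim
    refine tendsto_of_tendsto_of_tendsto_of_le_of_le tendsto_const_nhds hlim (fun _ => zero_le)
      fun k => ?_
    have e : (fun x => fderiv ℝ (cutoff d k) x (EuclideanSpace.single j 1) • f x) =
        (fun x => fderiv ℝ (cutoff d k) x (EuclideanSpace.single j 1)) •
          (Metric.ball (0 : Space d) (k + 1))ᶜ.indicator f := by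
      ext x
      by_cases hx : x ∈ Metric.ball (0 : Space d) (k + 1)
      · have := hK k j x
        rw [Set.indicator_of_notMem (fun h => h.2 hx), norm_le_zero_iff] at this
        simp [this]
      · simp [Set.indicator_of_mem (show x ∈ (Metric.ball (0 : Space d) (k + 1))ᶜ from hx)]
    rw [e]
    refine (eLpNorm_smul_le_mul_eLpNorm (p := ENNReal.ofReal d) (q := P)
      (hf.1.indicator Metric.isOpen_ball.measurableSet.compl)
      (continuous_fderiv_single (contDiff_cutoff d k) j).aestronglyMeasurable).trans ?_
    gcongr
    exact hgrad k

/-- The Sobolev inequality extends from test functions to compactly supported functions. -/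
theorem eLpNorm_le_of_hasCompactSupport {q : ENNReal} {A C : NNReal}
    (hS : ∀ u : Space d → ℂ, ContDiff ℝ (⊤ : ℕ∞) u → HasCompactSupport u →
      eLpNorm u q volume ≤ A * eLpNorm u 2 volume +
        C * ∑ j, eLpNorm (fun x => fderiv ℝ u x (EuclideanSpace.single j 1)) 2 volume)
    {f : Space d → ℂ} (hf : HasL2Grad f) (hfi : LocallyIntegrable f) (hs : HasCompactSupport f) :
    eLpNorm f q volume ≤ A * eLpNorm f 2 volume +
      C * ∑ j, eLpNorm (weakPartial j f) 2 volume := by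
  refine (Lp.eLpNorm_lim_le_liminf_eLpNorm (f := fun n => mollify (bumpSeq d n) f)
    (fun n => (contDiff_mollify _ hfi).continuous.aestronglyMeasurable) _
    (ae_tendsto_mollify hfi)).trans ?_
  refine Filter.liminf_le_of_le (by isBoundedDefault) fun b hb => ?_
  obtain ⟨n, hn⟩ := hb.exists
  refine hn.trans ((hS _ (contDiff_mollify _ hfi) (hasCompactSupport_mollify _ hs)).trans ?_)
  gcongr with j
  · exact eLpNorm_mollify_le _ hfi.aestronglyMeasurable
  · simp only [fderiv_mollify _ (hf.hasWeakPartial j)]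
    exact eLpNorm_mollify_le _ (hf.memLp j).1

theorem ae_eq_weakPartial_cutoff_smul {f : Space d → ℂ} (hf : HasL2Grad f) (k : ℕ) (j : Fin d) :
    weakPartial j (fun x => cutoff d k x • f x) =ᵐ[volume]
      (fun x => cutoff d k x • weakPartial j f x) +
        fun x => fderiv ℝ (cutoff d k) x (EuclideanSpace.single j 1) • f x :=
  ((hf.hasWeakPartial j).smooth_smul (contDiff_cutoff d k)).weakPartial

theorem MemLp.cutoff_smul {f : Space d → ℂ} {p : ENNReal} (hf : MemLp f p) (k : ℕ) :
    MemLp (fun x => cutoff d k x • f x) p := by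
  refine hf.mono ((contDiff_cutoff d k).continuous.aestronglyMeasurable.smul hf.1)
    (Filter.Eventually.of_forall fun x => ?_)
  rw [norm_smul, Real.norm_eq_abs, abs_of_nonneg (cutoff_nonneg k x)]
  exact mul_le_of_le_one_left (norm_nonneg _) (cutoff_le_one k x)

theorem eLpNorm_cutoff_smul_le (f : Space d → ℂ) (p : ENNReal) (k : ℕ) :
    eLpNorm (fun x => cutoff d k x • f x) p volume ≤ eLpNorm f p volume := by
  refine eLpNorm_mono fun x => ?_
  rw [norm_smul, Real.norm_eq_abs, abs_of_nonneg (cutoff_nonneg k x)]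
  exact mul_le_of_le_one_left (norm_nonneg _) (cutoff_le_one k x)

/-- The Sobolev inequality extends from test functions to `H¹` and to `Ḣ¹`. -/
theorem eLpNorm_le_of_test {q : ENNReal} {A C : NNReal}
    (hS : ∀ u : Space d → ℂ, ContDiff ℝ (⊤ : ℕ∞) u → HasCompactSupport u →
      eLpNorm u q volume ≤ A * eLpNorm u 2 volume +
        C * ∑ j, eLpNorm (fun x => fderiv ℝ u x (EuclideanSpace.single j 1)) 2 volume)
    {m : ℝ} {P : ENNReal} (h : MassExponent d m P)
    {f : Space d → ℂ} (hf : HasL2Grad f) (hP : MemLp f P) :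
    eLpNorm f q volume ≤ A * eLpNorm f 2 volume +
      C * ∑ j, eLpNorm (weakPartial j f) 2 volume := by
  have hfi : LocallyIntegrable f :=
    locallyIntegrable_of_memLp ((by norm_num : (1 : ENNReal) ≤ 2).trans h.two_le) hP
  let ε : ℕ → ENNReal := fun k => C * ∑ j, eLpNorm (fun x =>
      fderiv ℝ (cutoff d k) x (EuclideanSpace.single j 1) • f x) 2 volume
  have hε : Filter.Tendsto ε Filter.atTop (nhds 0) := by
    have h1 : Filter.Tendsto (fun k => ∑ j, eLpNorm (fun x =>
        fderiv ℝ (cutoff d k) x (EuclideanSpace.single j 1) • f x) 2 volume)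
        Filter.atTop (nhds (∑ _j : Fin d, 0)) :=
      tendsto_finsetSum _ fun j _ => tendsto_eLpNorm_fderiv_cutoff_smul h hP j
    have := ENNReal.Tendsto.const_mul (a := (C : ENNReal)) h1 (Or.inr ENNReal.coe_ne_top)
    simpa only [Finset.sum_const_zero, mul_zero] using this
  have hbound : ∀ᶠ k in Filter.atTop, eLpNorm (fun x => cutoff d k x • f x) q volume ≤
      (A * eLpNorm f 2 volume + C * ∑ j, eLpNorm (weakPartial j f) 2 volume) + ε k := by
    have hlt : ∀ᶠ k in Filter.atTop, ∀ j : Fin d, eLpNorm (fun x =>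
        fderiv ℝ (cutoff d k) x (EuclideanSpace.single j 1) • f x) 2 volume < 1 :=
      Filter.eventually_all.2 fun j =>
        (tendsto_eLpNorm_fderiv_cutoff_smul h hP j).eventually_lt_const zero_lt_one
    filter_upwards [hlt] with k hk
    have ms : ∀ j, AEStronglyMeasurable (fun x =>
        fderiv ℝ (cutoff d k) x (EuclideanSpace.single j 1) • f x) volume := fun j =>
      (continuous_fderiv_single (contDiff_cutoff d k) j).aestronglyMeasurable.smul hP.1
    have hg : HasL2Grad (fun x => cutoff d k x • f x) := fun j =>
      ⟨_, (hf.hasWeakPartial j).smooth_smul (contDiff_cutoff d k),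
        (MemLp.cutoff_smul (hf.memLp j) k).add ⟨ms j, (hk j).trans ENNReal.one_lt_top⟩⟩
    have hs : HasCompactSupport (fun x => cutoff d k x • f x) :=
      (hasCompactSupport_cutoff d k).smul_right
    have := eLpNorm_le_of_hasCompactSupport hS hg
      (locallyIntegrable_of_memLp ((by norm_num : (1 : ENNReal) ≤ 2).trans h.two_le)
        (MemLp.cutoff_smul hP k)) hs
    refine this.trans ?_
    rw [add_assoc, ← mul_add, ← Finset.sum_add_distrib]
    gcongr with j
    · exact eLpNorm_cutoff_smul_le f 2 k
    · rw [eLpNorm_congr_ae (ae_eq_weakPartial_cutoff_smul hf k j)]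
      refine (eLpNorm_add_le (MemLp.cutoff_smul (hf.memLp j) k).1 (ms j) (by norm_num)).trans ?_
      gcongr
      exact eLpNorm_cutoff_smul_le _ 2 k
  refine (Lp.eLpNorm_lim_le_liminf_eLpNorm (f := fun k x => cutoff d k x • f x)
    (fun k => (MemLp.cutoff_smul hP k).1) _ ?_).trans ?_
  · refine Filter.Eventually.of_forall fun x => tendsto_const_nhds.congr' ?_
    obtain ⟨N, hN⟩ := exists_nat_gt ‖x‖
    filter_upwards [Filter.eventually_ge_atTop N] with n hn
    have : (N : ℝ) ≤ n := by exact_mod_cast hn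
    rw [cutoff_eq_one (by linarith), one_smul]
  · refine Filter.liminf_le_of_le (by isBoundedDefault) fun b hb => ?_
    have h2 := (tendsto_const_nhds (x := (A * eLpNorm f 2 volume +
      C * ∑ j, eLpNorm (weakPartial j f) 2 volume))).add hε
    rw [add_zero] at h2
    refine ge_of_tendsto h2 ?_
    filter_upwards [hb, hbound] with k h1 h2 using h1.trans h2

end

/-! ### Interpolation and embeddings -/

section

variable {d : ℕ}

theorem eLpNorm_ofReal_eq {α E : Type*} [MeasurableSpace α] [NormedAddCommGroup E] {μ : Measure α}
    (f : α → E) {q : ℝ} (hq : 0 < q) :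
    eLpNorm f (ENNReal.ofReal q) μ = (∫⁻ x, ‖f x‖ₑ ^ q ∂μ) ^ (1 / q) := by
  rw [eLpNorm_eq_lintegral_rpow_enorm_toReal (by simpa using hq) ENNReal.ofReal_ne_top,
    ENNReal.toReal_ofReal hq.le]

/-- Interpolation between `L^a` and `L^b`. -/
theorem eLpNorm_interpolate {α E : Type*} [MeasurableSpace α] [NormedAddCommGroup E]
    {μ : Measure α} {f : α → E} (hf : AEStronglyMeasurable f μ) {a b q θ : ℝ} (ha : 0 < a)
    (hb : 0 < b) (hq : 0 < q) (h0 : 0 ≤ θ) (h1 : θ ≤ 1) (h : 1 / q = (1 - θ) / a + θ / b) :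
    eLpNorm f (ENNReal.ofReal q) μ ≤
      eLpNorm f (ENNReal.ofReal a) μ ^ (1 - θ) * eLpNorm f (ENNReal.ofReal b) μ ^ θ := by
  rw [eLpNorm_ofReal_eq f hq, eLpNorm_ofReal_eq f ha, eLpNorm_ofReal_eq f hb]
  have h1' : 0 ≤ 1 - θ := by linarith
  have key := ENNReal.lintegral_mul_norm_pow_le (μ := μ) (f := fun x => ‖f x‖ₑ ^ a)
    (g := fun x => ‖f x‖ₑ ^ b) (hf.enorm.pow_const _) (hf.enorm.pow_const _)
    (p := (1 - θ) * q / a) (q := θ * q / b) (by positivity) (by positivity) (by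
      have : (1 - θ) * q / a + θ * q / b = q * ((1 - θ) / a + θ / b) := by ring
      rw [this, ← h]
      field_simp)
  have e : ∀ x, (‖f x‖ₑ ^ a) ^ ((1 - θ) * q / a) * (‖f x‖ₑ ^ b) ^ (θ * q / b) = ‖f x‖ₑ ^ q := by
    intro x
    rw [← ENNReal.rpow_mul, ← ENNReal.rpow_mul, ← ENNReal.rpow_add_of_nonneg _ _ (by positivity)
      (by positivity)]
    congr 1
    field_simp
    ring
  simp only [e] at key
  calc _ ≤ ((∫⁻ x, ‖f x‖ₑ ^ a ∂μ) ^ ((1 - θ) * q / a) *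
        (∫⁻ x, ‖f x‖ₑ ^ b ∂μ) ^ (θ * q / b)) ^ (1 / q) :=
        ENNReal.rpow_le_rpow key (by positivity)
    _ = _ := by
        rw [ENNReal.mul_rpow_of_nonneg _ _ (by positivity), ← ENNReal.rpow_mul, ← ENNReal.rpow_mul,
          ← ENNReal.rpow_mul, ← ENNReal.rpow_mul]
        congr 2 <;> field_simp

theorem eLpNorm_le_of_bound {α E : Type*} [MeasurableSpace α] [NormedAddCommGroup E]
    {μ : Measure α} {f : α → E} {s : ℝ} (hs : ∀ x, ‖f x‖ ≤ s) {q : ℝ} (hq : 2 ≤ q) :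
    eLpNorm f (ENNReal.ofReal q) μ ≤
      ENNReal.ofReal s ^ (1 - 2 / q) * eLpNorm f 2 μ ^ (2 / q) := by
  have hq0 : 0 < q := by linarith
  have h2 : eLpNorm f 2 μ = (∫⁻ x, ‖f x‖ₑ ^ (2 : ℝ) ∂μ) ^ (1 / (2 : ℝ)) := by
    have := eLpNorm_ofReal_eq (μ := μ) f (q := 2) (by norm_num)
    simpa using this
  have hq2 : 0 ≤ q - 2 := by linarith
  rw [eLpNorm_ofReal_eq f hq0, h2, ← ENNReal.rpow_mul]
  calc (∫⁻ x, ‖f x‖ₑ ^ q ∂μ) ^ (1 / q) ≤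
        (∫⁻ x, ENNReal.ofReal s ^ (q - 2) * ‖f x‖ₑ ^ (2 : ℝ) ∂μ) ^ (1 / q) := by
        gcongr with x
        have : ‖f x‖ₑ ^ q = ‖f x‖ₑ ^ (q - 2) * ‖f x‖ₑ ^ (2 : ℝ) := by
          rw [← ENNReal.rpow_add_of_nonneg _ _ hq2 (by norm_num)]
          congr 1
          ring
        rw [this]
        gcongr
        rw [← ofReal_norm]
        exact ENNReal.ofReal_le_ofReal (hs x)
    _ = _ := by
        rw [lintegral_const_mul' _ _ (ENNReal.rpow_ne_top_of_nonneg hq2 ENNReal.ofReal_ne_top),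
          ENNReal.mul_rpow_of_nonneg _ _ (by positivity), ← ENNReal.rpow_mul]
        congr 2 <;> field_simp

/-- The quadratic form `‖∇f‖² + m ‖f‖²`. -/
noncomputable def sobEnergy (m : ℝ) (f : Space d → ℂ) : ℝ := gradSq f + m * massSq f

theorem gradSq_nonneg (f : Space d → ℂ) : 0 ≤ gradSq f :=
  Finset.sum_nonneg fun _ _ => integral_nonneg fun _ => by positivity

theorem massSq_nonneg (f : Space d → ℂ) : 0 ≤ massSq f := integral_nonneg fun _ => by positivity

theorem sobEnergy_nonneg {m : ℝ} (hm : 0 ≤ m) (f : Space d → ℂ) : 0 ≤ sobEnergy m f :=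
  add_nonneg (gradSq_nonneg f) (mul_nonneg hm (massSq_nonneg f))

theorem eLpNorm_two_eq {f : Space d → ℂ} (hf : MemLp f 2) :
    eLpNorm f 2 volume = ENNReal.ofReal (√(∫ x, ‖f x‖ ^ 2)) := by
  have h1 : eLpNorm f 2 volume ^ 2 = ENNReal.ofReal (√(∫ x, ‖f x‖ ^ 2)) ^ 2 := by
    rw [eLpNorm_two_sq, ← ENNReal.ofReal_pow (Real.sqrt_nonneg _),
      Real.sq_sqrt (integral_nonneg fun _ => by positivity),
      ofReal_integral_eq_lintegral_ofReal (hf.integrable_norm_pow (by norm_num))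
        (Filter.Eventually.of_forall fun _ => by positivity)]
    refine lintegral_congr fun x => ?_
    rw [ENNReal.ofReal_pow (norm_nonneg _), ofReal_norm]
  exact le_antisymm (ENNReal_le_of_sq_le h1.le) (ENNReal_le_of_sq_le h1.ge)

theorem eLpNorm_weakPartial_le {m : ℝ} (hm : 0 ≤ m) {f : Space d → ℂ} (hf : HasL2Grad f)
    (j : Fin d) : eLpNorm (weakPartial j f) 2 volume ≤ ENNReal.ofReal (√(sobEnergy m f)) := by
  rw [eLpNorm_two_eq (hf.memLp j)]
  gcongr
  have h1 : ∫ x, ‖weakPartial j f x‖ ^ 2 ≤ gradSq f :=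
    Finset.single_le_sum (f := fun j => ∫ x, ‖weakPartial j f x‖ ^ 2)
      (fun _ _ => integral_nonneg fun _ => by positivity) (Finset.mem_univ j)
  have := mul_nonneg hm (massSq_nonneg f)
  unfold sobEnergy
  linarith

theorem sum_eLpNorm_weakPartial_le {m : ℝ} (hm : 0 ≤ m) {f : Space d → ℂ} (hf : HasL2Grad f) :
    ∑ j, eLpNorm (weakPartial j f) 2 volume ≤ d * ENNReal.ofReal (√(sobEnergy m f)) := by
  refine (Finset.sum_le_sum fun j _ => eLpNorm_weakPartial_le hm hf j).trans ?_
  simp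

theorem eLpNorm_two_le {m : ℝ} (hm : 0 < m) {f : Space d → ℂ} (hf : MemLp f 2) :
    eLpNorm f 2 volume ≤ (1 / √m).toNNReal * ENNReal.ofReal (√(sobEnergy m f)) := by
  rw [eLpNorm_two_eq hf]
  change _ ≤ ENNReal.ofReal (1 / √m) * _
  rw [← ENNReal.ofReal_mul (by positivity)]
  gcongr
  have h1 : m * massSq f ≤ sobEnergy m f := by
    have := gradSq_nonneg f
    unfold sobEnergy
    linarith
  rw [one_div, ← div_eq_inv_mul, le_div_iff₀ (Real.sqrt_pos.2 hm), ← Real.sqrt_mul' _ hm.le]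
  refine Real.sqrt_le_sqrt ?_
  rw [mul_comm]
  exact h1

/-- The Sobolev space with mass `m` and exponent `P` embeds continuously into `L^q`. -/
def SobolevEmbeds (d : ℕ) (m : ℝ) (P q : ENNReal) : Prop :=
  ∃ C : NNReal, ∀ f : Space d → ℂ, MemLp f P → HasL2Grad f →
    eLpNorm f q volume ≤ C * ENNReal.ofReal (√(sobEnergy m f))

theorem SobolevEmbeds.memLp {m : ℝ} {P q : ENNReal} (h : SobolevEmbeds d m P q)
    {f : Space d → ℂ} (hP : MemLp f P) (hf : HasL2Grad f) : MemLp f q := by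
  obtain ⟨C, hC⟩ := h
  exact ⟨hP.1, (hC f hP hf).trans_lt (ENNReal.mul_lt_top ENNReal.coe_lt_top ENNReal.ofReal_lt_top)⟩

/-- A Sobolev inequality for test functions gives an embedding; its `L²` term is only allowed in the
massive case. -/
theorem sobolevEmbeds_of_test {q : ENNReal} {A C : NNReal}
    (hS : ∀ u : Space d → ℂ, ContDiff ℝ (⊤ : ℕ∞) u → HasCompactSupport u →
      eLpNorm u q volume ≤ A * eLpNorm u 2 volume +
        C * ∑ j, eLpNorm (fun x => fderiv ℝ u x (EuclideanSpace.single j 1)) 2 volume)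
    {m : ℝ} {P : ENNReal} (h : MassExponent d m P) (hA : A = 0 ∨ (0 < m ∧ P = 2)) :
    SobolevEmbeds d m P q := by
  refine ⟨A * (1 / √m).toNNReal + C * d, fun f hP hf => ?_⟩
  refine (eLpNorm_le_of_test hS h hf hP).trans ?_
  push_cast
  rw [add_mul, mul_assoc, mul_assoc]
  refine add_le_add ?_ (mul_le_mul_right (sum_eLpNorm_weakPartial_le h.nonneg hf) _)
  rcases hA with rfl | ⟨hm, rfl⟩
  · simp
  · exact mul_le_mul_right (eLpNorm_two_le hm hP) _

theorem MassExponent.embeds_self {m : ℝ} {P : ENNReal} (h : MassExponent d m P) :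
    SobolevEmbeds d m P P := by
  rcases id h with ⟨hm, rfl⟩ | ⟨-, hd, rfl⟩
  · exact ⟨_, fun f hP _ => eLpNorm_two_le hm hP⟩
  · obtain ⟨C, hC⟩ := exists_eLpNorm_le_grad hd
    exact sobolevEmbeds_of_test (A := 0) (C := C) (fun u h1 h2 => by simpa using hC u h1 h2) h
      (Or.inl rfl)

/-- An admissible upper endpoint for the Sobolev embedding of `H¹`: the critical exponent in
dimension at least three, and the exponent `6` in lower dimensions. -/
noncomputable def topExponent (d : ℕ) : ℝ := if d ≤ 3 then 6 else 2 * (d : ℝ) / ((d : ℝ) - 2)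

theorem two_lt_topExponent (d : ℕ) : 2 < topExponent d := by
  unfold topExponent
  split_ifs with h
  · norm_num
  · have hd' : (3 : ℝ) < d := by exact_mod_cast not_le.1 h
    rw [lt_div_iff₀ (by linarith)]
    linarith

theorem sobolevEmbeds_topExponent {m : ℝ} (hm : 0 < m) :
    SobolevEmbeds d m 2 (ENNReal.ofReal (topExponent d)) := by
  have h : MassExponent d m 2 := Or.inl ⟨hm, rfl⟩
  unfold topExponent
  split_ifs with hd
  · obtain ⟨C, hC⟩ := exists_eLpNorm_six_le hd
    exact sobolevEmbeds_of_test (A := C) (C := C)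
      (fun u h1 h2 => by simpa [mul_add] using hC u h1 h2) h (Or.inr ⟨hm, rfl⟩)
  · obtain ⟨C, hC⟩ := exists_eLpNorm_le_grad (not_le.1 hd).le
    exact sobolevEmbeds_of_test (A := 0) (C := C) (fun u h1 h2 => by simpa using hC u h1 h2) h
      (Or.inl rfl)

theorem exists_interpolation_weight {a b q : ℝ} (ha : 0 < a) (hq : a ≤ q) (hb : q < b) :
    ∃ θ : ℝ, 0 ≤ θ ∧ θ < 1 ∧ 1 / q = (1 - θ) / a + θ / b := by
  have hq0 : 0 < q := ha.trans_le hq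
  have hb0 : 0 < b := hq0.trans hb
  have h1 : 1 / b < 1 / q := one_div_lt_one_div_of_lt hq0 hb
  have h2 : 1 / q ≤ 1 / a := one_div_le_one_div_of_le ha hq
  have h3 : 0 < 1 / a - 1 / b := by linarith
  refine ⟨(1 / a - 1 / q) / (1 / a - 1 / b), div_nonneg (by linarith) h3.le,
    (div_lt_one h3).2 (by linarith), ?_⟩
  set X := 1 / a with hX
  set Y := 1 / b with hY
  rw [div_eq_mul_one_div _ a, div_eq_mul_one_div _ b, ← hX, ← hY]
  field_simp
  ring

theorem sobolevEmbeds_of_lt_topExponent {m : ℝ} (hm : 0 < m) {q : ℝ} (hq : 2 ≤ q)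
    (hq' : q < topExponent d) : SobolevEmbeds d m 2 (ENNReal.ofReal q) := by
  obtain ⟨C, hC⟩ := sobolevEmbeds_topExponent (d := d) hm
  obtain ⟨θ, h0, h1, h⟩ := exists_interpolation_weight two_pos hq hq'
  have hq0 : 0 < q := by linarith
  refine ⟨(1 / √m).toNNReal ^ (1 - θ) * C ^ θ, fun f hP hf => ?_⟩
  refine (eLpNorm_interpolate hP.1 two_pos (hq0.trans hq') hq0 h0 h1.le h).trans ?_
  have h1' : 0 ≤ 1 - θ := by linarith
  set E := ENNReal.ofReal (√(sobEnergy m f))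
  have hE : E = E ^ (1 - θ) * E ^ θ := by
    rw [← ENNReal.rpow_add_of_nonneg _ _ h1' h0]
    simp
  calc _ ≤ ((1 / √m).toNNReal * E) ^ (1 - θ) * (C * E) ^ θ := by
        gcongr
        · simpa using eLpNorm_two_le hm hP
        · exact hC f hP hf
    _ = _ := by
        rw [ENNReal.mul_rpow_of_nonneg _ _ h1', ENNReal.mul_rpow_of_nonneg _ _ h0]
        conv_rhs => rw [hE]
        push_cast
        rw [← ENNReal.coe_rpow_of_nonneg _ h1', ← ENNReal.coe_rpow_of_nonneg _ h0]
        ring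

/-- A bounded family in `H¹` whose mollifications are uniformly small is small in `L^q` for the
subcritical exponents `q > 2`. The mollification error is small in `L²` and bounded in the top
exponent, hence small in `L^q`; the mollification itself is bounded in `L²` and small in `L^∞`. -/
theorem exists_bump_eLpNorm_le {m : ℝ} (hm : 0 < m) {q : ℝ} (hq : 2 < q)
    (hq' : q < topExponent d) (B : ℝ) {δ : ENNReal} (hδ : 0 < δ) :
    ∃ φ : ContDiffBump (0 : Space d), ∃ s : ℝ, 0 < s ∧ ∀ f : Space d → ℂ, MemLp f 2 →
      HasL2Grad f → sobEnergy m f ≤ B → (∀ x, ‖mollify φ f x‖ ≤ s) →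
      eLpNorm f (ENNReal.ofReal q) volume ≤ δ := by
  obtain ⟨C, hC⟩ := sobolevEmbeds_topExponent (d := d) hm
  obtain ⟨θ, h0, h1, h⟩ := exists_interpolation_weight two_pos hq.le hq'
  set r := topExponent d
  have hr2 : 2 < r := two_lt_topExponent d
  have hq0 : 0 < q := by linarith
  have h1' : 0 < 1 - θ := by linarith
  let b : ENNReal := ENNReal.ofReal (√B)
  let K : ENNReal := (1 / √m).toNNReal * b
  have hb : b ≠ ⊤ := ENNReal.ofReal_ne_top
  have hK : K ≠ ⊤ := ENNReal.mul_ne_top ENNReal.coe_ne_top hb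
  let R : ENNReal := K ^ (2 / r) + C * b
  have hR : R ≠ ⊤ := ENNReal.add_ne_top.2
    ⟨ENNReal.rpow_ne_top_of_nonneg (by positivity) hK, ENNReal.mul_ne_top ENNReal.coe_ne_top hb⟩
  have hδ2 : 0 < δ / 2 := ENNReal.half_pos hδ.ne'
  -- `n` makes the mollification error small in `L^q`.
  have lim1 : Filter.Tendsto (fun n => (ENNReal.ofReal (bumpSeq d n).rOut * (d * b)) ^ (1 - θ) *
      R ^ θ) Filter.atTop (nhds 0) := by
    have a1 := ENNReal.tendsto_ofReal (tendsto_bumpSeq_rOut d)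
    have a2 := ENNReal.Tendsto.mul_const (b := (d * b)) a1
      (Or.inr (ENNReal.mul_ne_top (ENNReal.natCast_ne_top d) hb))
    have a3 := (ENNReal.continuous_rpow_const (y := 1 - θ)).tendsto _ |>.comp a2
    have a4 := ENNReal.Tendsto.mul_const (b := R ^ θ) a3
      (Or.inr (ENNReal.rpow_ne_top_of_nonneg h0 hR))
    simpa [Function.comp_def, h1'] using a4
  obtain ⟨n, hn⟩ := (lim1.eventually_lt_const hδ2).exists
  -- `1 / (k + 1)` is the pointwise bound making the mollification small in `L^q`.
  have hq2 : 0 < 1 - 2 / q := by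
    have : 2 / q < 1 := (div_lt_one hq0).2 hq
    linarith
  have lim2 : Filter.Tendsto (fun k : ℕ => ENNReal.ofReal (1 / ((k : ℝ) + 1)) ^ (1 - 2 / q) *
      K ^ (2 / q)) Filter.atTop (nhds 0) := by
    have a1 := ENNReal.tendsto_ofReal (tendsto_one_div_add_atTop_nhds_zero_nat (𝕜 := ℝ))
    have a3 := (ENNReal.continuous_rpow_const (y := 1 - 2 / q)).tendsto _ |>.comp a1
    have a4 := ENNReal.Tendsto.mul_const (b := K ^ (2 / q)) a3
      (Or.inr (ENNReal.rpow_ne_top_of_nonneg (by positivity) hK))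
    simpa [Function.comp_def, hq2] using a4
  obtain ⟨k, hk⟩ := (lim2.eventually_lt_const hδ2).exists
  refine ⟨bumpSeq d n, 1 / ((k : ℝ) + 1), by positivity, fun f hP hf hB hs => ?_⟩
  set φ := bumpSeq d n
  have hfi : LocallyIntegrable f := locallyIntegrable_of_memLp (by norm_num) hP
  have hE : ENNReal.ofReal (√(sobEnergy m f)) ≤ b :=
    ENNReal.ofReal_le_ofReal (Real.sqrt_le_sqrt hB)
  have hmm : AEStronglyMeasurable (mollify φ f) volume :=
    (contDiff_mollify φ hfi).continuous.aestronglyMeasurable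
  have hf2 : eLpNorm f 2 volume ≤ K := (eLpNorm_two_le hm hP).trans (mul_le_mul_right hE _)
  have hm2 : eLpNorm (mollify φ f) 2 volume ≤ K := (eLpNorm_mollify_le φ hP.1).trans hf2
  have hbd : ∀ t : ℝ, 2 ≤ t → eLpNorm (mollify φ f) (ENNReal.ofReal t) volume ≤
      ENNReal.ofReal (1 / ((k : ℝ) + 1)) ^ (1 - 2 / t) * K ^ (2 / t) := fun t ht => by
    refine (eLpNorm_le_of_bound hs ht).trans ?_
    gcongr
  have hdr : eLpNorm (mollify φ f - f) (ENNReal.ofReal r) volume ≤ R := by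
    refine (eLpNorm_sub_le hmm hP.1 (by
      rw [show (1 : ENNReal) = ENNReal.ofReal 1 by simp]
      exact ENNReal.ofReal_le_ofReal (by linarith))).trans ?_
    refine add_le_add ((hbd r hr2.le).trans (mul_le_of_le_one_left zero_le ?_))
      ((hC f hP hf).trans (by gcongr))
    refine ENNReal.rpow_le_one ?_ ?_
    · rw [show (1 : ENNReal) = ENNReal.ofReal 1 by simp]
      refine ENNReal.ofReal_le_ofReal ?_
      rw [div_le_one (by positivity)]
      have : (0 : ℝ) ≤ k := by positivity
      linarith
    · have : 2 / r < 1 := (div_lt_one (by linarith)).2 hr2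
      linarith
  have hd2 : eLpNorm (mollify φ f - f) (ENNReal.ofReal 2) volume ≤
      ENNReal.ofReal φ.rOut * (d * b) := by
    rw [show ENNReal.ofReal 2 = 2 by simp]
    refine (eLpNorm_mollify_sub_le hf hfi φ).trans ?_
    gcongr
    refine (sum_eLpNorm_weakPartial_le hm.le hf).trans ?_
    gcongr
  have e : f = mollify φ f - (mollify φ f - f) := by simp
  rw [e]
  refine (eLpNorm_sub_le hmm (hmm.sub hP.1) (by
      rw [show (1 : ENNReal) = ENNReal.ofReal 1 by simp]
      exact ENNReal.ofReal_le_ofReal (by linarith))).trans ?_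
  rw [← ENNReal.add_halves δ]
  refine add_le_add ((hbd q hq.le).trans hk.le) (le_trans ?_ hn.le)
  refine (eLpNorm_interpolate (hmm.sub hP.1) two_pos (by linarith) hq0 h0 h1.le h).trans ?_
  gcongr

end

/-! ### Weak compactness in `L²` -/

section

variable {d : ℕ}

/-- Weak convergence of a sequence in `L²`. -/
def WeakL2 (a : ℕ → Space d → ℂ) (b : Space d → ℂ) : Prop :=
  MemLp b 2 ∧ ∀ k : Space d → ℂ, MemLp k 2 →
    Filter.Tendsto (fun n => ∫ x, k x * a n x) Filter.atTop (nhds (∫ x, k x * b x))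

theorem WeakL2.comp_subseq {a : ℕ → Space d → ℂ} {b : Space d → ℂ} (h : WeakL2 a b) {φ : ℕ → ℕ}
    (hφ : StrictMono φ) : WeakL2 (fun n => a (φ n)) b :=
  ⟨h.1, fun k hk => (h.2 k hk).comp hφ.tendsto_atTop⟩

theorem exists_subseq_tendsto_inner {H : Type*} [NormedAddCommGroup H] [InnerProductSpace ℂ H]
    [CompleteSpace H] [TopologicalSpace.SeparableSpace H] {x : ℕ → H} {B : ℝ}
    (hx : ∀ n, ‖x n‖ ≤ B) : ∃ φ : ℕ → ℕ, StrictMono φ ∧ ∃ z : H, ∀ y : H,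
      Filter.Tendsto (fun n => inner ℂ (x (φ n)) y) Filter.atTop (nhds (inner ℂ z y)) := by
  let T : ℕ → WeakDual ℂ H := fun n =>
    StrongDual.toWeakDual (InnerProductSpace.toDual ℂ H (x n))
  obtain ⟨L, -, φ, hφ, hL⟩ := WeakDual.isSeqCompact_closedBall ℂ H 0 B (x := T) (fun n => by
    simp only [Set.mem_preimage, mem_closedBall_zero_iff]
    change ‖InnerProductSpace.toDual ℂ H (x n)‖ ≤ B
    rw [LinearIsometryEquiv.norm_map]
    exact hx n)
  refine ⟨φ, hφ, (InnerProductSpace.toDual ℂ H).symm (WeakDual.toStrongDual L), fun y => ?_⟩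
  rw [InnerProductSpace.toDual_symm_apply]
  have := ((WeakDual.eval_continuous (𝕜 := ℂ) y).tendsto L).comp hL
  refine this.congr fun n => ?_
  change InnerProductSpace.toDual ℂ H (x (φ n)) y = _
  rw [InnerProductSpace.toDual_apply_apply]

theorem exists_subseq_weakL2 {a : ℕ → Space d → ℂ} {B : ENNReal} (hB : B ≠ ⊤)
    (ha : ∀ n, AEStronglyMeasurable (a n) volume) (hb : ∀ n, eLpNorm (a n) 2 volume ≤ B) :
    ∃ φ : ℕ → ℕ, StrictMono φ ∧ ∃ b, WeakL2 (fun n => a (φ n)) b := by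
  have hm : ∀ n, MemLp (a n) 2 := fun n => ⟨ha n, (hb n).trans_lt hB.lt_top⟩
  have : Fact ((2 : ENNReal) ≠ ⊤) := ⟨by norm_num⟩
  obtain ⟨φ, hφ, z, hz⟩ := exists_subseq_tendsto_inner (x := fun n => (hm n).toLp (a n))
    (B := B.toReal) (fun n => by
      rw [Lp.norm_toLp]
      exact ENNReal.toReal_mono hB (hb n))
  refine ⟨φ, hφ, z, Lp.memLp z, fun k hk => ?_⟩
  have hk' : MemLp (fun x => conj (k x)) 2 := hk.star
  have h1 := (Complex.continuous_conj.tendsto _).comp (hz (hk'.toLp _))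
  have e : ∀ w : Lp ℂ 2 (volume : Measure (Space d)), conj (inner ℂ w (hk'.toLp _)) =
      ∫ x, k x * w x := by
    intro w
    rw [L2.inner_def, ← integral_conj]
    refine integral_congr_ae ?_
    filter_upwards [hk'.coeFn_toLp] with x hx
    rw [hx]
    simp [RCLike.inner_apply]
  rw [e] at h1
  refine h1.congr fun n => ?_
  simp only [Function.comp_apply]
  rw [e]
  refine integral_congr_ae ?_
  filter_upwards [(hm (φ n)).coeFn_toLp] with x hx
  rw [hx]

/-- Finitely many bounded sequences have a common weakly convergent subsequence. -/
theorem exists_subseq_weakL2_finset {ι : Type*} {a : ι → ℕ → Space d → ℂ} {B : ENNReal}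
    (hB : B ≠ ⊤) (ha : ∀ i n, AEStronglyMeasurable (a i n) volume)
    (hb : ∀ i n, eLpNorm (a i n) 2 volume ≤ B) (s : Finset ι) :
    ∃ φ : ℕ → ℕ, StrictMono φ ∧ ∀ i ∈ s, ∃ b, WeakL2 (fun n => a i (φ n)) b := by
  classical
  induction s using Finset.induction with
  | empty => exact ⟨id, strictMono_id, by simp⟩
  | insert i s _ ih =>
    obtain ⟨φ, hφ, h⟩ := ih
    obtain ⟨ψ, hψ, b, hb'⟩ := exists_subseq_weakL2 hB (fun n => ha i (φ n)) (fun n => hb i (φ n))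
    refine ⟨φ ∘ ψ, hφ.comp hψ, fun k hk => ?_⟩
    rcases Finset.mem_insert.1 hk with rfl | hk
    · exact ⟨b, hb'⟩
    · obtain ⟨c, hc⟩ := h k hk
      exact ⟨c, hc.comp_subseq hψ⟩

theorem integrable_mul_of_memLp_two {f g : Space d → ℂ} (hf : MemLp f 2) (hg : MemLp g 2) :
    Integrable (fun x => f x * g x) := MemLp.integrable_mul hf hg

theorem integral_norm_sub_sq {f g : Space d → ℂ} (hf : MemLp f 2) (hg : MemLp g 2) :
    ∫ x, ‖f x - g x‖ ^ 2 =
      (∫ x, ‖f x‖ ^ 2) - 2 * (∫ x, conj (g x) * f x).re + ∫ x, ‖g x‖ ^ 2 := by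
  have hg' : MemLp (fun x => conj (g x)) 2 := hg.star
  have i1 := hf.integrable_norm_pow (p := 2) (by norm_num)
  have i2 := hg.integrable_norm_pow (p := 2) (by norm_num)
  have i3 := integrable_mul_of_memLp_two hg' hf
  have hre : (∫ x, conj (g x) * f x).re = ∫ x, (conj (g x) * f x).re := (integral_re i3).symm
  have i3' : Integrable (fun x => (conj (g x) * f x).re) := i3.re
  rw [hre, ← integral_const_mul]
  have s1 : Integrable (fun x => ‖f x‖ ^ 2 - 2 * (conj (g x) * f x).re) :=
    i1.sub (i3'.const_mul 2)
  rw [← integral_sub i1 (i3'.const_mul 2), ← integral_add s1 i2]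
  refine integral_congr_ae (Filter.Eventually.of_forall fun x => ?_)
  simp only [← Complex.normSq_eq_norm_sq, Complex.normSq_apply]
  simp
  ring

/-- The Hilbert space splitting of the norm along a weakly convergent sequence. -/
theorem WeakL2.tendsto_split {a : ℕ → Space d → ℂ} {b : Space d → ℂ} (h : WeakL2 a b)
    (ha : ∀ n, MemLp (a n) 2) :
    Filter.Tendsto (fun n => (∫ x, ‖a n x - b x‖ ^ 2) + (∫ x, ‖b x‖ ^ 2) - ∫ x, ‖a n x‖ ^ 2)
      Filter.atTop (nhds 0) := by
  have h1 := (Complex.continuous_re.tendsto _).comp (h.2 (fun x => conj (b x)) h.1.star)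
  have e : (∫ x, conj (b x) * b x).re = ∫ x, ‖b x‖ ^ 2 := by
    have hb' : MemLp (fun x => conj (b x)) 2 := h.1.star
    have hre : (∫ x, conj (b x) * b x).re = ∫ x, (conj (b x) * b x).re :=
      (integral_re (integrable_mul_of_memLp_two hb' h.1)).symm
    rw [hre]
    refine integral_congr_ae (Filter.Eventually.of_forall fun x => ?_)
    simp only [← Complex.normSq_eq_norm_sq, Complex.normSq_apply]
    simp
  rw [e] at h1
  have h2 := (tendsto_const_nhds (x := 2 * ∫ x, ‖b x‖ ^ 2)).sub (h1.const_mul 2)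
  rw [sub_self] at h2
  refine h2.congr fun n => ?_
  rw [integral_norm_sub_sq (ha n) h.1]
  simp only [Function.comp_apply]
  ring

/-- A positive continuous weight for which the Sobolev space embeds into the weighted space `L²`. It
allows the massless case to be treated by Hilbert space methods: there `w = (1 + |x|)^{-2}` is in
`L^d`, so that Hölder's inequality applies. -/
theorem MassExponent.exists_weight {m : ℝ} {P : ENNReal} (h : MassExponent d m P) :
    ∃ w : Space d → ℝ, Continuous w ∧ (∀ x, 0 < w x) ∧ (m = 0 ∨ ∀ x, w x = 1) ∧
      ∃ C : NNReal, ∀ f : Space d → ℂ, MemLp f P → HasL2Grad f →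
        eLpNorm (fun x => w x • f x) 2 volume ≤ C * ENNReal.ofReal (√(sobEnergy m f)) := by
  obtain ⟨C, hC⟩ := h.embeds_self
  rcases id h with ⟨hm, rfl⟩ | ⟨rfl, hd, rfl⟩
  · exact ⟨fun _ => 1, continuous_const, fun _ => one_pos, Or.inr fun _ => rfl, C,
      fun f hP hf => by simpa using hC f hP hf⟩
  · have hd' : (3 : ℝ) ≤ d := by exact_mod_cast hd
    have := holderTriple_critical hd
    let w : Space d → ℝ := fun x => (1 + ‖x‖) ^ (-(2 : ℝ))
    have hpos : ∀ x : Space d, 0 < 1 + ‖x‖ := fun x => by positivity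
    have hw : Continuous w := by
      refine Continuous.rpow_const (by fun_prop) fun x => Or.inl (hpos x).ne'
    have hwd : MemLp w (ENNReal.ofReal d) := by
      rw [← integrable_norm_rpow_iff hw.aestronglyMeasurable (by simp; omega)
        ENNReal.ofReal_ne_top, ENNReal.toReal_ofReal (by linarith)]
      have hi := integrable_one_add_norm (E := Space d) (μ := volume) (r := 2 * d) (by
        simp only [finrank_euclideanSpace, Fintype.card_fin]; linarith)
      refine hi.congr (Filter.Eventually.of_forall fun x => ?_)
      simp only [w]
      rw [Real.norm_of_nonneg (Real.rpow_nonneg (hpos x).le _), ← Real.rpow_mul (hpos x).le]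
      congr 1
      ring
    refine ⟨w, hw, fun x => Real.rpow_pos_of_pos (hpos x) _, Or.inl rfl,
      (eLpNorm w (ENNReal.ofReal d) volume).toNNReal * C, fun f hP hf => ?_⟩
    refine (eLpNorm_smul_le_mul_eLpNorm (f := f) (φ := w) (p := ENNReal.ofReal d)
      (q := ENNReal.ofReal (2 * (d : ℝ) / ((d : ℝ) - 2))) hP.1 hw.aestronglyMeasurable).trans ?_
    push_cast
    rw [ENNReal.coe_toNNReal hwd.2.ne, mul_assoc]
    gcongr
    exact hC f hP hf

/-! ### Rellich's theorem -/

theorem memLp_of_continuous_hasCompactSupport {k : Space d → ℂ} (hk : Continuous k)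
    (hs : HasCompactSupport k) (p : ENNReal) : MemLp k p :=
  hk.memLp_of_hasCompactSupport hs

/-- Mollifications of a sequence which is weakly null in a weighted `L²` space converge to zero
in `L²` on bounded sets. -/
theorem tendsto_eLpNorm_mollify_ball {w : Space d → ℝ} (hw : Continuous w) (hw0 : ∀ x, 0 < w x)
    {r : ℕ → Space d → ℂ} (hr : ∀ n, AEStronglyMeasurable (r n) volume) {B : ENNReal} (hB : B ≠ ⊤)
    (hb : ∀ n, eLpNorm (fun x => w x • r n x) 2 volume ≤ B)
    (hweak : WeakL2 (fun n x => w x • r n x) 0) (hri : ∀ n, LocallyIntegrable (r n))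
    (φ : ContDiffBump (0 : Space d)) (R : ℝ) :
    Filter.Tendsto (fun n => eLpNorm (mollify φ (r n)) 2
      (volume.restrict (Metric.closedBall 0 R))) Filter.atTop (nhds 0) := by
  let k : Space d → Space d → ℂ := fun x y => ((φ.normed volume (x - y) / w y : ℝ) : ℂ)
  have hkc : ∀ x, Continuous (k x) := fun x => by
    refine Complex.continuous_ofReal.comp (Continuous.div ?_ hw fun y => (hw0 y).ne')
    exact (φ.continuous_normed).comp (by fun_prop)
  have hks : ∀ x, HasCompactSupport (k x) := fun x => by
    refine HasCompactSupport.intro (isCompact_closedBall x φ.rOut) fun y hy => ?_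
    have : φ.normed volume (x - y) = 0 := by
      by_contra hne
      have hmem : x - y ∈ Function.support (φ.normed volume) := hne
      rw [φ.support_normed_eq, mem_ball_zero_iff] at hmem
      exact hy (by rw [Metric.mem_closedBall, dist_comm, dist_eq_norm]; exact hmem.le)
    simp [k, this]
  have hk2 : ∀ x, MemLp (k x) 2 := fun x => memLp_of_continuous_hasCompactSupport (hkc x) (hks x) 2
  have hmol : ∀ n x, mollify φ (r n) x = ∫ y, k x y * (w y • r n y) := by
    intro n x
    rw [mollify_eq]
    refine integral_congr_ae (Filter.Eventually.of_forall fun y => ?_)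
    have : (w y : ℂ) ≠ 0 := by exact_mod_cast (hw0 y).ne'
    simp only [k, Complex.real_smul]
    push_cast
    field_simp
  have hpt : ∀ x, Filter.Tendsto (fun n => mollify φ (r n) x) Filter.atTop (nhds 0) := by
    intro x
    have := hweak.2 (k x) (hk2 x)
    simp only [Pi.zero_apply, mul_zero, integral_zero] at this
    exact this.congr fun n => (hmol n x).symm
  -- The mollifications converge pointwise; a uniform bound on the ball gives dominated convergence.
  obtain ⟨M, hM⟩ : ∃ M : ℝ, ∀ n, ∀ x ∈ Metric.closedBall (0 : Space d) R,
      ‖mollify φ (r n) x‖ ≤ M := by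
    let S := Metric.closedBall (0 : Space d) (R + φ.rOut)
    have hkk : Continuous (fun z : Space d × Space d => k z.1 z.2) := by
      refine Complex.continuous_ofReal.comp (Continuous.div ?_ (by fun_prop)
        fun z => (hw0 z.2).ne')
      exact (φ.continuous_normed).comp (by fun_prop)
    obtain ⟨M0, hM0⟩ := ((isCompact_closedBall (0 : Space d) R).prod
      (isCompact_closedBall (0 : Space d) (R + φ.rOut))).exists_bound_of_continuousOn
      hkk.continuousOn
    let A : ENNReal := ENNReal.ofReal |M0| * volume S ^ (1 / (2 : ENNReal).toReal) * B
    have hA : A ≠ ⊤ := ENNReal.mul_ne_top (ENNReal.mul_ne_top ENNReal.ofReal_ne_top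
      (ENNReal.rpow_ne_top_of_nonneg (by positivity) measure_closedBall_lt_top.ne)) hB
    refine ⟨A.toReal, fun n x hx => ?_⟩
    have hmeas : AEStronglyMeasurable (fun y => w y • r n y) volume :=
      hw.aestronglyMeasurable.smul (hr n)
    have h1 : ‖mollify φ (r n) x‖ₑ ≤ A := by
      rw [hmol]
      refine (enorm_integral_le_lintegral_enorm _).trans ?_
      rw [← eLpNorm_one_eq_lintegral_enorm]
      have h2 := eLpNorm_smul_le_mul_eLpNorm (p := 2) (q := 2) (r := 1) hmeas
        (hkc x).aestronglyMeasurable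
      simp only [smul_eq_mul] at h2
      refine h2.trans ?_
      refine mul_le_mul' ?_ (hb n)
      refine le_trans (b := eLpNorm (S.indicator fun _ => |M0|) 2 volume) ?_ ?_
      · refine eLpNorm_mono_real fun y => ?_
        by_cases hy : y ∈ S
        · rw [Set.indicator_of_mem hy]
          exact (hM0 (x, y) ⟨hx, hy⟩).trans (le_abs_self _)
        · rw [Set.indicator_of_notMem hy]
          have : φ.normed volume (x - y) = 0 := by
            by_contra hne
            have hmem : x - y ∈ Function.support (φ.normed volume) := hne
            rw [φ.support_normed_eq, mem_ball_zero_iff] at hmem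
            apply hy
            rw [mem_closedBall_zero_iff] at hx ⊢
            have := norm_sub_norm_le y x
            rw [norm_sub_rev] at this
            linarith
          simp [k, this]
      · rw [eLpNorm_indicator_const Metric.isClosed_closedBall.measurableSet (by norm_num)
          (by norm_num), Real.enorm_of_nonneg (abs_nonneg _)]
    have := ENNReal.toReal_mono hA h1
    simpa using this
  have hlim : Filter.Tendsto (fun n => ∫⁻ x in Metric.closedBall (0 : Space d) R,
      ‖mollify φ (r n) x‖ₑ ^ 2) Filter.atTop
      (nhds (∫⁻ _ in Metric.closedBall (0 : Space d) R, 0)) := by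
    refine tendsto_lintegral_of_dominated_convergence' (fun _ => ENNReal.ofReal M ^ 2)
      (fun n => ?_) (fun n => ?_) ?_ ?_
    · exact ((contDiff_mollify φ (hri n)).continuous.aestronglyMeasurable.enorm.pow_const 2)
    · filter_upwards [ae_restrict_mem Metric.isClosed_closedBall.measurableSet] with x hx
      gcongr
      rw [← ofReal_norm]
      exact ENNReal.ofReal_le_ofReal (hM n x hx)
    · simp only [lintegral_const, Measure.restrict_apply_univ]
      exact ENNReal.mul_ne_top (ENNReal.pow_ne_top ENNReal.ofReal_ne_top)
        measure_closedBall_lt_top.ne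
    · refine Filter.Eventually.of_forall fun x => ?_
      have := ((ENNReal.continuous_pow 2).comp continuous_enorm).tendsto (0 : ℂ) |>.comp (hpt x)
      simpa [Function.comp_def] using this
  rw [lintegral_zero] at hlim
  simp only [← eLpNorm_two_sq] at hlim
  have := (ENNReal.continuous_rpow_const (y := 1 / 2)).tendsto _ |>.comp hlim
  have e : ∀ a : ENNReal, (a ^ 2) ^ (1 / 2 : ℝ) = a := fun a => by
    rw [← ENNReal.rpow_natCast, ← ENNReal.rpow_mul]
    norm_num
  simpa only [Function.comp_def, e, ENNReal.zero_rpow_of_pos (by norm_num : (0 : ℝ) < 1 / 2)]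
    using this

end

section

variable {d : ℕ}

/-- Convergence in `L²` on every ball. -/
def TendstoL2Loc (a : ℕ → Space d → ℂ) (b : Space d → ℂ) : Prop :=
  ∀ R : ℝ, Filter.Tendsto (fun n => eLpNorm (a n - b) 2 (volume.restrict (Metric.closedBall 0 R)))
    Filter.atTop (nhds 0)

theorem TendstoL2Loc.comp_subseq {a : ℕ → Space d → ℂ} {b : Space d → ℂ} (h : TendstoL2Loc a b)
    {φ : ℕ → ℕ} (hφ : StrictMono φ) : TendstoL2Loc (fun n => a (φ n)) b :=
  fun R => (h R).comp hφ.tendsto_atTop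

/-- Fatou's lemma for a sequence converging in `L²` on every ball. -/
theorem TendstoL2Loc.eLpNorm_le {a : ℕ → Space d → ℂ} {b : Space d → ℂ} (h : TendstoL2Loc a b)
    (ha : ∀ n, AEStronglyMeasurable (a n) volume) (hb : AEStronglyMeasurable b volume)
    {p K : ENNReal} (hK : ∀ n, eLpNorm (a n) p volume ≤ K) : eLpNorm b p volume ≤ K := by
  have hball : ∀ R : ℝ, eLpNorm b p (volume.restrict (Metric.closedBall 0 R)) ≤ K := by
    intro R
    have h1 := tendstoInMeasure_of_tendsto_eLpNorm (by norm_num) (fun n => (ha n).restrict)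
      hb.restrict (h R)
    obtain ⟨ns, hns, hae⟩ := h1.exists_seq_tendsto_ae
    refine (Lp.eLpNorm_lim_le_liminf_eLpNorm (f := fun n => a (ns n))
      (fun n => (ha (ns n)).restrict) b hae).trans ?_
    refine Filter.liminf_le_of_le (by isBoundedDefault) fun c hc => ?_
    obtain ⟨n, hn⟩ := hc.exists
    exact hn.trans ((eLpNorm_mono_measure _ Measure.restrict_le_self).trans (hK _))
  refine (Lp.eLpNorm_lim_le_liminf_eLpNorm
    (f := fun n : ℕ => (Metric.closedBall (0 : Space d) n).indicator b)
    (fun n => hb.indicator Metric.isClosed_closedBall.measurableSet) b ?_).trans ?_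
  · refine Filter.Eventually.of_forall fun x => tendsto_const_nhds.congr' ?_
    obtain ⟨N, hN⟩ := exists_nat_gt ‖x‖
    filter_upwards [Filter.eventually_ge_atTop N] with n hn
    have : (N : ℝ) ≤ n := by exact_mod_cast hn
    rw [Set.indicator_of_mem]
    rw [mem_closedBall_zero_iff]
    linarith
  · refine Filter.liminf_le_of_le (by isBoundedDefault) fun c hc => ?_
    obtain ⟨n, hn⟩ := hc.exists
    refine hn.trans ?_
    rw [eLpNorm_indicator_eq_eLpNorm_restrict Metric.isClosed_closedBall.measurableSet]
    exact hball n

theorem locallyIntegrable_continuous_smul {f : Space d → ℂ} (hf : LocallyIntegrable f)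
    {ζ : Space d → ℝ} (hζ : Continuous ζ) : LocallyIntegrable (fun x => ζ x • f x) := by
  rw [← locallyIntegrableOn_univ] at *
  exact hf.continuousOn_smul isOpen_univ.isLocallyClosed hζ.continuousOn

/-- Weak limits of gradients are gradients. The functions themselves converge weakly only after
multiplication by the weight. -/
theorem hasWeakPartial_of_weakL2 {w : Space d → ℝ} (hw : Continuous w) (hw0 : ∀ x, 0 < w x)
    {f : ℕ → Space d → ℂ} {g : ℕ → Space d → ℂ} {F G : Space d → ℂ} {j : Fin d}
    (hfg : ∀ n, HasWeakPartial j (f n) (g n)) (hF : WeakL2 (fun n x => w x • f n x) F)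
    (hG : WeakL2 g G) : HasWeakPartial j (fun x => (w x)⁻¹ • F x) G := by
  have hwi : Continuous (fun x => (w x)⁻¹) := hw.inv₀ fun x => (hw0 x).ne'
  have hne : ∀ x, (w x : ℂ) ≠ 0 := fun x => by exact_mod_cast (hw0 x).ne'
  refine ⟨locallyIntegrable_continuous_smul (locallyIntegrable_of_memLp (by norm_num) hF.1) hwi,
    locallyIntegrable_of_memLp (by norm_num) hG.1, fun χ h1 h2 => ?_⟩
  have c1 := continuous_fderiv_single h1 j
  have s1 := hasCompactSupport_fderiv_single h2 j
  have l1 := hF.2 (fun x => ((fderiv ℝ χ x (EuclideanSpace.single j 1) * (w x)⁻¹ : ℝ) : ℂ))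
    (memLp_of_continuous_hasCompactSupport (Complex.continuous_ofReal.comp (c1.mul hwi))
      ((s1.mul_right (f' := fun x => (w x)⁻¹)).comp_left Complex.ofReal_zero) 2)
  have l2 := hG.2 (fun x => ((χ x : ℝ) : ℂ))
    (memLp_of_continuous_hasCompactSupport (Complex.continuous_ofReal.comp h1.continuous)
      (h2.comp_left Complex.ofReal_zero) 2)
  have e : ∀ n, ∫ x, ((fderiv ℝ χ x (EuclideanSpace.single j 1) * (w x)⁻¹ : ℝ) : ℂ) *
      (w x • f n x) = - ∫ x, ((χ x : ℝ) : ℂ) * g n x := by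
    intro n
    have := (hfg n).2.2 χ h1 h2
    simp only [Complex.real_smul] at this
    rw [← this]
    refine integral_congr_ae (Filter.Eventually.of_forall fun x => ?_)
    have := hne x
    simp only [Complex.real_smul]
    push_cast
    field_simp
  simp only [e] at l1
  have := tendsto_nhds_unique l1 l2.neg
  simp only [Complex.real_smul]
  rw [← this]
  refine integral_congr_ae (Filter.Eventually.of_forall fun x => ?_)
  push_cast
  ring

/-- Bounded sequences in a Sobolev space have subsequences which converge in `L²` on bounded sets
and along which the quadratic form splits. -/
theorem exists_subseq_sobolev {m : ℝ} {P : ENNReal} (h : MassExponent d m P)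
    {f : ℕ → Space d → ℂ} (hP : ∀ n, MemLp (f n) P) (hf : ∀ n, HasL2Grad (f n)) {B : ℝ}
    (hB : ∀ n, sobEnergy m (f n) ≤ B) :
    ∃ φ : ℕ → ℕ, StrictMono φ ∧ ∃ F : Space d → ℂ, MemLp F P ∧ HasL2Grad F ∧
      TendstoL2Loc (fun n => f (φ n)) F ∧
      Filter.Tendsto (fun n => sobEnergy m (f (φ n) - F) + sobEnergy m F - sobEnergy m (f (φ n)))
        Filter.atTop (nhds 0) := by
  obtain ⟨w, hw, hw0, hw1, C, hC⟩ := h.exists_weight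
  have h1P : 1 ≤ P := (by norm_num : (1 : ENNReal) ≤ 2).trans h.two_le
  let b : ENNReal := ENNReal.ofReal (√B)
  have hb : b ≠ ⊤ := ENNReal.ofReal_ne_top
  have hE : ∀ n, ENNReal.ofReal (√(sobEnergy m (f n))) ≤ b := fun n =>
    ENNReal.ofReal_le_ofReal (Real.sqrt_le_sqrt (hB n))
  -- The weighted functions and all their partial derivatives, as one finite family of sequences.
  let a : Option (Fin d) → ℕ → Space d → ℂ := fun i n =>
    match i with
    | none => fun x => w x • f n x
    | some j => weakPartial j (f n)
  have ham : ∀ i n, AEStronglyMeasurable (a i n) volume := by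
    intro i n
    cases i with
    | none => exact hw.aestronglyMeasurable.smul (hP n).1
    | some j => exact ((hf n).memLp j).1
  have hab : ∀ i n, eLpNorm (a i n) 2 volume ≤ C * b + b := by
    intro i n
    cases i with
    | none => exact (hC _ (hP n) (hf n)).trans ((mul_le_mul_right (hE n) _).trans le_self_add)
    | some j => exact (eLpNorm_weakPartial_le h.nonneg (hf n) j).trans ((hE n).trans le_add_self)
  have hK : C * b + b ≠ ⊤ :=
    ENNReal.add_ne_top.2 ⟨ENNReal.mul_ne_top ENNReal.coe_ne_top hb, hb⟩
  obtain ⟨φ, hφ, hlim⟩ := exists_subseq_weakL2_finset hK ham hab Finset.univ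
  obtain ⟨H, hH⟩ := hlim none (Finset.mem_univ _)
  choose G hG using fun j : Fin d => hlim (some j) (Finset.mem_univ _)
  let F : Space d → ℂ := fun x => (w x)⁻¹ • H x
  have hwF : (fun x => w x • F x) = H := by
    ext x
    simp only [F, smul_smul, mul_inv_cancel₀ (hw0 x).ne', one_smul]
  have hFG : ∀ j, HasWeakPartial j F (G j) := fun j =>
    hasWeakPartial_of_weakL2 hw hw0 (fun n => (hf (φ n)).hasWeakPartial j) hH (hG j)
  have hFgrad : HasL2Grad F := fun j => ⟨G j, hFG j, (hG j).1⟩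
  have hFi : LocallyIntegrable F := locallyIntegrable_continuous_smul
    (locallyIntegrable_of_memLp (by norm_num) hH.1) (hw.inv₀ fun x => (hw0 x).ne')
  have hfi : ∀ n, LocallyIntegrable (f n) := fun n => locallyIntegrable_of_memLp h1P (hP n)
  let r : ℕ → Space d → ℂ := fun n => f (φ n) - F
  have hri : ∀ n, LocallyIntegrable (r n) := fun n => (hfi _).sub hFi
  have hrg : ∀ n, HasL2Grad (r n) := fun n => (hf _).sub hFgrad
  have hrw : ∀ n, (fun x => w x • r n x) = fun x => a none (φ n) x - H x := by
    intro n
    rw [← hwF]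
    ext x
    simp [r, a, smul_sub]
  have hrb : ∀ n, eLpNorm (fun x => w x • r n x) 2 volume ≤ (C * b + b) + eLpNorm H 2 volume := by
    intro n
    rw [hrw]
    refine (eLpNorm_sub_le (ham none _) hH.1.1 (by norm_num)).trans ?_
    gcongr
    exact hab none _
  have hrweak : WeakL2 (fun n x => w x • r n x) 0 := by
    refine ⟨MemLp.zero, fun k hk => ?_⟩
    have h1 := (hH.2 k hk).sub (tendsto_const_nhds (x := ∫ x, k x * H x))
    rw [sub_self] at h1
    simp only [Pi.zero_apply, mul_zero, integral_zero]
    refine h1.congr fun n => ?_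
    have i1 : Integrable (fun x => k x * a none (φ n) x) := integrable_mul_of_memLp_two hk
      ⟨ham none _, (hab none _).trans_lt hK.lt_top⟩
    rw [← integral_sub i1 (integrable_mul_of_memLp_two hk hH.1)]
    refine integral_congr_ae (Filter.Eventually.of_forall fun x => ?_)
    have := congrFun (hrw n) x
    beta_reduce
    rw [this]
    ring
  have hgr : ∀ n j, weakPartial j (r n) =ᵐ[volume] fun x => weakPartial j (f (φ n)) x - G j x :=
    fun n j => (((hf _).hasWeakPartial j).sub (hFG j)).weakPartial
  have hgF : ∀ j, weakPartial j F =ᵐ[volume] G j := fun j => (hFG j).weakPartial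
  let D : ENNReal := ∑ j, ((C * b + b) + eLpNorm (G j) 2 volume)
  have hD : D ≠ ⊤ := by
    refine (ENNReal.sum_lt_top.2 fun j _ => ?_).ne
    exact ENNReal.add_lt_top.2 ⟨hK.lt_top, (hG j).1.2⟩
  have hrD : ∀ n, ∑ j, eLpNorm (weakPartial j (r n)) 2 volume ≤ D := by
    intro n
    refine Finset.sum_le_sum fun j _ => ?_
    rw [eLpNorm_congr_ae (hgr n j)]
    refine (eLpNorm_sub_le (ham (some j) _) (hG j).1.1 (by norm_num)).trans ?_
    gcongr
    exact hab (some j) _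
  -- Rellich: the mollification error is uniformly small, and the mollifications of `r n` vanish in
  -- the limit.
  have hloc : TendstoL2Loc (fun n => f (φ n)) F := by
    intro R
    refine ENNReal.tendsto_nhds_zero.2 fun ε hε => ?_
    have hε2 : 0 < ε / 2 := ENNReal.half_pos hε.ne'
    have lim1 : Filter.Tendsto (fun n => ENNReal.ofReal (bumpSeq d n).rOut * D) Filter.atTop
        (nhds 0) := by
      have a1 := ENNReal.tendsto_ofReal (tendsto_bumpSeq_rOut d)
      simpa using ENNReal.Tendsto.mul_const (b := D) a1 (Or.inr hD)
    obtain ⟨k, hk⟩ := (lim1.eventually_lt_const hε2).exists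
    have lim2 := tendsto_eLpNorm_mollify_ball hw hw0 (fun n => (hri n).aestronglyMeasurable)
      (ENNReal.add_ne_top.2 ⟨hK, hH.1.2.ne⟩) hrb hrweak hri (bumpSeq d k) R
    filter_upwards [lim2.eventually_lt_const hε2] with n hn
    have e : r n = mollify (bumpSeq d k) (r n) - (mollify (bumpSeq d k) (r n) - r n) := by simp
    have hmm : AEStronglyMeasurable (mollify (bumpSeq d k) (r n)) volume :=
      (contDiff_mollify _ (hri n)).continuous.aestronglyMeasurable
    change eLpNorm (r n) 2 _ ≤ ε
    rw [e]
    refine (eLpNorm_sub_le hmm.restrict (hmm.sub (hri n).aestronglyMeasurable).restrict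
      (by norm_num)).trans ?_
    rw [← ENNReal.add_halves ε]
    refine add_le_add hn.le (le_trans ?_ hk.le)
    refine (eLpNorm_mono_measure _ Measure.restrict_le_self).trans ?_
    refine (eLpNorm_mollify_sub_le (hrg n) (hri n) _).trans ?_
    gcongr
    exact hrD n
  obtain ⟨C', hC'⟩ := h.embeds_self
  have hFP : MemLp F P := by
    refine ⟨hFi.aestronglyMeasurable, lt_of_le_of_lt (hloc.eLpNorm_le (fun n => (hP _).1)
      hFi.aestronglyMeasurable (K := C' * b) fun n => ?_)
      (ENNReal.mul_lt_top ENNReal.coe_lt_top hb.lt_top)⟩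
    exact (hC' _ (hP _) (hf _)).trans (mul_le_mul_right (hE _) _)
  refine ⟨φ, hφ, F, hFP, hFgrad, hloc, ?_⟩
  have hgrad : Filter.Tendsto (fun n => gradSq (r n) + gradSq F - gradSq (f (φ n))) Filter.atTop
      (nhds 0) := by
    have h1 := tendsto_finsetSum Finset.univ fun (j : Fin d) _ =>
      (hG j).tendsto_split fun n => (hf (φ n)).memLp j
    rw [Finset.sum_const_zero] at h1
    refine h1.congr fun n => ?_
    unfold gradSq
    rw [← Finset.sum_add_distrib, ← Finset.sum_sub_distrib]
    refine Finset.sum_congr rfl fun j _ => ?_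
    congr 2
    · refine integral_congr_ae ?_
      filter_upwards [hgr n j] with x hx
      rw [hx]
    · refine integral_congr_ae ?_
      filter_upwards [hgF j] with x hx
      rw [hx]
  have hmass : Filter.Tendsto (fun n => m * massSq (r n) + m * massSq F - m * massSq (f (φ n)))
      Filter.atTop (nhds 0) := by
    -- In the massless case there is nothing to split; otherwise the weight is `1`.
    rcases hw1 with rfl | hw1
    · simp
    · have hFH : F = H := by
        ext x
        simp [F, hw1]
      have ha : ∀ n, a none n = f n := fun n => by
        ext x
        simp [a, hw1]
      have hmem : ∀ n, MemLp (a none (φ n)) 2 := fun n =>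
        ⟨ham none _, (hab none _).trans_lt hK.lt_top⟩
      have h1 := (hH.tendsto_split hmem).const_mul m
      rw [mul_zero] at h1
      refine h1.congr fun n => ?_
      rw [ha, ← hFH, mul_sub, mul_add]
      rfl
  have := hgrad.add hmass
  rw [add_zero] at this
  refine this.congr fun n => ?_
  unfold sobEnergy
  simp only [r]
  ring

end

/-! ### The interaction term -/

section

variable {d : ℕ}

theorem holderTriple_ofReal {a b c : ℝ} (ha : 0 < a) (hb : 0 < b) (hc : 0 < c)
    (h : 1 / a + 1 / b = 1 / c) :
    ENNReal.HolderTriple (ENNReal.ofReal a) (ENNReal.ofReal b) (ENNReal.ofReal c) := by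
  constructor
  rw [← ENNReal.ofReal_inv_of_pos ha, ← ENNReal.ofReal_inv_of_pos hb,
    ← ENNReal.ofReal_add (by positivity) (by positivity), ← ENNReal.ofReal_inv_of_pos hc]
  congr 1
  simpa [one_div] using h

/-- A pair of exponents `(p, q)` for which `∫ u² v̄` is controlled by the norms of `u` in `L^p` and
of `v` in `L^q`. -/
def InteractionExponents (p q : ℝ) : Prop := 2 ≤ p ∧ 2 ≤ q ∧ 2 / p + 1 / q = 1

theorem InteractionExponents.lintegral_le {p q : ℝ} (h : InteractionExponents p q)
    {a b c : Space d → ℂ} (ha : AEStronglyMeasurable a volume)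
    (hb : AEStronglyMeasurable b volume) (hc : AEStronglyMeasurable c volume) :
    ∫⁻ x, ‖a x‖ₑ * ‖b x‖ₑ * ‖c x‖ₑ ≤ eLpNorm a (ENNReal.ofReal p) volume *
      eLpNorm b (ENNReal.ofReal p) volume * eLpNorm c (ENNReal.ofReal q) volume := by
  obtain ⟨hp, hq, hpq⟩ := h
  have hp0 : 0 < p := by linarith
  have hq0 : 0 < q := by linarith
  have := holderTriple_ofReal hp0 hp0 (half_pos hp0) (by field_simp; norm_num)
  have := holderTriple_ofReal (half_pos hp0) hq0 one_pos (by
    rw [one_div_one, one_div_div]; exact hpq)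
  have h1 := eLpNorm_smul_le_mul_eLpNorm (r := ENNReal.ofReal (p / 2)) (p := ENNReal.ofReal p)
    (q := ENNReal.ofReal p) hb ha
  have h2 := eLpNorm_smul_le_mul_eLpNorm (r := ENNReal.ofReal 1) (p := ENNReal.ofReal (p / 2))
    (q := ENNReal.ofReal q) hc (ha.smul hb)
  rw [ENNReal.ofReal_one, eLpNorm_one_eq_lintegral_enorm] at h2
  have e : ∀ x, ‖((a • b) • c) x‖ₑ = ‖a x‖ₑ * ‖b x‖ₑ * ‖c x‖ₑ := fun x => by
    simp [enorm_mul]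
  simp only [e] at h2
  exact h2.trans (mul_le_mul_left h1 _)

theorem InteractionExponents.integrable {p q : ℝ} (h : InteractionExponents p q)
    {a b c : Space d → ℂ} (ha : MemLp a (ENNReal.ofReal p)) (hb : MemLp b (ENNReal.ofReal p))
    (hc : MemLp c (ENNReal.ofReal q)) : Integrable (fun x => a x * b x * conj (c x)) := by
  refine ⟨(ha.1.mul hb.1).mul (Complex.continuous_conj.comp_aestronglyMeasurable hc.1), ?_⟩
  refine lt_of_eq_of_lt (lintegral_congr fun x => ?_)
    ((h.lintegral_le ha.1 hb.1 hc.1).trans_lt (ENNReal.mul_lt_top (ENNReal.mul_lt_top ha.2 hb.2)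
      hc.2))
  simp only [enorm_mul]
  congr 1
  exact (RCLike.enorm_conj (c x))

theorem InteractionExponents.integrable_interaction {p q : ℝ} (h : InteractionExponents p q)
    {u v : Space d → ℂ} (hu : MemLp u (ENNReal.ofReal p)) (hv : MemLp v (ENNReal.ofReal q)) :
    Integrable (fun x => u x ^ 2 * conj (v x)) := by
  simpa [sq] using h.integrable hu hu hv

theorem InteractionExponents.abs_interaction_le {p q : ℝ} (h : InteractionExponents p q)
    {w : Pair d} (hu : MemLp w.1 (ENNReal.ofReal p)) (hv : MemLp w.2 (ENNReal.ofReal q)) :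
    ENNReal.ofReal |interaction w| ≤ eLpNorm w.1 (ENNReal.ofReal p) volume *
      eLpNorm w.1 (ENNReal.ofReal p) volume * eLpNorm w.2 (ENNReal.ofReal q) volume := by
  refine le_trans ?_ (h.lintegral_le hu.1 hu.1 hv.1)
  calc ENNReal.ofReal |interaction w| ≤ ENNReal.ofReal ‖∫ x, w.1 x ^ 2 * conj (w.2 x)‖ :=
        ENNReal.ofReal_le_ofReal (Complex.abs_re_le_norm _)
    _ = ‖∫ x, w.1 x ^ 2 * conj (w.2 x)‖ₑ := ofReal_norm _
    _ ≤ ∫⁻ x, ‖w.1 x ^ 2 * conj (w.2 x)‖ₑ := enorm_integral_le_lintegral_enorm _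
    _ = _ := by
        refine lintegral_congr fun x => ?_
        rw [enorm_mul, sq, enorm_mul]
        congr 1
        exact RCLike.enorm_conj _

/-- A product of three factors, one of them fixed, tends to zero if one of the moving factors is
locally null and the other one is locally bounded. -/
theorem tendsto_lintegral_fixed_factor {A : Space d → ℂ} {x y : ℕ → Space d → ℂ} {p : ENNReal}
    (hp0 : p ≠ 0) (hp : p ≠ ⊤) (hA : MemLp A p) (hx : ∀ n, AEStronglyMeasurable (x n) volume)
    (hy : ∀ n, AEStronglyMeasurable (y n) volume) {K : ENNReal} (hK : K ≠ ⊤)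
    (hbound : ∀ n, ∀ a : Space d → ℂ, AEStronglyMeasurable a volume →
      ∫⁻ z, ‖a z‖ₑ * ‖x n z‖ₑ * ‖y n z‖ₑ ≤ K * eLpNorm a p volume)
    (hx0 : TendstoL2Loc x 0)
    (hyb : ∀ R : ℝ, ∃ L : ENNReal, L ≠ ⊤ ∧
      ∀ n, eLpNorm (y n) 2 (volume.restrict (Metric.closedBall 0 R)) ≤ L) :
    Filter.Tendsto (fun n => ∫⁻ z, ‖A z‖ₑ * ‖x n z‖ₑ * ‖y n z‖ₑ) Filter.atTop (nhds 0) := by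
  refine ENNReal.tendsto_nhds_zero.2 fun ε hε => ?_
  have hε2 : 0 < ε / 2 := ENNReal.half_pos hε.ne'
  -- Off `S k` the fixed factor is bounded by `k` and the point lies in the ball of radius `k`.
  let S : ℕ → Set (Space d) := fun k => (Metric.closedBall 0 k)ᶜ ∪ {z | (k : ℝ) < ‖A z‖}
  have hS : ∀ k, NullMeasurableSet (S k) volume := fun k =>
    (Metric.isClosed_closedBall.measurableSet.compl.nullMeasurableSet).union
      (nullMeasurableSet_lt aemeasurable_const hA.1.norm.aemeasurable)
  have hlim := tendsto_eLpNorm_indicator_zero hp0 hp hA hS (fun z => by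
    obtain ⟨N, hN⟩ := exists_nat_gt (max ‖z‖ ‖A z‖)
    filter_upwards [Filter.eventually_ge_atTop N] with n hn
    have : (N : ℝ) ≤ n := by exact_mod_cast hn
    have h1 := (le_max_left _ _).trans_lt hN
    have h2 := (le_max_right _ _).trans_lt hN
    simp only [S, Set.mem_union, Set.mem_compl_iff, mem_closedBall_zero_iff, Set.mem_ofPred_eq,
      not_or, not_not, not_lt]
    exact ⟨by linarith, by linarith⟩)
  have hlim' := ENNReal.Tendsto.const_mul hlim (Or.inr hK)
  rw [mul_zero] at hlim'
  obtain ⟨k, hk⟩ := (hlim'.eventually_lt_const hε2).exists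
  obtain ⟨L, hL, hLb⟩ := hyb k
  have h2 : Filter.Tendsto (fun n => ENNReal.ofReal k *
      (eLpNorm (x n) 2 (volume.restrict (Metric.closedBall 0 k)) * L)) Filter.atTop (nhds 0) := by
    have a1 := ENNReal.Tendsto.mul_const (b := L) (hx0 k) (Or.inr hL)
    have a2 := ENNReal.Tendsto.const_mul (a := ENNReal.ofReal k) a1 (Or.inr ENNReal.ofReal_ne_top)
    simpa using a2
  filter_upwards [h2.eventually_lt_const hε2] with n hn
  have hsplit : ∀ z, ‖A z‖ₑ * ‖x n z‖ₑ * ‖y n z‖ₑ ≤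
      ‖(S k).indicator A z‖ₑ * ‖x n z‖ₑ * ‖y n z‖ₑ +
      (Metric.closedBall (0 : Space d) k).indicator
        (fun z => ENNReal.ofReal k * (‖x n z‖ₑ * ‖y n z‖ₑ)) z := by
    intro z
    by_cases hz : z ∈ S k
    · rw [Set.indicator_of_mem hz]
      exact le_self_add
    · simp only [S, Set.mem_union, Set.mem_compl_iff, Set.mem_ofPred_eq, not_or, not_not,
        not_lt] at hz
      rw [Set.indicator_of_mem hz.1, ← mul_assoc]
      refine le_trans ?_ le_add_self
      gcongr
      rw [← ofReal_norm]
      exact ENNReal.ofReal_le_ofReal hz.2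
  refine (lintegral_mono hsplit).trans ?_
  have hmeas : AEMeasurable (fun z => ENNReal.ofReal k * (‖x n z‖ₑ * ‖y n z‖ₑ)) volume :=
    aemeasurable_const.mul ((hx n).enorm.mul (hy n).enorm)
  rw [lintegral_add_right' _ (hmeas.indicator Metric.isClosed_closedBall.measurableSet),
    ← ENNReal.add_halves ε]
  refine add_le_add ((hbound n _ (hA.1.indicator₀ (hS k))).trans hk.le) (le_trans ?_ hn.le)
  rw [lintegral_indicator Metric.isClosed_closedBall.measurableSet,
    lintegral_const_mul' _ _ ENNReal.ofReal_ne_top]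
  gcongr
  have h3 := eLpNorm_smul_le_mul_eLpNorm (p := 2) (q := 2) (r := 1)
    (μ := volume.restrict (Metric.closedBall 0 (k : ℝ))) (hy n).restrict (hx n).restrict
  rw [eLpNorm_one_eq_lintegral_enorm] at h3
  simp only [Pi.smul_apply', smul_eq_mul, enorm_mul] at h3
  exact h3.trans (mul_le_mul_right (hLb n) _)

theorem eLpNorm_two_ball_le {p : ℝ} (hp : 2 ≤ p) {a : ℕ → Space d → ℂ}
    (ha : ∀ n, AEStronglyMeasurable (a n) volume) {K : ENNReal} (hK : K ≠ ⊤)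
    (hb : ∀ n, eLpNorm (a n) (ENNReal.ofReal p) volume ≤ K) (R : ℝ) : ∃ L : ENNReal, L ≠ ⊤ ∧
      ∀ n, eLpNorm (a n) 2 (volume.restrict (Metric.closedBall 0 R)) ≤ L := by
  have h2p : (2 : ENNReal) ≤ ENNReal.ofReal p := by
    rw [show (2 : ENNReal) = ENNReal.ofReal 2 by simp]
    exact ENNReal.ofReal_le_ofReal hp
  have hexp : 0 ≤ 1 / (2 : ENNReal).toReal - 1 / (ENNReal.ofReal p).toReal := by
    rw [ENNReal.toReal_ofReal (by linarith), ENNReal.toReal_ofNat, sub_nonneg]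
    exact one_div_le_one_div_of_le (by norm_num) hp
  refine ⟨K * volume (Metric.closedBall (0 : Space d) R) ^
    (1 / (2 : ENNReal).toReal - 1 / (ENNReal.ofReal p).toReal), ENNReal.mul_ne_top hK
      (ENNReal.rpow_ne_top_of_nonneg hexp measure_closedBall_lt_top.ne), fun n => ?_⟩
  refine (eLpNorm_le_eLpNorm_mul_rpow_measure_univ h2p (ha n).restrict).trans ?_
  rw [Measure.restrict_apply_univ]
  gcongr
  exact (eLpNorm_mono_measure _ Measure.restrict_le_self).trans (hb n)

/-- The Brezis–Lieb splitting of the interaction. Every cross term contains a factor of the limit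
`z` and a factor of `w n - z`, which is locally null in `L²`. -/
theorem InteractionExponents.tendsto_interaction_split {p q : ℝ} (h : InteractionExponents p q)
    {w : ℕ → Pair d} {z : Pair d}
    (hu : ∀ n, MemLp (w n).1 (ENNReal.ofReal p)) (hv : ∀ n, MemLp (w n).2 (ENNReal.ofReal q))
    (hu' : MemLp z.1 (ENNReal.ofReal p)) (hv' : MemLp z.2 (ENNReal.ofReal q)) {K : ENNReal}
    (hK : K ≠ ⊤) (hub : ∀ n, eLpNorm (w n).1 (ENNReal.ofReal p) volume ≤ K)
    (hvb : ∀ n, eLpNorm (w n).2 (ENNReal.ofReal q) volume ≤ K)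
    (hlu : TendstoL2Loc (fun n => (w n).1) z.1) (hlv : TendstoL2Loc (fun n => (w n).2) z.2) :
    Filter.Tendsto (fun n => interaction (w n) - interaction (w n - z) - interaction z)
      Filter.atTop (nhds 0) := by
  obtain ⟨hp, hq, hpq⟩ := id h
  have h1p : (1 : ENNReal) ≤ ENNReal.ofReal p := by
    rw [show (1 : ENNReal) = ENNReal.ofReal 1 by simp]
    exact ENNReal.ofReal_le_ofReal (by linarith)
  have h1q : (1 : ENNReal) ≤ ENNReal.ofReal q := by
    rw [show (1 : ENNReal) = ENNReal.ofReal 1 by simp]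
    exact ENNReal.ofReal_le_ofReal (by linarith)
  have hp0 : ENNReal.ofReal p ≠ 0 := (zero_lt_one.trans_le h1p).ne'
  have hq0 : ENNReal.ofReal q ≠ 0 := (zero_lt_one.trans_le h1q).ne'
  let r : ℕ → Space d → ℂ := fun n => (w n).1 - z.1
  let s : ℕ → Space d → ℂ := fun n => (w n).2 - z.2
  have hr : ∀ n, MemLp (r n) (ENNReal.ofReal p) := fun n => (hu n).sub hu'
  have hs : ∀ n, MemLp (s n) (ENNReal.ofReal q) := fun n => (hv n).sub hv'
  let K' : ENNReal := K + eLpNorm z.1 (ENNReal.ofReal p) volume +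
    eLpNorm z.2 (ENNReal.ofReal q) volume
  have hK' : K' ≠ ⊤ := ENNReal.add_ne_top.2 ⟨ENNReal.add_ne_top.2 ⟨hK, hu'.2.ne⟩, hv'.2.ne⟩
  have hrb : ∀ n, eLpNorm (r n) (ENNReal.ofReal p) volume ≤ K' := fun n =>
    (eLpNorm_sub_le (hu n).1 hu'.1 h1p).trans ((add_le_add_left (hub n) _).trans le_self_add)
  have hsb : ∀ n, eLpNorm (s n) (ENNReal.ofReal q) volume ≤ K' := fun n =>
    (eLpNorm_sub_le (hv n).1 hv'.1 h1q).trans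
      (add_le_add_left ((hvb n).trans le_self_add) _)
  have hzu : eLpNorm z.1 (ENNReal.ofReal p) volume ≤ K' := le_add_self.trans le_self_add
  have hzv : eLpNorm z.2 (ENNReal.ofReal q) volume ≤ K' := le_add_self
  have hr0 : TendstoL2Loc r 0 := fun R => by simpa using hlu R
  have hs0 : TendstoL2Loc s 0 := fun R => by simpa using hlv R
  have hKK : K' * K' ≠ ⊤ := ENNReal.mul_ne_top hK' hK'
  have t1 := tendsto_lintegral_fixed_factor (x := r) (y := fun _ => z.2) hp0 ENNReal.ofReal_ne_top
    hu' (fun n => (hr n).1) (fun _ => hv'.1) hKK (fun n a ha => by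
      refine (h.lintegral_le ha (hr n).1 hv'.1).trans ?_
      rw [mul_assoc, mul_comm]
      gcongr
      exact hrb n) hr0 (eLpNorm_two_ball_le hq (fun _ => hv'.1) hK' fun _ => hzv)
  have t2 := tendsto_lintegral_fixed_factor (x := r) (y := s) hp0 ENNReal.ofReal_ne_top
    hu' (fun n => (hr n).1) (fun n => (hs n).1) hKK (fun n a ha => by
      refine (h.lintegral_le ha (hr n).1 (hs n).1).trans ?_
      rw [mul_assoc, mul_comm]
      gcongr
      · exact hrb n
      · exact hsb n) hr0 (eLpNorm_two_ball_le hq (fun n => (hs n).1) hK' hsb)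
  have t3 := tendsto_lintegral_fixed_factor (x := r) (y := r) hq0 ENNReal.ofReal_ne_top
    hv' (fun n => (hr n).1) (fun n => (hr n).1) hKK (fun n a ha => by
      have := h.lintegral_le (hr n).1 (hr n).1 ha
      refine le_trans (le_of_eq (lintegral_congr fun x => by ring)) (this.trans ?_)
      gcongr
      · exact hrb n
      · exact hrb n) hr0 (eLpNorm_two_ball_le hp (fun n => (hr n).1) hK' hrb)
  have t4 := tendsto_lintegral_fixed_factor (x := s) (y := fun _ => z.1) hp0 ENNReal.ofReal_ne_top
    hu' (fun n => (hs n).1) (fun _ => hu'.1) hKK (fun n a ha => by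
      have := h.lintegral_le ha hu'.1 (hs n).1
      refine le_trans (le_of_eq (lintegral_congr fun x => by ring)) (this.trans ?_)
      rw [mul_assoc, mul_comm]
      gcongr
      exact hsb n) hs0 (eLpNorm_two_ball_le hp (fun _ => hu'.1) hK' fun _ => hzu)
  have hsum := ((ENNReal.Tendsto.const_mul (a := 2) t1 (Or.inr (by norm_num))).add
    (ENNReal.Tendsto.const_mul (a := 2) t2 (Or.inr (by norm_num)))).add (t3.add t4)
  simp only [mul_zero, add_zero] at hsum
  rw [tendsto_zero_iff_abs_tendsto_zero]
  have hfin : ∀ᶠ n in Filter.atTop, |interaction (w n) - interaction (w n - z) - interaction z| ≤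
      (2 * (∫⁻ x, ‖z.1 x‖ₑ * ‖r n x‖ₑ * ‖z.2 x‖ₑ) +
        2 * (∫⁻ x, ‖z.1 x‖ₑ * ‖r n x‖ₑ * ‖s n x‖ₑ) +
        ((∫⁻ x, ‖z.2 x‖ₑ * ‖r n x‖ₑ * ‖r n x‖ₑ) +
          ∫⁻ x, ‖z.1 x‖ₑ * ‖s n x‖ₑ * ‖z.1 x‖ₑ)).toReal := by
    filter_upwards [hsum.eventually_lt_const zero_lt_one] with n hn
    have i1 := h.integrable_interaction (hu n) (hv n)
    have i2 := h.integrable_interaction (hr n) (hs n)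
    have i3 := h.integrable_interaction hu' hv'
    have e1 : interaction (w n) - interaction (w n - z) - interaction z =
        (∫ x, ((w n).1 x ^ 2 * conj ((w n).2 x) - r n x ^ 2 * conj (s n x) -
          z.1 x ^ 2 * conj (z.2 x))).re := by
      have i12 : Integrable (fun x => (w n).1 x ^ 2 * conj ((w n).2 x) -
        r n x ^ 2 * conj (s n x)) := i1.sub i2
      rw [integral_sub i12 i3, integral_sub i1 i2]
      rfl
    rw [e1]
    refine (Complex.abs_re_le_norm _).trans ?_
    rw [← toReal_enorm]
    refine ENNReal.toReal_mono (hn.trans ENNReal.one_lt_top).ne ?_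
    refine (enorm_integral_le_lintegral_enorm _).trans ?_
    have mz := hu'.1.enorm
    have mv := hv'.1.enorm
    have mr := (hr n).1.enorm
    have ms := (hs n).1.enorm
    rw [← lintegral_const_mul' _ _ (by norm_num), ← lintegral_const_mul' _ _ (by norm_num),
      ← lintegral_add_right' _ (by fun_prop), ← lintegral_add_right' _ (by fun_prop),
      ← lintegral_add_right' _ (by fun_prop)]
    refine lintegral_mono fun x => ?_
    have e2 : (w n).1 x ^ 2 * conj ((w n).2 x) - r n x ^ 2 * conj (s n x) -
        z.1 x ^ 2 * conj (z.2 x) = 2 * (z.1 x * r n x * conj (z.2 x)) +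
          2 * (z.1 x * r n x * conj (s n x)) + (conj (z.2 x) * r n x * r n x +
          z.1 x * conj (s n x) * z.1 x) := by
      simp only [r, s, Pi.sub_apply, map_sub]
      ring
    rw [e2]
    have hc : ∀ a : ℂ, ‖conj a‖ₑ = ‖a‖ₑ := fun a => RCLike.enorm_conj a
    have h2 : ‖(2 : ℂ)‖ₑ = 2 := by
      rw [← ofReal_norm]
      simp
    refine (enorm_add_le _ _).trans (add_le_add ((enorm_add_le _ _).trans (le_of_eq ?_))
      ((enorm_add_le _ _).trans (le_of_eq ?_)))
    · simp only [enorm_mul, hc, h2]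
    · simp only [enorm_mul, hc]
  have hR := (ENNReal.tendsto_toReal ENNReal.zero_ne_top).comp hsum
  rw [ENNReal.toReal_zero] at hR
  exact tendsto_of_tendsto_of_tendsto_of_le_of_le' tendsto_const_nhds hR
    (Filter.Eventually.of_forall fun _ => abs_nonneg _) hfin

end

/-! ### Modulations, translations and the quadratic form -/

section

variable {d : ℕ}

theorem norm_modulate (b : Space d) (f : Space d → ℂ) (x : Space d) :
    ‖modulate b f x‖ = ‖f x‖ := by
  simp [modulate, Complex.norm_exp]

theorem continuous_phase (b : Space d) :
    Continuous (fun x : Space d => Complex.exp (Complex.I * ((inner ℝ b x : ℝ) : ℂ))) := by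
  fun_prop

theorem aestronglyMeasurable_modulate (b : Space d) {f : Space d → ℂ}
    (hf : AEStronglyMeasurable f volume) : AEStronglyMeasurable (modulate b f) volume :=
  (continuous_phase b).aestronglyMeasurable.mul hf

theorem modulate_neg_modulate (b : Space d) (f : Space d → ℂ) :
    modulate (-b) (modulate b f) = f := by
  ext x
  simp only [modulate]
  rw [← mul_assoc, ← Complex.exp_add]
  simp

theorem modulate_modulate_neg (b : Space d) (f : Space d → ℂ) :
    modulate b (modulate (-b) f) = f := by
  simpa using modulate_neg_modulate (-b) f

theorem modulate_add (b : Space d) (f g : Space d → ℂ) :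
    modulate b (f + g) = modulate b f + modulate b g := by
  ext x
  simp only [modulate, Pi.add_apply]
  ring

theorem modulate_sub (b : Space d) (f g : Space d → ℂ) :
    modulate b (f - g) = modulate b f - modulate b g := by
  ext x
  simp only [modulate, Pi.sub_apply]
  ring

theorem modulate_smul (b : Space d) (f : Space d → ℂ) (s : ℝ) :
    modulate b (s • f) = s • modulate b f := by
  ext x
  simp only [modulate, Pi.smul_apply, Complex.real_smul]
  ring

theorem eLpNorm_modulate (b : Space d) (f : Space d → ℂ) (p : ENNReal) (μ : Measure (Space d)) :
    eLpNorm (modulate b f) p μ = eLpNorm f p μ :=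
  eLpNorm_congr_norm_ae (Filter.Eventually.of_forall fun x => norm_modulate b f x)

theorem memLp_modulate_iff (b : Space d) {f : Space d → ℂ} {p : ENNReal} :
    MemLp (modulate b f) p ↔ MemLp f p := by
  have h : ∀ (b : Space d) (f : Space d → ℂ), MemLp f p → MemLp (modulate b f) p := fun b f hf =>
    ⟨aestronglyMeasurable_modulate b hf.1, by rw [eLpNorm_modulate]; exact hf.2⟩
  refine ⟨fun hf => ?_, h b f⟩
  simpa [modulate_neg_modulate] using h (-b) _ hf

theorem massSq_modulate (b : Space d) (f : Space d → ℂ) : massSq (modulate b f) = massSq f := by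
  simp [massSq, norm_modulate]

theorem tendstoL2Loc_modulate (b : Space d) {a : ℕ → Space d → ℂ} {f : Space d → ℂ}
    (h : TendstoL2Loc a f) : TendstoL2Loc (fun n => modulate b (a n)) (modulate b f) := by
  intro R
  simp only [← modulate_sub, eLpNorm_modulate]
  exact h R

theorem modulate_comp_add_right (b : Space d) (f : Space d → ℂ) (y : Space d) :
    modulate b (fun x => f (x + y)) =
      fun x => Complex.exp (-(Complex.I * ((inner ℝ b y : ℝ) : ℂ))) * modulate b f (x + y) := by
  ext x
  simp only [modulate]
  rw [← mul_assoc, ← Complex.exp_add, inner_add_right]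
  congr 2
  push_cast
  ring

theorem norm_exp_neg_I_mul (t : ℝ) : ‖Complex.exp (-(Complex.I * (t : ℂ)))‖ = 1 := by
  simp [Complex.norm_exp]

theorem sobEnergy_phase_translate {m : ℝ} {f : Space d → ℂ} (hf : HasL2Grad f) {z : ℂ}
    (hz : ‖z‖ = 1) (y : Space d) : sobEnergy m (fun x => z * f (x + y)) = sobEnergy m f := by
  have h1 : massSq (fun x => z * f (x + y)) = massSq f := by
    unfold massSq
    simp only [norm_mul, hz, one_mul]
    exact integral_add_right_eq_self (fun x => ‖f x‖ ^ 2) y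
  have h2 : gradSq (fun x => z * f (x + y)) = gradSq f := by
    unfold gradSq
    refine Finset.sum_congr rfl fun j _ => ?_
    rw [← integral_add_right_eq_self (fun x => ‖weakPartial j f x‖ ^ 2) y]
    refine integral_congr_ae ?_
    filter_upwards [(((hf.hasWeakPartial j).comp_add_right y).const_mul z).weakPartial] with x hx
    rw [hx, norm_mul, hz, one_mul]
  unfold sobEnergy
  rw [h1, h2]

theorem mollify_phase_translate (φ : ContDiffBump (0 : Space d)) (f : Space d → ℂ) (z : ℂ)
    (y : Space d) : mollify φ (fun x => z * f (x + y)) 0 = z * mollify φ f y := by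
  rw [mollify_eq, mollify_eq, ← integral_const_mul,
    ← integral_add_right_eq_self (fun x => z * φ.normed volume (y - x) • f x) y]
  refine integral_congr_ae (Filter.Eventually.of_forall fun x => ?_)
  simp only [Complex.real_smul]
  rw [show y - (x + y) = 0 - x by abel]
  ring

theorem tendsto_mollify_zero_of_tendstoL2Loc {a : ℕ → Space d → ℂ} {f : Space d → ℂ}
    (h : TendstoL2Loc a f) (ha : ∀ n, LocallyIntegrable (a n)) (hf : LocallyIntegrable f)
    (φ : ContDiffBump (0 : Space d)) :
    Filter.Tendsto (fun n => mollify φ (a n) 0) Filter.atTop (nhds (mollify φ f 0)) := by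
  let k : Space d → ℝ := fun y => φ.normed volume (0 - y)
  have hk : Continuous k := (φ.continuous_normed).comp (by fun_prop)
  have hks : HasCompactSupport k := by
    have := (φ.hasCompactSupport_normed (μ := volume)).comp_homeomorph (Homeomorph.subLeft 0)
    simpa [Function.comp_def, k] using this
  have hk0 : ∀ y, y ∉ Metric.closedBall (0 : Space d) φ.rOut → k y = 0 := by
    intro y hy
    by_contra hne
    have hmem : 0 - y ∈ Function.support (φ.normed volume) := hne
    rw [φ.support_normed_eq, mem_ball_zero_iff, zero_sub, norm_neg] at hmem
    exact hy (by rw [mem_closedBall_zero_iff]; exact hmem.le)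
  have hk2 : MemLp k 2 volume := hk.memLp_of_hasCompactSupport hks
  rw [tendsto_iff_edist_tendsto_0]
  have hlim := ENNReal.Tendsto.const_mul (a := eLpNorm k 2 volume) (h φ.rOut)
    (Or.inr hk2.2.ne)
  rw [mul_zero] at hlim
  refine tendsto_of_tendsto_of_tendsto_of_le_of_le tendsto_const_nhds hlim (fun _ => zero_le)
    fun n => ?_
  have i1 := (ha n).integrable_smul_left_of_hasCompactSupport hk hks
  have i2 := hf.integrable_smul_left_of_hasCompactSupport hk hks
  rw [edist_eq_enorm_sub, mollify_eq, mollify_eq, ← integral_sub i1 i2]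
  have e : ∫ y, (k y • a n y - k y • f y) =
      ∫ y in Metric.closedBall (0 : Space d) φ.rOut, k y • (a n - f) y := by
    rw [setIntegral_eq_integral_of_forall_compl_eq_zero]
    · refine integral_congr_ae (Filter.Eventually.of_forall fun y => ?_)
      simp [smul_sub]
    · intro y hy
      simp [hk0 y hy]
  change ‖∫ y, (k y • a n y - k y • f y)‖ₑ ≤ _
  rw [e]
  refine (enorm_integral_le_lintegral_enorm _).trans ?_
  rw [← eLpNorm_one_eq_lintegral_enorm]
  refine (eLpNorm_smul_le_mul_eLpNorm (p := 2) (q := 2) (r := 1) (φ := k) (f := a n - f)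
    ((ha n).aestronglyMeasurable.sub hf.aestronglyMeasurable).restrict
    hk.aestronglyMeasurable.restrict).trans ?_
  gcongr
  exact Measure.restrict_le_self

/-- The real inner product associated with `sobEnergy`. -/
noncomputable def sobInner (m : ℝ) (f g : Space d → ℂ) : ℝ :=
  ∑ j, (∫ x, conj (weakPartial j g x) * weakPartial j f x).re +
    m * (∫ x, conj (g x) * f x).re

theorem integral_norm_add_smul_sq {f g : Space d → ℂ} (hf : MemLp f 2) (hg : MemLp g 2) (s : ℝ) :
    ∫ x, ‖f x + s • g x‖ ^ 2 = (∫ x, ‖f x‖ ^ 2) + 2 * s * (∫ x, conj (g x) * f x).re +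
      s ^ 2 * ∫ x, ‖g x‖ ^ 2 := by
  have h := integral_norm_sub_sq hf (hg.const_smul (-s))
  have e1 : ∫ x, conj ((-s • g) x) * f x = ((-s : ℝ) : ℂ) * ∫ x, conj (g x) * f x := by
    rw [← integral_const_mul]
    refine integral_congr_ae (Filter.Eventually.of_forall fun x => ?_)
    simp only [Pi.smul_apply, Complex.real_smul, map_mul, Complex.conj_ofReal]
    ring
  have e2 : ∫ x, ‖(-s • g) x‖ ^ 2 = s ^ 2 * ∫ x, ‖g x‖ ^ 2 := by
    rw [← integral_const_mul]
    refine integral_congr_ae (Filter.Eventually.of_forall fun x => ?_)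
    simp [mul_pow]
  rw [e1, e2, Complex.re_ofReal_mul] at h
  have e3 : ∫ x, ‖f x + s • g x‖ ^ 2 = ∫ x, ‖f x - (-s • g) x‖ ^ 2 := by simp
  rw [e3, h]
  ring

theorem sobEnergy_add_smul {m : ℝ} {P : ENNReal} (h : MassExponent d m P) {f g : Space d → ℂ}
    (hf : MemLp f P) (hf' : HasL2Grad f) (hg : MemLp g P) (hg' : HasL2Grad g) (s : ℝ) :
    sobEnergy m (f + s • g) =
      sobEnergy m f + 2 * s * sobInner m f g + s ^ 2 * sobEnergy m g := by
  have h1 : gradSq (f + s • g) = gradSq f +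
      2 * s * ∑ j, (∫ x, conj (weakPartial j g x) * weakPartial j f x).re + s ^ 2 * gradSq g := by
    unfold gradSq
    rw [Finset.mul_sum, Finset.mul_sum, ← Finset.sum_add_distrib, ← Finset.sum_add_distrib]
    refine Finset.sum_congr rfl fun j _ => ?_
    rw [← integral_norm_add_smul_sq (hf'.memLp j) (hg'.memLp j)]
    refine integral_congr_ae ?_
    filter_upwards [((hf'.hasWeakPartial j).add ((hg'.hasWeakPartial j).const_smul s)).weakPartial]
      with x hx
    rw [hx]
    rfl
  have h2 : m * massSq (f + s • g) = m * massSq f +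
      2 * s * (m * (∫ x, conj (g x) * f x).re) + s ^ 2 * (m * massSq g) := by
    rcases h with ⟨-, rfl⟩ | ⟨rfl, -⟩
    · have := integral_norm_add_smul_sq hf hg s
      unfold massSq
      simp only [Pi.add_apply, Pi.smul_apply]
      rw [this]
      ring
    · simp
  unfold sobEnergy sobInner
  rw [h1, h2]
  ring

theorem sobEnergy_eq_zero_iff_ae {m : ℝ} {P : ENNReal} (h : MassExponent d m P) {f : Space d → ℂ}
    (hf : MemLp f P) (hf' : HasL2Grad f) (h0 : sobEnergy m f = 0) : f =ᵐ[volume] 0 := by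
  obtain ⟨C, hC⟩ := h.embeds_self
  have := hC f hf hf'
  rw [h0] at this
  simp only [Real.sqrt_zero, ENNReal.ofReal_zero, mul_zero, nonpos_iff_eq_zero] at this
  exact (eLpNorm_eq_zero_iff hf.1 ((by norm_num : (0 : ENNReal) < 2).trans_le h.two_le).ne').1 this

end

/-! ### The maximization problem for the interaction -/

section

variable {d : ℕ}

/-- The parameters of the variational problem: the coefficient `κ`, the two modulations `b₁, b₂`,
the masses `m₁, m₂`, the Sobolev exponents `P₁, P₂` of the two components and exponents `p₁, p₂`
for which both Sobolev spaces embed and which control the interaction. At least one of the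
components is massive, with a subcritical exponent. -/
structure PairSetting (κ : ℝ) (b₁ b₂ : Space d) (m₁ m₂ : ℝ) (P₁ P₂ : ENNReal) (p₁ p₂ : ℝ) :
    Prop where
  kappa_pos : 0 < κ
  mass₁ : MassExponent d m₁ P₁
  mass₂ : MassExponent d m₂ P₂
  embeds₁ : SobolevEmbeds d m₁ P₁ (ENNReal.ofReal p₁)
  embeds₂ : SobolevEmbeds d m₂ P₂ (ENNReal.ofReal p₂)
  exponents : InteractionExponents p₁ p₂
  subcritical : (0 < m₁ ∧ P₁ = 2 ∧ 2 < p₁ ∧ p₁ < topExponent d) ∨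
    (0 < m₂ ∧ P₂ = 2 ∧ 2 < p₂ ∧ p₂ < topExponent d)

/-- The pairs `(u, v)` whose modulations by `b₁` and `b₂` lie in the Sobolev spaces with exponents
`P₁` and `P₂`. -/
def pairSpace (b₁ b₂ : Space d) (P₁ P₂ : ENNReal) : Set (Pair d) :=
  {p | (MemLp p.1 P₁ ∧ HasL2Grad (modulate b₁ p.1)) ∧ (MemLp p.2 P₂ ∧ HasL2Grad (modulate b₂ p.2))}

/-- The quadratic form of the action, in terms of the modulated components. -/
noncomputable def pairEnergy (κ : ℝ) (b₁ b₂ : Space d) (m₁ m₂ : ℝ) (p : Pair d) : ℝ :=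
  1 / 2 * sobEnergy m₁ (modulate b₁ p.1) + κ / 2 * sobEnergy m₂ (modulate b₂ p.2)

variable {κ m₁ m₂ p₁ p₂ : ℝ} {b₁ b₂ : Space d} {P₁ P₂ : ENNReal}

theorem pairSpace_add_smul {p q : Pair d} (hp : p ∈ pairSpace b₁ b₂ P₁ P₂)
    (hq : q ∈ pairSpace b₁ b₂ P₁ P₂) (s : ℝ) : p + s • q ∈ pairSpace b₁ b₂ P₁ P₂ := by
  obtain ⟨⟨h1, h2⟩, h3, h4⟩ := hp
  obtain ⟨⟨k1, k2⟩, k3, k4⟩ := hq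
  refine ⟨⟨h1.add (k1.const_smul s), ?_⟩, h3.add (k3.const_smul s), ?_⟩
  · change HasL2Grad (modulate b₁ (p.1 + s • q.1))
    rw [modulate_add, modulate_smul]
    exact h2.add (k2.const_smul s)
  · change HasL2Grad (modulate b₂ (p.2 + s • q.2))
    rw [modulate_add, modulate_smul]
    exact h4.add (k4.const_smul s)

theorem pairSpace_sub {p q : Pair d} (hp : p ∈ pairSpace b₁ b₂ P₁ P₂)
    (hq : q ∈ pairSpace b₁ b₂ P₁ P₂) : p - q ∈ pairSpace b₁ b₂ P₁ P₂ := by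
  simpa [sub_eq_add_neg] using pairSpace_add_smul hp hq (-1)

theorem pairSpace_smul {p : Pair d} (hp : p ∈ pairSpace b₁ b₂ P₁ P₂) (s : ℝ) :
    s • p ∈ pairSpace b₁ b₂ P₁ P₂ := by
  have := pairSpace_add_smul hp hp (s - 1)
  rwa [show p + (s - 1) • p = s • p by rw [sub_smul, one_smul]; abel] at this

theorem interaction_smul (p : Pair d) (l : ℝ) : interaction (l • p) = l ^ 3 * interaction p := by
  unfold interaction
  rw [← Complex.re_ofReal_mul, ← integral_const_mul]
  congr 2
  ext x
  simp only [Prod.smul_fst, Prod.smul_snd, Pi.smul_apply, Complex.real_smul, map_mul,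
    Complex.conj_ofReal]
  push_cast
  ring

namespace PairSetting

theorem memLp_fst (S : PairSetting κ b₁ b₂ m₁ m₂ P₁ P₂ p₁ p₂) {p : Pair d}
    (hp : p ∈ pairSpace b₁ b₂ P₁ P₂) : MemLp p.1 (ENNReal.ofReal p₁) :=
  (memLp_modulate_iff b₁).1 (S.embeds₁.memLp ((memLp_modulate_iff b₁).2 hp.1.1) hp.1.2)

theorem memLp_snd (S : PairSetting κ b₁ b₂ m₁ m₂ P₁ P₂ p₁ p₂) {p : Pair d}
    (hp : p ∈ pairSpace b₁ b₂ P₁ P₂) : MemLp p.2 (ENNReal.ofReal p₂) :=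
  (memLp_modulate_iff b₂).1 (S.embeds₂.memLp ((memLp_modulate_iff b₂).2 hp.2.1) hp.2.2)

theorem pairEnergy_nonneg (S : PairSetting κ b₁ b₂ m₁ m₂ P₁ P₂ p₁ p₂) (p : Pair d) :
    0 ≤ pairEnergy κ b₁ b₂ m₁ m₂ p := by
  have h1 := sobEnergy_nonneg S.mass₁.nonneg (modulate b₁ p.1)
  have h2 := sobEnergy_nonneg S.mass₂.nonneg (modulate b₂ p.2)
  have := S.kappa_pos
  unfold pairEnergy
  positivity

theorem sobEnergy_fst_le (S : PairSetting κ b₁ b₂ m₁ m₂ P₁ P₂ p₁ p₂) (p : Pair d) :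
    sobEnergy m₁ (modulate b₁ p.1) ≤ 2 * pairEnergy κ b₁ b₂ m₁ m₂ p := by
  have h2 := sobEnergy_nonneg S.mass₂.nonneg (modulate b₂ p.2)
  have := mul_nonneg S.kappa_pos.le h2
  unfold pairEnergy
  linarith

theorem sobEnergy_snd_le (S : PairSetting κ b₁ b₂ m₁ m₂ P₁ P₂ p₁ p₂) (p : Pair d) :
    sobEnergy m₂ (modulate b₂ p.2) ≤ 2 / κ * pairEnergy κ b₁ b₂ m₁ m₂ p := by
  have h1 := sobEnergy_nonneg S.mass₁.nonneg (modulate b₁ p.1)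
  have hκ := S.kappa_pos
  unfold pairEnergy
  rw [div_mul_eq_mul_div, le_div_iff₀ hκ]
  linarith

theorem pairEnergy_add_smul (S : PairSetting κ b₁ b₂ m₁ m₂ P₁ P₂ p₁ p₂) {p q : Pair d}
    (hp : p ∈ pairSpace b₁ b₂ P₁ P₂) (hq : q ∈ pairSpace b₁ b₂ P₁ P₂) (s : ℝ) :
    pairEnergy κ b₁ b₂ m₁ m₂ (p + s • q) = pairEnergy κ b₁ b₂ m₁ m₂ p +
      s * (sobInner m₁ (modulate b₁ p.1) (modulate b₁ q.1) +
        κ * sobInner m₂ (modulate b₂ p.2) (modulate b₂ q.2)) +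
      s ^ 2 * pairEnergy κ b₁ b₂ m₁ m₂ q := by
  unfold pairEnergy
  simp only [Prod.fst_add, Prod.smul_fst, Prod.snd_add, Prod.smul_snd, modulate_add, modulate_smul]
  rw [sobEnergy_add_smul S.mass₁ ((memLp_modulate_iff b₁).2 hp.1.1) hp.1.2
      ((memLp_modulate_iff b₁).2 hq.1.1) hq.1.2,
    sobEnergy_add_smul S.mass₂ ((memLp_modulate_iff b₂).2 hp.2.1) hp.2.2
      ((memLp_modulate_iff b₂).2 hq.2.1) hq.2.2]
  ring

theorem isNull_of_pairEnergy_eq_zero (S : PairSetting κ b₁ b₂ m₁ m₂ P₁ P₂ p₁ p₂) {p : Pair d}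
    (hp : p ∈ pairSpace b₁ b₂ P₁ P₂) (h0 : pairEnergy κ b₁ b₂ m₁ m₂ p = 0) : IsNull p := by
  have h1 := sobEnergy_nonneg S.mass₁.nonneg (modulate b₁ p.1)
  have h2 := sobEnergy_nonneg S.mass₂.nonneg (modulate b₂ p.2)
  have h3 := S.sobEnergy_fst_le p
  have h4 := S.sobEnergy_snd_le p
  rw [h0, mul_zero] at h3 h4
  have key : ∀ (b : Space d) (f : Space d → ℂ), modulate b f =ᵐ[volume] 0 → f =ᵐ[volume] 0 := by
    intro b f hf
    filter_upwards [hf] with x hx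
    rw [Pi.zero_apply, ← norm_eq_zero] at hx ⊢
    rwa [norm_modulate] at hx
  exact ⟨key b₁ _ (sobEnergy_eq_zero_iff_ae S.mass₁ ((memLp_modulate_iff b₁).2 hp.1.1) hp.1.2
      (le_antisymm h3 h1)),
    key b₂ _ (sobEnergy_eq_zero_iff_ae S.mass₂ ((memLp_modulate_iff b₂).2 hp.2.1) hp.2.2
      (le_antisymm h4 h2))⟩

/-- The components are bounded in `L^{p₁}` and `L^{p₂}` in terms of the quadratic form. -/
theorem exists_norm_le (S : PairSetting κ b₁ b₂ m₁ m₂ P₁ P₂ p₁ p₂) : ∃ C : NNReal,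
    ∀ p ∈ pairSpace b₁ b₂ P₁ P₂,
      eLpNorm p.1 (ENNReal.ofReal p₁) volume ≤
        C * ENNReal.ofReal (√(pairEnergy κ b₁ b₂ m₁ m₂ p)) ∧
      eLpNorm p.2 (ENNReal.ofReal p₂) volume ≤
        C * ENNReal.ofReal (√(pairEnergy κ b₁ b₂ m₁ m₂ p)) := by
  obtain ⟨C₁, h1⟩ := S.embeds₁
  obtain ⟨C₂, h2⟩ := S.embeds₂
  have hκ := S.kappa_pos
  refine ⟨C₁ * (√2).toNNReal + C₂ * (√(2 / κ)).toNNReal, fun p hp => ⟨?_, ?_⟩⟩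
  · have := h1 _ ((memLp_modulate_iff b₁).2 hp.1.1) hp.1.2
    rw [eLpNorm_modulate] at this
    refine this.trans ?_
    push_cast
    rw [add_mul]
    refine le_trans ?_ le_self_add
    rw [mul_assoc]
    gcongr
    change _ ≤ ENNReal.ofReal √2 * _
    rw [← ENNReal.ofReal_mul (by positivity), ← Real.sqrt_mul (by norm_num)]
    exact ENNReal.ofReal_le_ofReal (Real.sqrt_le_sqrt (S.sobEnergy_fst_le p))
  · have := h2 _ ((memLp_modulate_iff b₂).2 hp.2.1) hp.2.2
    rw [eLpNorm_modulate] at this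
    refine this.trans ?_
    push_cast
    rw [add_mul]
    refine le_trans ?_ le_add_self
    rw [mul_assoc]
    gcongr
    change _ ≤ ENNReal.ofReal √(2 / κ) * _
    rw [← ENNReal.ofReal_mul (by positivity), ← Real.sqrt_mul (by positivity)]
    exact ENNReal.ofReal_le_ofReal (Real.sqrt_le_sqrt (S.sobEnergy_snd_le p))

theorem exists_abs_interaction_le (S : PairSetting κ b₁ b₂ m₁ m₂ P₁ P₂ p₁ p₂) : ∃ K : ℝ, 0 ≤ K ∧
    ∀ p ∈ pairSpace b₁ b₂ P₁ P₂, |interaction p| ≤ K * √(pairEnergy κ b₁ b₂ m₁ m₂ p) ^ 3 := by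
  obtain ⟨C, hC⟩ := S.exists_norm_le
  refine ⟨C ^ 3, by positivity, fun p hp => ?_⟩
  have h1 := S.exponents.abs_interaction_le (S.memLp_fst hp) (S.memLp_snd hp)
  obtain ⟨h2, h3⟩ := hC p hp
  set s := √(pairEnergy κ b₁ b₂ m₁ m₂ p)
  have hs : 0 ≤ s := Real.sqrt_nonneg _
  have h4 : ENNReal.ofReal |interaction p| ≤ ENNReal.ofReal (C ^ 3 * s ^ 3) := by
    refine h1.trans ((mul_le_mul' (mul_le_mul' h2 h2) h3).trans (le_of_eq ?_))
    rw [← ENNReal.ofReal_coe_nnreal, ← ENNReal.ofReal_mul (by positivity),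
      ← ENNReal.ofReal_mul (by positivity), ← ENNReal.ofReal_mul (by positivity)]
    congr 1
    ring
  exact (ENNReal.ofReal_le_ofReal_iff (by positivity)).1 h4

end PairSetting

theorem pairSpace_of_tilde {f g : Space d → ℂ} (hf : MemLp f P₁) (hf' : HasL2Grad f)
    (hg : MemLp g P₂) (hg' : HasL2Grad g) :
    ((modulate (-b₁) f, modulate (-b₂) g) : Pair d) ∈ pairSpace b₁ b₂ P₁ P₂ := by
  refine ⟨⟨(memLp_modulate_iff _).2 hf, ?_⟩, (memLp_modulate_iff _).2 hg, ?_⟩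
  · simpa only [modulate_modulate_neg] using hf'
  · simpa only [modulate_modulate_neg] using hg'

/-- The translate of a pair. -/
def translate (y : Space d) (p : Pair d) : Pair d := (fun x => p.1 (x + y), fun x => p.2 (x + y))

theorem translate_mem_pairSpace {p : Pair d} (hp : p ∈ pairSpace b₁ b₂ P₁ P₂) (y : Space d) :
    translate y p ∈ pairSpace b₁ b₂ P₁ P₂ := by
  refine ⟨⟨hp.1.1.comp_measurePreserving (measurePreserving_add_right volume y), ?_⟩,
    hp.2.1.comp_measurePreserving (measurePreserving_add_right volume y), ?_⟩
  · simp only [translate, modulate_comp_add_right]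
    exact (hp.1.2.comp_add_right y).const_mul _
  · simp only [translate, modulate_comp_add_right]
    exact (hp.2.2.comp_add_right y).const_mul _

theorem pairEnergy_translate {p : Pair d} (hp : p ∈ pairSpace b₁ b₂ P₁ P₂) (y : Space d) :
    pairEnergy κ b₁ b₂ m₁ m₂ (translate y p) = pairEnergy κ b₁ b₂ m₁ m₂ p := by
  unfold pairEnergy
  simp only [translate, modulate_comp_add_right]
  rw [sobEnergy_phase_translate hp.1.2 (norm_exp_neg_I_mul _),
    sobEnergy_phase_translate hp.2.2 (norm_exp_neg_I_mul _)]

theorem interaction_translate (p : Pair d) (y : Space d) :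
    interaction (translate y p) = interaction p := by
  unfold interaction
  congr 1
  exact integral_add_right_eq_self (fun x => p.1 x ^ 2 * conj (p.2 x)) y

/-- A bounded family in `H¹` which does not vanish in a subcritical space `L^q` can be translated
so that the value at the origin of a fixed mollification stays away from zero. -/
theorem exists_translation_of_le_eLpNorm {m : ℝ} (hm : 0 < m) {q : ℝ} (hq : 2 < q)
    (hq' : q < topExponent d) {B : ℝ} {δ : ENNReal} (hδ : 0 < δ) (hδ' : δ ≠ ⊤)
    {f : ℕ → Space d → ℂ} (hf : ∀ n, MemLp (f n) 2) (hf' : ∀ n, HasL2Grad (f n))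
    (hB : ∀ n, sobEnergy m (f n) ≤ B) (hlow : ∀ n, δ ≤ eLpNorm (f n) (ENNReal.ofReal q) volume) :
    ∃ φ : ContDiffBump (0 : Space d), ∃ s : ℝ, 0 < s ∧ ∃ y : ℕ → Space d,
      ∀ n, s ≤ ‖mollify φ (f n) (y n)‖ := by
  obtain ⟨φ, s, hs, h⟩ := exists_bump_eLpNorm_le (d := d) hm hq hq' B (ENNReal.half_pos hδ.ne')
  refine ⟨φ, s, hs, ?_⟩
  have : ∀ n, ∃ y, s ≤ ‖mollify φ (f n) y‖ := by
    intro n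
    by_contra! hc
    have h1 := h (f n) (hf n) (hf' n) (hB n) fun x => (hc x).le
    exact absurd ((hlow n).trans h1) (not_le.2 (ENNReal.half_lt_self hδ.ne' hδ'))
  choose y hy using this
  exact ⟨y, hy⟩

/-- If the mollifications at the origin stay away from zero, then a local limit is nonzero. -/
theorem not_ae_eq_zero_of_mollify {b : Space d} {P : ENNReal} (hP : 1 ≤ P)
    {u : ℕ → Space d → ℂ} {F : Space d → ℂ} (hu : ∀ n, MemLp (u n) P) (hF : MemLp F P)
    (hlim : TendstoL2Loc (fun n => modulate b (u n)) F) {φ : ContDiffBump (0 : Space d)} {s : ℝ}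
    (hs : 0 < s) (hlow : ∀ n, s ≤ ‖mollify φ (modulate b (u n)) 0‖) : ¬ F =ᵐ[volume] 0 := by
  intro h0
  have h1 := tendsto_mollify_zero_of_tendstoL2Loc hlim
    (fun n => locallyIntegrable_of_memLp hP ((memLp_modulate_iff b).2 (hu n)))
    (locallyIntegrable_of_memLp hP hF) φ
  have h2 : mollify φ F 0 = 0 := by
    rw [mollify_eq, ← integral_zero (Space d) ℂ]
    refine integral_congr_ae ?_
    filter_upwards [h0] with x hx
    simp [hx]
  rw [h2] at h1
  have h3 := ge_of_tendsto h1.norm (Filter.Eventually.of_forall hlow)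
  rw [norm_zero] at h3
  linarith

/-- Strict superadditivity of `t ↦ t^{3/2}`: the sum `t^{3/2} + (1-t)^{3/2}` reaches `1` only at the
endpoints. -/
theorem eq_one_of_one_le_split {t : ℝ} (h0 : 0 < t) (h1 : t ≤ 1)
    (h : 1 ≤ √t ^ 3 + √(1 - t) ^ 3) : t = 1 := by
  by_contra hne
  have hlt : t < 1 := lt_of_le_of_ne h1 hne
  have a1 : √t < 1 := by
    simpa using Real.sqrt_lt_sqrt h0.le hlt
  have a2 : √(1 - t) < 1 := by
    simpa using Real.sqrt_lt_sqrt (show (0 : ℝ) ≤ 1 - t by linarith) (show 1 - t < 1 by linarith)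
  have s1 : √t ^ 2 = t := Real.sq_sqrt h0.le
  have s2 : √(1 - t) ^ 2 = 1 - t := Real.sq_sqrt (by linarith)
  have e1 : √t ^ 3 = t * √t := by rw [pow_succ, s1]
  have e2 : √(1 - t) ^ 3 = (1 - t) * √(1 - t) := by rw [pow_succ, s2]
  rw [e1, e2] at h
  nlinarith

end

/-! ### Existence of a maximizer -/

section

variable {d : ℕ}
variable {κ m₁ m₂ p₁ p₂ : ℝ} {b₁ b₂ : Space d} {P₁ P₂ : ENNReal}

theorem mollify_modulate_translate (φ : ContDiffBump (0 : Space d)) (b : Space d)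
    (f : Space d → ℂ) (y : Space d) :
    ‖mollify φ (modulate b (fun x => f (x + y))) 0‖ = ‖mollify φ (modulate b f) y‖ := by
  rw [modulate_comp_add_right, mollify_phase_translate, norm_mul, norm_exp_neg_I_mul, one_mul]

theorem pairEnergy_smul (p : Pair d) (s : ℝ) :
    pairEnergy κ b₁ b₂ m₁ m₂ (s • p) = s ^ 2 * pairEnergy κ b₁ b₂ m₁ m₂ p := by
  have h : ∀ (m : ℝ) (f : Space d → ℂ), sobEnergy m (s • f) = s ^ 2 * sobEnergy m f := by
    intro m f
    have : massSq (s • f) = s ^ 2 * massSq f := by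
      simp [massSq, ← integral_const_mul, mul_pow]
    unfold sobEnergy
    rw [gradSq_smul, this]
    ring
  unfold pairEnergy
  rw [Prod.smul_fst, Prod.smul_snd, modulate_smul, modulate_smul, h, h]
  ring

namespace PairSetting

/-- A bounded sequence on which the interaction stays away from zero does not vanish: after
translations, the mollification of one of the components stays away from zero at the origin. -/
theorem exists_translation (S : PairSetting κ b₁ b₂ m₁ m₂ P₁ P₂ p₁ p₂) {w : ℕ → Pair d}
    (hw : ∀ n, w n ∈ pairSpace b₁ b₂ P₁ P₂) (hw1 : ∀ n, pairEnergy κ b₁ b₂ m₁ m₂ (w n) ≤ 1)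
    {η : ℝ} (hη : 0 < η) (hlow : ∀ n, η ≤ interaction (w n)) :
    ∃ φ : ContDiffBump (0 : Space d), ∃ s : ℝ, 0 < s ∧ ∃ y : ℕ → Space d,
      (∀ n, s ≤ ‖mollify φ (modulate b₁ (translate (y n) (w n)).1) 0‖) ∨
      (∀ n, s ≤ ‖mollify φ (modulate b₂ (translate (y n) (w n)).2) 0‖) := by
  obtain ⟨C, hC⟩ := S.exists_norm_le
  let D : ENNReal := (C : ENNReal) + 1
  have hD0 : D ≠ 0 := by simp [D]
  have hDt : D ≠ ⊤ := by simp [D]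
  have hsq : ∀ n, ENNReal.ofReal (√(pairEnergy κ b₁ b₂ m₁ m₂ (w n))) ≤ 1 := fun n => by
    rw [← ENNReal.ofReal_one]
    refine ENNReal.ofReal_le_ofReal ?_
    rw [← Real.sqrt_one]
    exact Real.sqrt_le_sqrt (hw1 n)
  have hCD : ∀ n, (C : ENNReal) * ENNReal.ofReal (√(pairEnergy κ b₁ b₂ m₁ m₂ (w n))) ≤ D := fun n =>
    (mul_le_of_le_one_right' (hsq n)).trans le_self_add
  have hu : ∀ n, eLpNorm (w n).1 (ENNReal.ofReal p₁) volume ≤ D := fun n =>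
    (hC _ (hw n)).1.trans (hCD n)
  have hv : ∀ n, eLpNorm (w n).2 (ENNReal.ofReal p₂) volume ≤ D := fun n =>
    (hC _ (hw n)).2.trans (hCD n)
  have hN : ∀ n, ENNReal.ofReal η ≤ eLpNorm (w n).1 (ENNReal.ofReal p₁) volume *
      eLpNorm (w n).1 (ENNReal.ofReal p₁) volume * eLpNorm (w n).2 (ENNReal.ofReal p₂) volume :=
    fun n => (ENNReal.ofReal_le_ofReal ((hlow n).trans (le_abs_self _))).trans
      (S.exponents.abs_interaction_le (S.memLp_fst (hw n)) (S.memLp_snd (hw n)))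
  let δ : ENNReal := ENNReal.ofReal η / (D * D)
  have hDD : D * D ≠ ⊤ := ENNReal.mul_ne_top hDt hDt
  have hδ : 0 < δ := ENNReal.div_pos (ENNReal.ofReal_pos.2 hη).ne' hDD
  have hδ' : δ ≠ ⊤ := ENNReal.div_ne_top ENNReal.ofReal_ne_top (mul_ne_zero hD0 hD0)
  rcases S.subcritical with ⟨hm, rfl, hp, hp'⟩ | ⟨hm, rfl, hp, hp'⟩
  · have hl : ∀ n, δ ≤ eLpNorm (modulate b₁ (w n).1) (ENNReal.ofReal p₁) volume := fun n => by
      rw [eLpNorm_modulate]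
      refine ENNReal.div_le_of_le_mul ((hN n).trans ?_)
      rw [mul_assoc]
      gcongr
      exacts [hu n, hv n]
    obtain ⟨φ, s, hs, y, hy⟩ := exists_translation_of_le_eLpNorm hm hp hp' hδ hδ'
      (fun n => (memLp_modulate_iff b₁).2 (hw n).1.1) (fun n => (hw n).1.2)
      (fun n => (S.sobEnergy_fst_le (w n)).trans (mul_le_mul_of_nonneg_left (hw1 n) (by norm_num)))
      hl
    refine ⟨φ, s, hs, y, Or.inl fun n => ?_⟩
    simpa only [translate, mollify_modulate_translate] using hy n
  · have hκ := S.kappa_pos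
    have hl : ∀ n, δ ≤ eLpNorm (modulate b₂ (w n).2) (ENNReal.ofReal p₂) volume := fun n => by
      rw [eLpNorm_modulate]
      refine ENNReal.div_le_of_le_mul ((hN n).trans ?_)
      rw [mul_comm]
      gcongr
      exacts [hu n, hu n]
    obtain ⟨φ, s, hs, y, hy⟩ := exists_translation_of_le_eLpNorm hm hp hp' hδ hδ'
      (fun n => (memLp_modulate_iff b₂).2 (hw n).2.1) (fun n => (hw n).2.2)
      (fun n => (S.sobEnergy_snd_le (w n)).trans
        (mul_le_mul_of_nonneg_left (hw1 n) (by positivity))) hl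
    refine ⟨φ, s, hs, y, Or.inr fun n => ?_⟩
    simpa only [translate, mollify_modulate_translate] using hy n

/-- Compactness: a bounded sequence has a subsequence with a local limit, along which both the
quadratic form and the interaction split. -/
theorem exists_subseq_split (S : PairSetting κ b₁ b₂ m₁ m₂ P₁ P₂ p₁ p₂) {w : ℕ → Pair d}
    (hw : ∀ n, w n ∈ pairSpace b₁ b₂ P₁ P₂) (hw1 : ∀ n, pairEnergy κ b₁ b₂ m₁ m₂ (w n) ≤ 1) :
    ∃ ψ : ℕ → ℕ, StrictMono ψ ∧ ∃ z ∈ pairSpace b₁ b₂ P₁ P₂,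
      TendstoL2Loc (fun n => modulate b₁ (w (ψ n)).1) (modulate b₁ z.1) ∧
      TendstoL2Loc (fun n => modulate b₂ (w (ψ n)).2) (modulate b₂ z.2) ∧
      Filter.Tendsto (fun n => pairEnergy κ b₁ b₂ m₁ m₂ (w (ψ n) - z) +
        pairEnergy κ b₁ b₂ m₁ m₂ z - pairEnergy κ b₁ b₂ m₁ m₂ (w (ψ n))) Filter.atTop (nhds 0) ∧
      Filter.Tendsto (fun n => interaction (w (ψ n)) - interaction (w (ψ n) - z) - interaction z)
        Filter.atTop (nhds 0) := by
  have hκ := S.kappa_pos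
  obtain ⟨φ, hφ, F, hF, hF', hFl, hFe⟩ := exists_subseq_sobolev S.mass₁
    (fun n => (memLp_modulate_iff b₁).2 (hw n).1.1) (fun n => (hw n).1.2)
    (fun n => (S.sobEnergy_fst_le (w n)).trans (mul_le_mul_of_nonneg_left (hw1 n) (by norm_num)))
  obtain ⟨χ, hχ, G, hG, hG', hGl, hGe⟩ := exists_subseq_sobolev S.mass₂
    (fun n => (memLp_modulate_iff b₂).2 (hw (φ n)).2.1) (fun n => (hw (φ n)).2.2)
    (fun n => (S.sobEnergy_snd_le (w (φ n))).trans
      (mul_le_mul_of_nonneg_left (hw1 (φ n)) (by positivity)))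
  have hz := pairSpace_of_tilde (b₁ := b₁) (b₂ := b₂) hF hF' hG hG'
  have hFl' := hFl.comp_subseq hχ
  refine ⟨fun n => φ (χ n), hφ.comp hχ, _, hz, ?_, ?_, ?_, ?_⟩
  · simpa only [modulate_modulate_neg] using hFl'
  · simpa only [modulate_modulate_neg] using hGl
  · have h1 := ((hFe.comp hχ.tendsto_atTop).const_mul (1 / 2)).add (hGe.const_mul (κ / 2))
    rw [mul_zero, mul_zero, add_zero] at h1
    refine h1.congr fun n => ?_
    unfold pairEnergy
    simp only [Function.comp_apply, Prod.fst_sub, Prod.snd_sub, modulate_sub, modulate_modulate_neg]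
    ring
  · obtain ⟨C, hC⟩ := S.exists_norm_le
    have hCD : ∀ n, (C : ENNReal) * ENNReal.ofReal (√(pairEnergy κ b₁ b₂ m₁ m₂ (w n))) ≤ C :=
      fun n => by
        refine mul_le_of_le_one_right' ?_
        rw [← ENNReal.ofReal_one]
        refine ENNReal.ofReal_le_ofReal ?_
        rw [← Real.sqrt_one]
        exact Real.sqrt_le_sqrt (hw1 n)
    refine S.exponents.tendsto_interaction_split (fun n => S.memLp_fst (hw _))
      (fun n => S.memLp_snd (hw _)) (S.memLp_fst hz) (S.memLp_snd hz) (K := C)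
      ENNReal.coe_ne_top (fun n => (hC _ (hw _)).1.trans (hCD _))
      (fun n => (hC _ (hw _)).2.trans (hCD _)) ?_ ?_
    · simpa only [modulate_neg_modulate] using tendstoL2Loc_modulate (-b₁) hFl'
    · simpa only [modulate_neg_modulate] using tendstoL2Loc_modulate (-b₂) hGl

/-- The interaction attains its maximum on the unit ball of the quadratic form. The maximizer
saturates the sharp inequality `N ≤ M L^{3/2}`. -/
theorem exists_maximizer (S : PairSetting κ b₁ b₂ m₁ m₂ P₁ P₂ p₁ p₂)
    (hpos : ∃ p ∈ pairSpace b₁ b₂ P₁ P₂, 0 < interaction p) :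
    ∃ M : ℝ, 0 < M ∧ (∀ p ∈ pairSpace b₁ b₂ P₁ P₂,
        interaction p ≤ M * √(pairEnergy κ b₁ b₂ m₁ m₂ p) ^ 3) ∧
      ∃ z ∈ pairSpace b₁ b₂ P₁ P₂, pairEnergy κ b₁ b₂ m₁ m₂ z = 1 ∧ interaction z = M := by
  obtain ⟨K, hK0, hK⟩ := S.exists_abs_interaction_le
  set X := pairSpace b₁ b₂ P₁ P₂ with hX
  set L : Pair d → ℝ := pairEnergy κ b₁ b₂ m₁ m₂ with hL
  have hLnn : ∀ p, 0 ≤ L p := S.pairEnergy_nonneg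
  let A : Set ℝ := interaction '' {p | p ∈ X ∧ L p ≤ 1}
  have hAb : BddAbove A := by
    refine ⟨K, ?_⟩
    rintro _ ⟨p, ⟨hp, hp1⟩, rfl⟩
    refine (le_abs_self _).trans ((hK p hp).trans (mul_le_of_le_one_right hK0 ?_))
    refine pow_le_one₀ (Real.sqrt_nonneg _) ?_
    rw [← Real.sqrt_one]
    exact Real.sqrt_le_sqrt hp1
  -- Rescaling to the unit sphere turns the bound by the supremum into the sharp inequality.
  have hsup : ∀ p ∈ X, interaction p ≤ sSup A * √(L p) ^ 3 := by
    intro p hp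
    rcases (hLnn p).eq_or_lt with h0 | h0
    · have := hK p hp
      rw [show L p = 0 from h0.symm] at this
      simp only [Real.sqrt_zero, ne_eq, OfNat.ofNat_ne_zero, not_false_eq_true, zero_pow,
        mul_zero] at this
      rw [← h0]
      simpa using (le_abs_self _).trans this
    · have hs : 0 < √(L p) := Real.sqrt_pos.2 h0
      have hs2 : √(L p) ^ 2 = L p := Real.sq_sqrt h0.le
      have hmem : interaction ((√(L p))⁻¹ • p) ∈ A := by
        refine ⟨_, ⟨pairSpace_smul hp _, ?_⟩, rfl⟩
        rw [hL, pairEnergy_smul, inv_pow, ← hL, hs2, inv_mul_cancel₀ h0.ne']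
      have := le_csSup hAb hmem
      rw [interaction_smul, inv_pow, inv_mul_le_iff₀ (by positivity)] at this
      linarith
  have hM : 0 < sSup A := by
    obtain ⟨p, hp, hp0⟩ := hpos
    by_contra hc
    have h1 := hsup p hp
    have h2 : 0 ≤ √(L p) ^ 3 := by positivity
    nlinarith
  have hAne : A.Nonempty := by
    rw [Set.nonempty_iff_ne_empty]
    intro h
    rw [h, Real.sSup_empty] at hM
    exact lt_irrefl _ hM
  obtain ⟨a, -, ha, haA⟩ := exists_seq_tendsto_sSup hAne hAb
  obtain ⟨N₀, hN₀⟩ := Filter.eventually_atTop.1 (ha.eventually_const_le (half_lt_self hM))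
  have : ∀ n, ∃ p ∈ X, L p ≤ 1 ∧ interaction p = a (n + N₀) := by
    intro n
    obtain ⟨p, ⟨hp, hp1⟩, hpa⟩ := haA (n + N₀)
    exact ⟨p, hp, hp1, hpa⟩
  choose w hwX hw1 hwa using this
  obtain ⟨φ, s, hs, y, hy⟩ := S.exists_translation hwX hw1 (half_pos hM) fun n => by
    rw [hwa]
    exact hN₀ (n + N₀) (Nat.le_add_left _ _)
  -- A maximizing sequence, translated so that it does not vanish in the limit.
  let v : ℕ → Pair d := fun n => translate (y n) (w n)
  have hvX : ∀ n, v n ∈ X := fun n => translate_mem_pairSpace (hwX n) _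
  have hvL : ∀ n, L (v n) ≤ 1 := fun n => by
    rw [show L (v n) = L (w n) from pairEnergy_translate (hwX n) _]
    exact hw1 n
  have hvN : Filter.Tendsto (fun n => interaction (v n)) Filter.atTop (nhds (sSup A)) := by
    simp only [v, interaction_translate, hwa]
    exact ha.comp (Filter.tendsto_add_atTop_nat N₀)
  obtain ⟨ψ, hψ, z, hz, hz1, hz2, hzL, hzN⟩ := S.exists_subseq_split hvX hvL
  have h2P : ∀ {m : ℝ} {P : ENNReal}, MassExponent d m P → 1 ≤ P := fun h =>
    (by norm_num : (1 : ENNReal) ≤ 2).trans h.two_le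
  have hz0 : ¬ IsNull z := by
    rintro ⟨n1, n2⟩
    have hmod : ∀ (b : Space d) (f : Space d → ℂ), f =ᵐ[volume] 0 → modulate b f =ᵐ[volume] 0 := by
      intro b f hf
      filter_upwards [hf] with x hx
      simp [modulate, hx]
    rcases hy with hy | hy
    · exact not_ae_eq_zero_of_mollify (h2P S.mass₁) (fun n => (hvX (ψ n)).1.1)
        ((memLp_modulate_iff b₁).2 hz.1.1) hz1 hs (fun n => hy (ψ n)) (hmod _ _ n1)
    · exact not_ae_eq_zero_of_mollify (h2P S.mass₂) (fun n => (hvX (ψ n)).2.1)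
        ((memLp_modulate_iff b₂).2 hz.2.1) hz2 hs (fun n => hy (ψ n)) (hmod _ _ n2)
  have hLz : 0 < L z := (hLnn z).lt_of_ne' fun h => hz0 (S.isNull_of_pairEnergy_eq_zero hz h)
  -- The remainder `v - z` carries at most the quadratic form `1 - L z` and the rest of the
  -- interaction, so strict superadditivity leaves nothing for it.
  have hLsub : ∀ ε > 0, ∀ᶠ n in Filter.atTop, L (v (ψ n) - z) ≤ 1 - L z + ε := by
    intro ε hε
    filter_upwards [hzL.eventually_le_const hε] with n hn
    have := hvL (ψ n)
    simp only [hL] at hn this ⊢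
    linarith
  have hLz1 : L z ≤ 1 := by
    by_contra! hc
    obtain ⟨n, hn⟩ := (hLsub ((L z - 1) / 2) (by linarith)).exists
    have := hLnn (v (ψ n) - z)
    linarith
  have hNle : ∀ ε > 0, sSup A - interaction z ≤ sSup A * √(1 - L z + ε) ^ 3 := by
    intro ε hε
    have hlim : Filter.Tendsto (fun n => interaction (v (ψ n) - z)) Filter.atTop
        (nhds (sSup A - interaction z)) := by
      have := ((hvN.comp hψ.tendsto_atTop).sub hzN).sub_const (interaction z)
      rw [sub_zero] at this
      refine this.congr fun n => ?_
      simp only [Function.comp_apply]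
      ring
    refine le_of_tendsto hlim ?_
    filter_upwards [hLsub ε hε] with n hn
    refine (hsup _ (pairSpace_sub (hvX _) hz)).trans ?_
    gcongr
  have hNle0 : sSup A - interaction z ≤ sSup A * √(1 - L z) ^ 3 := by
    have hc : Filter.Tendsto (fun ε : ℝ => sSup A * √(1 - L z + ε) ^ 3) (nhdsWithin 0 (Set.Ioi 0))
        (nhds (sSup A * √(1 - L z + 0) ^ 3)) := by
      refine (Continuous.tendsto ?_ 0).mono_left nhdsWithin_le_nhds
      fun_prop
    rw [add_zero] at hc
    refine ge_of_tendsto hc ?_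
    filter_upwards [self_mem_nhdsWithin] with ε hε
    exact hNle ε hε
  have hNz := hsup z hz
  have ht : L z = 1 := by
    refine eq_one_of_one_le_split hLz hLz1 ?_
    have : sSup A * 1 ≤ sSup A * (√(L z) ^ 3 + √(1 - L z) ^ 3) := by linarith
    exact le_of_mul_le_mul_left this hM
  refine ⟨sSup A, hM, hsup, z, hz, ht, le_antisymm ?_ ?_⟩
  · simpa [ht] using hNz
  · rw [ht] at hNle0
    simp only [sub_self, Real.sqrt_zero, ne_eq, OfNat.ofNat_ne_zero, not_false_eq_true, zero_pow,
      mul_zero] at hNle0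
    linarith

end PairSetting

end

/-! ### Critical points and the Nehari manifold -/

section

variable {d : ℕ}
variable {κ ω m₁ m₂ p₁ p₂ : ℝ} {c b₁ b₂ : Space d} {P₁ P₂ : ENNReal}

/-- The derivative `Re ∫ (2 u h v̄ + u² k̄)` of the interaction at `p = (u, v)` in the direction
`q = (h, k)`. -/
noncomputable def interactionDeriv (p q : Pair d) : ℝ :=
  (∫ x, (2 * (p.1 x * q.1 x * conj (p.2 x)) + p.1 x * p.1 x * conj (q.2 x))).re

namespace PairSetting

theorem exists_interaction_add_smul (S : PairSetting κ b₁ b₂ m₁ m₂ P₁ P₂ p₁ p₂) {p q : Pair d}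
    (hp : p ∈ pairSpace b₁ b₂ P₁ P₂) (hq : q ∈ pairSpace b₁ b₂ P₁ P₂) :
    ∃ r : ℝ, ∀ s : ℝ, interaction (p + s • q) =
      interaction p + s * interactionDeriv p q + s ^ 2 * r + s ^ 3 * interaction q := by
  have hu := S.memLp_fst hp
  have hv := S.memLp_snd hp
  have hh := S.memLp_fst hq
  have hk := S.memLp_snd hq
  have i0 := S.exponents.integrable hu hu hv
  have i1 := ((S.exponents.integrable hu hh hv).const_mul 2).add (S.exponents.integrable hu hu hk)
  have i2 := (S.exponents.integrable hh hh hv).add ((S.exponents.integrable hu hh hk).const_mul 2)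
  have i3 := S.exponents.integrable hh hh hk
  refine ⟨(∫ x, (q.1 x * q.1 x * conj (p.2 x) + 2 * (p.1 x * q.1 x * conj (q.2 x)))).re,
    fun s => ?_⟩
  have key : ∫ x, (p + s • q).1 x ^ 2 * conj ((p + s • q).2 x) =
      (∫ x, p.1 x * p.1 x * conj (p.2 x)) +
      (s : ℂ) * (∫ x, (2 * (p.1 x * q.1 x * conj (p.2 x)) + p.1 x * p.1 x * conj (q.2 x))) +
      ((s ^ 2 : ℝ) : ℂ) *
        (∫ x, (q.1 x * q.1 x * conj (p.2 x) + 2 * (p.1 x * q.1 x * conj (q.2 x)))) +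
      ((s ^ 3 : ℝ) : ℂ) * ∫ x, q.1 x * q.1 x * conj (q.2 x) := by
    have j1 := i1.const_mul (s : ℂ)
    have j2 := i2.const_mul ((s ^ 2 : ℝ) : ℂ)
    have j3 := i3.const_mul ((s ^ 3 : ℝ) : ℂ)
    rw [← integral_const_mul, ← integral_const_mul, ← integral_const_mul]
    refine Eq.trans ?_ ((integral_add ((i0.add j1).add j2) j3).trans ?_)
    · refine integral_congr_ae (Filter.Eventually.of_forall fun x => ?_)
      simp only [Prod.fst_add, Prod.snd_add, Prod.smul_fst, Prod.smul_snd, Pi.add_apply,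
        Pi.smul_apply, Complex.real_smul, map_add, map_mul, Complex.conj_ofReal]
      push_cast
      ring
    · congr 1
      refine (integral_add (i0.add j1) j2).trans ?_
      congr 1
      exact integral_add i0 j1
  unfold interaction interactionDeriv
  rw [key]
  simp only [Complex.add_re, Complex.re_ofReal_mul, pow_two]

/-- The action along a line, to first order. -/
theorem hasDerivAt_action (S : PairSetting κ b₁ b₂ m₁ m₂ P₁ P₂ p₁ p₂) {p q : Pair d}
    (hQ : ∀ p : Pair d, quadraticPart κ ω c p = pairEnergy κ b₁ b₂ m₁ m₂ p)
    (hp : p ∈ pairSpace b₁ b₂ P₁ P₂) (hq : q ∈ pairSpace b₁ b₂ P₁ P₂) :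
    HasDerivAt (fun s : ℝ => action κ ω c (p + s • q))
      (sobInner m₁ (modulate b₁ p.1) (modulate b₁ q.1) +
        κ * sobInner m₂ (modulate b₂ p.2) (modulate b₂ q.2) - interactionDeriv p q) 0 := by
  obtain ⟨r, hr⟩ := S.exists_interaction_add_smul hp hq
  unfold action
  simp only [hQ, hr, S.pairEnergy_add_smul hp hq]
  set A := sobInner m₁ (modulate b₁ p.1) (modulate b₁ q.1) +
        κ * sobInner m₂ (modulate b₂ p.2) (modulate b₂ q.2)
  have h1 := hasDerivAt_id' (0 : ℝ)
  have h2 := hasDerivAt_pow 2 (0 : ℝ)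
  have h3 := hasDerivAt_pow 3 (0 : ℝ)
  have := (((h1.mul_const A).const_add (pairEnergy κ b₁ b₂ m₁ m₂ p)).add
      (h2.mul_const (pairEnergy κ b₁ b₂ m₁ m₂ q))).sub
    ((((h1.mul_const (interactionDeriv p q)).const_add (interaction p)).add (h2.mul_const r)).add
      (h3.mul_const (interaction q)))
  refine this.congr_deriv ?_
  simp

/-- On the equality set of the sharp inequality `N ≤ M L^{3/2}` the derivatives of both sides
agree, since their difference has a minimum there. -/
theorem derivs_eq_of_saturates (S : PairSetting κ b₁ b₂ m₁ m₂ P₁ P₂ p₁ p₂) {M : ℝ}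
    (hM : ∀ p ∈ pairSpace b₁ b₂ P₁ P₂,
      interaction p ≤ M * √(pairEnergy κ b₁ b₂ m₁ m₂ p) ^ 3) {p q : Pair d}
    (hp : p ∈ pairSpace b₁ b₂ P₁ P₂) (hq : q ∈ pairSpace b₁ b₂ P₁ P₂)
    (hL : 0 < pairEnergy κ b₁ b₂ m₁ m₂ p)
    (heq : interaction p = M * √(pairEnergy κ b₁ b₂ m₁ m₂ p) ^ 3) :
    3 / 2 * M * √(pairEnergy κ b₁ b₂ m₁ m₂ p) *
      (sobInner m₁ (modulate b₁ p.1) (modulate b₁ q.1) +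
        κ * sobInner m₂ (modulate b₂ p.2) (modulate b₂ q.2)) = interactionDeriv p q := by
  obtain ⟨r, hr⟩ := S.exists_interaction_add_smul hp hq
  have hLs := S.pairEnergy_add_smul hp hq
  set A := sobInner m₁ (modulate b₁ p.1) (modulate b₁ q.1) +
        κ * sobInner m₂ (modulate b₂ p.2) (modulate b₂ q.2)
  set E := pairEnergy κ b₁ b₂ m₁ m₂ p
  let h : ℝ → ℝ := fun s => M * √(E + s * A + s ^ 2 * pairEnergy κ b₁ b₂ m₁ m₂ q) ^ 3 -
    (interaction p + s * interactionDeriv p q + s ^ 2 * r + s ^ 3 * interaction q)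
  have h1 := hasDerivAt_id' (0 : ℝ)
  have h2 := hasDerivAt_pow 2 (0 : ℝ)
  have h3 := hasDerivAt_pow 3 (0 : ℝ)
  have d1 : HasDerivAt (fun s : ℝ => E + s * A + s ^ 2 * pairEnergy κ b₁ b₂ m₁ m₂ q) A 0 := by
    refine (((h1.mul_const A).const_add E).add
      (h2.mul_const (pairEnergy κ b₁ b₂ m₁ m₂ q))).congr_deriv ?_
    simp
  have d2 := ((d1.sqrt (by simpa using hL.ne')).pow 3).const_mul M
  have d3 := d2.sub ((((h1.mul_const (interactionDeriv p q)).const_add (interaction p)).add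
    (h2.mul_const r)).add (h3.mul_const (interaction q)))
  have hmin : IsLocalMin h 0 := by
    refine Filter.Eventually.of_forall fun s => ?_
    have h0 : h 0 = 0 := by simp [h, heq]
    rw [h0]
    have := hM _ (pairSpace_add_smul hp hq s)
    rw [hr, hLs] at this
    simp only [h]
    linarith
  have := hmin.hasDerivAt_eq_zero d3
  have hs : √E ≠ 0 := (Real.sqrt_pos.2 hL).ne'
  simp at this
  field_simp at this
  nlinarith

end PairSetting

/-- The variational characterization: ground states are the minimizers on the Nehari manifold, and
they exist. -/
theorem groundStates_eq_nehariMinimizers (S : PairSetting κ b₁ b₂ m₁ m₂ P₁ P₂ p₁ p₂)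
    (hX : spaceX κ ω c = pairSpace b₁ b₂ P₁ P₂)
    (hQ : ∀ p : Pair d, quadraticPart κ ω c p = pairEnergy κ b₁ b₂ m₁ m₂ p)
    (hpos : ∃ p ∈ pairSpace b₁ b₂ P₁ P₂, 0 < interaction p) :
    (groundStates κ ω c).Nonempty ∧ groundStates κ ω c = nehariMinimizers κ ω c := by
  obtain ⟨M, hM, hle, z, hz, hz1, hzM⟩ := S.exists_maximizer hpos
  set L : Pair d → ℝ := pairEnergy κ b₁ b₂ m₁ m₂ with hL
  have hact : ∀ p, action κ ω c p = L p - interaction p := fun p => by rw [action, hQ]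
  have hneh : ∀ p, nehari κ ω c p = 2 * L p - 3 * interaction p := fun p => by rw [nehari_eq, hQ]
  have hpos' : ∀ p ∈ pairSpace b₁ b₂ P₁ P₂, ¬ IsNull p → 0 < L p := fun p hp h0 =>
    (S.pairEnergy_nonneg p).lt_of_ne' fun h => h0 (S.isNull_of_pairEnergy_eq_zero hp h)
  have hnull : ∀ p : Pair d, 0 < interaction p → ¬ IsNull p := by
    rintro p hp ⟨h1, -⟩
    have : interaction p = 0 := by
      have : ∫ x, p.1 x ^ 2 * conj (p.2 x) = 0 := by
        rw [← integral_zero (Space d) ℂ]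
        refine integral_congr_ae ?_
        filter_upwards [h1] with x hx
        simp [hx]
      rw [interaction, this, Complex.zero_re]
    exact hp.ne' this
  set l : ℝ := 2 / (3 * M) with hl
  have hl0 : 0 < l := by positivity
  have hlM : 3 / 2 * M * l = 1 := by rw [hl]; field_simp
  -- On the Nehari manifold the action is `L / 3`, and `L ≥ l²`.
  have hlow : ∀ p ∈ nehariManifold κ ω c, 0 < L p ∧ interaction p = 2 / 3 * L p ∧ l ≤ √(L p) := by
    rintro p ⟨hp, h0, hn⟩
    rw [hX] at hp
    rw [hneh] at hn
    have hp0 := hpos' p hp h0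
    have hs : 0 < √(L p) := Real.sqrt_pos.2 hp0
    have hs2 : √(L p) ^ 2 = L p := Real.sq_sqrt hp0.le
    have h1 := hle p hp
    refine ⟨hp0, by linarith, ?_⟩
    have h2 : 2 / 3 * √(L p) ^ 2 ≤ M * √(L p) * √(L p) ^ 2 := by
      calc 2 / 3 * √(L p) ^ 2 = interaction p := by rw [hs2]; linarith
        _ ≤ _ := h1
        _ = _ := by ring
    have h3 := le_of_mul_le_mul_right h2 (by positivity)
    rw [hl, div_le_iff₀ (by positivity)]
    linarith
  have hactN : ∀ p ∈ nehariManifold κ ω c, action κ ω c p = 1 / 3 * L p := fun p hp => by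
    rw [hact, (hlow p hp).2.1]
    ring
  have hactle : ∀ p ∈ nehariManifold κ ω c, 1 / 3 * l ^ 2 ≤ action κ ω c p := fun p hp => by
    obtain ⟨h0, -, h1⟩ := hlow p hp
    rw [hactN p hp]
    have := pow_le_pow_left₀ hl0.le h1 2
    rw [Real.sq_sqrt h0.le] at this
    linarith
  have hw : l • z ∈ nehariManifold κ ω c ∧ action κ ω c (l • z) = 1 / 3 * l ^ 2 := by
    have e1 : L (l • z) = l ^ 2 := by rw [hL, pairEnergy_smul, ← hL, hz1, mul_one]
    have e2 : interaction (l • z) = 2 / 3 * l ^ 2 := by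
      rw [interaction_smul, hzM]
      linear_combination 2 / 3 * l ^ 2 * hlM
    have e3 : l • z ∈ nehariManifold κ ω c := by
      refine ⟨hX ▸ pairSpace_smul hz l, hnull _ ?_, ?_⟩
      · rw [e2]; positivity
      · rw [hneh, e1, e2]; ring
    exact ⟨e3, by rw [hactN _ e3, e1]⟩
  have hmin : ∀ p, p ∈ nehariMinimizers κ ω c ↔
      p ∈ nehariManifold κ ω c ∧ action κ ω c p ≤ 1 / 3 * l ^ 2 := by
    intro p
    refine ⟨fun ⟨hp, hg⟩ => ⟨hp, ?_⟩, fun ⟨hp, hg⟩ => ⟨hp, ?_, ?_⟩⟩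
    · rw [← hw.2]
      exact hg.1 ⟨_, hw.1, rfl⟩
    · rintro _ ⟨q, hq, rfl⟩
      exact hg.trans (hactle q hq)
    · intro x hx
      exact hx ⟨p, hp, rfl⟩
  have hcritN : criticalPoints κ ω c ⊆ nehariManifold κ ω c := by
    rintro p ⟨hp, h0, hd⟩
    refine ⟨hp, h0, ?_⟩
    have h1 := hd p hp
    have h2 : HasDerivAt (fun s : ℝ => action κ ω c (p + s • p))
        (2 * quadraticPart κ ω c p - 3 * interaction p) 0 := by
      have e : (fun s : ℝ => action κ ω c (p + s • p)) = fun s : ℝ =>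
          (1 + s) ^ 2 * quadraticPart κ ω c p - (1 + s) ^ 3 * interaction p := by
        ext s
        rw [← action_smul, add_smul, one_smul]
      rw [e]
      have h1 := (hasDerivAt_id' (0 : ℝ)).const_add 1
      refine (((h1.pow 2).mul_const (quadraticPart κ ω c p)).sub
        ((h1.pow 3).mul_const (interaction p))).congr_deriv ?_
      norm_num
    rw [nehari_eq]
    exact h2.unique h1
  have hminC : nehariMinimizers κ ω c ⊆ criticalPoints κ ω c := by
    intro p hp
    obtain ⟨hpN, hpl⟩ := (hmin p).1 hp
    have hpX : p ∈ pairSpace b₁ b₂ P₁ P₂ := hX ▸ hpN.1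
    obtain ⟨hp0, hpi, hps⟩ := hlow p hpN
    refine ⟨hpN.1, hpN.2.1, fun q hq => ?_⟩
    rw [hX] at hq
    rw [hactN p hpN] at hpl
    have hs : √(L p) = l := by
      refine le_antisymm ?_ hps
      rw [Real.sqrt_le_left hl0.le]
      linarith
    have hs2 : L p = l ^ 2 := by rw [← hs, Real.sq_sqrt hp0.le]
    refine (S.hasDerivAt_action hQ hpX hq).congr_deriv ?_
    rw [← S.derivs_eq_of_saturates hle hpX hq hp0 ?_]
    · rw [show pairEnergy κ b₁ b₂ m₁ m₂ p = L p from rfl, hs, hlM]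
      ring
    · rw [show pairEnergy κ b₁ b₂ m₁ m₂ p = L p from rfl, hs, hpi, hs2]
      linear_combination -2 / 3 * l ^ 2 * hlM
  have hwm : l • z ∈ nehariMinimizers κ ω c := (hmin _).2 ⟨hw.1, hw.2.le⟩
  have hEq : groundStates κ ω c = nehariMinimizers κ ω c := by
    ext p
    refine ⟨fun ⟨hp, hg⟩ => (hmin p).2 ⟨hcritN hp, ?_⟩, fun hp => ⟨hminC hp, fun q hq => ?_⟩⟩
    · rw [← hw.2]
      exact hg _ (hminC hwm)
    · exact ((hmin p).1 hp).2.trans (hactle q (hcritN hq))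
  exact ⟨hEq ▸ ⟨_, hwm⟩, hEq⟩

end

/-! ### The three mass regimes -/

section

variable {d : ℕ}
variable {κ ω m₁ m₂ p₁ p₂ : ℝ} {c b₁ b₂ : Space d} {P₁ P₂ : ENNReal}

theorem contDiff_modulate (b : Space d) {η : Space d → ℂ} (h : ContDiff ℝ (⊤ : ℕ∞) η) :
    ContDiff ℝ (⊤ : ℕ∞) (modulate b η) := by
  refine ContDiff.mul ?_ h
  refine Complex.contDiff_exp.comp (contDiff_const.mul (Complex.ofRealCLM.contDiff.comp ?_))
  exact (innerSL ℝ b).contDiff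

theorem hasL2Grad_of_contDiff {η : Space d → ℂ} (h : ContDiff ℝ (⊤ : ℕ∞) η)
    (h' : HasCompactSupport η) : HasL2Grad η := fun j =>
  ⟨_, hasWeakPartial_of_contDiff h j,
    memLp_of_continuous_hasCompactSupport (continuous_fderiv_single h j)
      (hasCompactSupport_fderiv_single h' j) _⟩

theorem mem_pairSpace_of_contDiff {η θ : Space d → ℂ} (h : ContDiff ℝ (⊤ : ℕ∞) η)
    (h' : HasCompactSupport η) (k : ContDiff ℝ (⊤ : ℕ∞) θ) (k' : HasCompactSupport θ) :
    ((η, θ) : Pair d) ∈ pairSpace b₁ b₂ P₁ P₂ :=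
  ⟨⟨memLp_of_continuous_hasCompactSupport h.continuous h' _,
      hasL2Grad_of_contDiff (contDiff_modulate _ h) h'.mul_left⟩,
    memLp_of_continuous_hasCompactSupport k.continuous k' _,
      hasL2Grad_of_contDiff (contDiff_modulate _ k) k'.mul_left⟩

/-- A pair of equal nonnegative bump functions has positive interaction. -/
theorem exists_interaction_pos :
    ∃ p ∈ pairSpace b₁ b₂ P₁ P₂, 0 < interaction (p : Pair d) := by
  let φ : ContDiffBump (0 : Space d) := ⟨1, 2, one_pos, one_lt_two⟩
  let η : Space d → ℂ := fun x => (φ x : ℂ)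
  have h : ContDiff ℝ (⊤ : ℕ∞) η := Complex.ofRealCLM.contDiff.comp φ.contDiff
  have h' : HasCompactSupport η := φ.hasCompactSupport.comp_left (g := fun t : ℝ => (t : ℂ)) rfl
  refine ⟨(η, η), mem_pairSpace_of_contDiff h h' h h', ?_⟩
  have e : ∫ x, η x ^ 2 * conj (η x) = ((∫ x, φ x ^ 3 : ℝ) : ℂ) := by
    rw [← integral_complex_ofReal]
    refine integral_congr_ae (Filter.Eventually.of_forall fun x => ?_)
    simp only [η, Complex.conj_ofReal]
    push_cast
    ring
  simp only [interaction]
  rw [e, Complex.ofReal_re]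
  refine Continuous.integral_pos_of_hasCompactSupport_nonneg_nonzero (x := 0)
    (φ.continuous.pow 3) ?_ (fun x => pow_nonneg φ.nonneg 3) ?_
  · exact φ.hasCompactSupport.comp_left (g := fun t : ℝ => t ^ 3) (by norm_num)
  · have : φ 0 = 1 := φ.one_of_mem_closedBall (by simp [φ])
    simp [this]

theorem quadraticPart_eq_pairEnergy (hκ : 0 < κ) (ω : ℝ) (c : Space d) (p : Pair d) :
    quadraticPart κ ω c p = pairEnergy κ (-(1 / 2 : ℝ) • c) (-(1 / (2 * κ)) • c)
      (ω - ‖c‖ ^ 2 / 4) (2 / κ * (ω - ‖c‖ ^ 2 / (8 * κ))) p := by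
  unfold quadraticPart pairEnergy sobEnergy
  rw [massSq_modulate, massSq_modulate]
  field_simp
  ring

/-- The exponent of `u` which is complementary to the exponent `r` of `v`. -/
theorem interactionExponents_conjugate {r : ℝ} (hr : 2 < r) :
    InteractionExponents (2 * r / (r - 1)) r := by
  have : 0 < r - 1 := by linarith
  refine ⟨?_, hr.le, ?_⟩
  · rw [le_div_iff₀ this]; linarith
  · field_simp
    ring

/-- The restriction `d ≤ 5` enters here: the top exponent is at least `10/3`, so the exponent
`2r/(r-1)` complementary to it is subcritical. -/
theorem three_lt_topExponent (h : d ≤ 5) : 3 < topExponent d := by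
  unfold topExponent
  split_ifs with h3
  · norm_num
  · have : d = 4 ∨ d = 5 := by omega
    rcases this with rfl | rfl <;> norm_num

theorem conjugate_lt_of_three_lt {r : ℝ} (hr : 3 < r) :
    2 < 2 * r / (r - 1) ∧ 2 * r / (r - 1) < r := by
  have : 0 < r - 1 := by linarith
  constructor
  · rw [lt_div_iff₀ this]; linarith
  · rw [div_lt_iff₀ this]; nlinarith

theorem topExponent_eq (h : 3 ≤ d) : topExponent d = 2 * (d : ℝ) / ((d : ℝ) - 2) := by
  unfold topExponent
  split_ifs with h3
  · obtain rfl : d = 3 := le_antisymm h3 h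
    norm_num
  · rfl

theorem spaceX_eq_pairSpace {P₁ P₂ : ENNReal}
    (h : ∀ f g : Space d → ℂ, (f, g) ∈ tildeX κ ω c ↔
      (MemLp f P₁ ∧ HasL2Grad f) ∧ MemLp g P₂ ∧ HasL2Grad g) :
    spaceX κ ω c = pairSpace (-(1 / 2 : ℝ) • c) (-(1 / (2 * κ)) • c) P₁ P₂ := by
  ext p
  unfold spaceX pairSpace
  simp only [Set.mem_ofPred_eq, h, memLp_modulate_iff]

theorem not_caseA_of_caseB (h : CaseB κ ω c) : ¬ CaseA κ ω c := fun h' => by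
  have := (le_max_right (‖c‖ ^ 2 / 4) (‖c‖ ^ 2 / (8 * κ))).trans_lt h'.2
  exact this.ne h.2.2.1.symm

theorem not_caseA_of_caseC (h : CaseC κ ω c) : ¬ CaseA κ ω c := fun h' => by
  have := (le_max_left (‖c‖ ^ 2 / 4) (‖c‖ ^ 2 / (8 * κ))).trans_lt h'.2
  exact this.ne h.2.1.symm

theorem not_caseC_of_caseB (h : CaseB κ ω c) : ¬ CaseC κ ω c := fun h' =>
  lt_asymm h.2.1 h'.1

/-- In each of the three regimes `X_{ω,c}` and the action are an instance of the abstract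
variational problem. -/
theorem exists_pairSetting
    (h : (1 ≤ d ∧ d ≤ 5 ∧ CaseA κ ω c) ∨ (3 ≤ d ∧ d ≤ 5 ∧ CaseB κ ω c) ∨
      (d = 5 ∧ CaseC κ ω c)) :
    0 < κ ∧ ∃ P₁ P₂ p₁ p₂, PairSetting κ (-(1 / 2 : ℝ) • c) (-(1 / (2 * κ)) • c)
        (ω - ‖c‖ ^ 2 / 4) (2 / κ * (ω - ‖c‖ ^ 2 / (8 * κ))) P₁ P₂ p₁ p₂ ∧
      spaceX κ ω c = pairSpace (-(1 / 2 : ℝ) • c) (-(1 / (2 * κ)) • c) P₁ P₂ := by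
  rcases h with ⟨h1, h5, hc⟩ | ⟨h3, h5, hc⟩ | ⟨rfl, hc⟩
  · have hκ := hc.1
    have hm₁ : 0 < ω - ‖c‖ ^ 2 / 4 := sub_pos.2 ((le_max_left _ _).trans_lt hc.2)
    have hm₂ : 0 < 2 / κ * (ω - ‖c‖ ^ 2 / (8 * κ)) :=
      mul_pos (by positivity) (sub_pos.2 ((le_max_right _ _).trans_lt hc.2))
    have hr := three_lt_topExponent h5
    obtain ⟨k1, k2⟩ := conjugate_lt_of_three_lt hr
    refine ⟨hκ, 2, 2, 2 * topExponent d / (topExponent d - 1), topExponent d, ⟨hκ,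
      Or.inl ⟨hm₁, rfl⟩, Or.inl ⟨hm₂, rfl⟩, sobolevEmbeds_of_lt_topExponent hm₁ k1.le k2,
      sobolevEmbeds_topExponent hm₂, interactionExponents_conjugate (by linarith),
      Or.inl ⟨hm₁, rfl, k1, k2⟩⟩, spaceX_eq_pairSpace fun f g => ⟨?_, fun k => Or.inl ⟨hc, k⟩⟩⟩
    rintro (⟨-, k⟩ | ⟨hB, -⟩ | ⟨hC, -⟩)
    · exact k
    · exact absurd hc (not_caseA_of_caseB hB)
    · exact absurd hc (not_caseA_of_caseC hC)
  · have hκ := hc.1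
    have hm₂ : 2 / κ * (ω - ‖c‖ ^ 2 / (8 * κ)) = 0 := by rw [hc.2.2.1, sub_self, mul_zero]
    have hm₁ : 0 < ω - ‖c‖ ^ 2 / 4 := by
      have hc0 : 0 < ‖c‖ ^ 2 := by have := norm_pos_iff.2 hc.2.2.2; positivity
      rw [hc.2.2.1, sub_pos]
      exact div_lt_div_of_pos_left hc0 (by positivity) (by linarith [hc.2.1])
    have hr := three_lt_topExponent h5
    obtain ⟨k1, k2⟩ := conjugate_lt_of_three_lt hr
    have hM : MassExponent d (2 / κ * (ω - ‖c‖ ^ 2 / (8 * κ)))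
        (ENNReal.ofReal (2 * (d : ℝ) / ((d : ℝ) - 2))) := Or.inr ⟨hm₂, h3, rfl⟩
    have hE := hM.embeds_self
    rw [← topExponent_eq h3] at hE hM
    refine ⟨hκ, 2, ENNReal.ofReal (topExponent d), 2 * topExponent d / (topExponent d - 1),
      topExponent d, ⟨hκ,
      Or.inl ⟨hm₁, rfl⟩, hM, sobolevEmbeds_of_lt_topExponent hm₁ k1.le k2,
      hE, interactionExponents_conjugate (by linarith),
      Or.inl ⟨hm₁, rfl, k1, k2⟩⟩, spaceX_eq_pairSpace fun f g => ?_⟩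
    rw [topExponent_eq h3]
    refine ⟨?_, fun k => Or.inr (Or.inl ⟨hc, k⟩)⟩
    rintro (⟨hA, -⟩ | ⟨-, k⟩ | ⟨hC, -⟩)
    · exact absurd hA (not_caseA_of_caseB hc)
    · exact k
    · exact absurd hC (not_caseC_of_caseB hc)
  · have hκ : 0 < κ := by linarith [hc.1]
    have hm₁ : ω - ‖c‖ ^ 2 / 4 = 0 := by rw [hc.2.1, sub_self]
    have hm₂ : 0 < 2 / κ * (ω - ‖c‖ ^ 2 / (8 * κ)) := by
      have hc0 : 0 < ‖c‖ ^ 2 := by have := norm_pos_iff.2 hc.2.2; positivity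
      refine mul_pos (by positivity) ?_
      rw [hc.2.1, sub_pos]
      exact div_lt_div_of_pos_left hc0 (by positivity) (by linarith [hc.1])
    have hM : MassExponent 5 (ω - ‖c‖ ^ 2 / 4)
        (ENNReal.ofReal (2 * ((5 : ℕ) : ℝ) / (((5 : ℕ) : ℝ) - 2))) :=
      Or.inr ⟨hm₁, by norm_num, rfl⟩
    have ht : topExponent 5 = 10 / 3 := by rw [topExponent_eq (by norm_num)]; norm_num
    refine ⟨hκ, _, 2, 2 * ((5 : ℕ) : ℝ) / (((5 : ℕ) : ℝ) - 2), 5 / 2, ⟨hκ, hM,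
      Or.inl ⟨hm₂, rfl⟩, hM.embeds_self,
      sobolevEmbeds_of_lt_topExponent hm₂ (by norm_num) (by rw [ht]; norm_num),
      ⟨by norm_num, by norm_num, by norm_num⟩,
      Or.inr ⟨hm₂, rfl, by norm_num, by rw [ht]; norm_num⟩⟩, spaceX_eq_pairSpace fun f g =>
      ⟨?_, fun k => Or.inr (Or.inr ⟨hc, k⟩)⟩⟩
    rintro (⟨hA, -⟩ | ⟨hB, -⟩ | ⟨-, k⟩)
    · exact absurd hA (not_caseA_of_caseC hc)
    · exact absurd hc (not_caseC_of_caseB hB)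
    · exact k

end

/-! ### The weak form of the stationary system -/

section

variable {d : ℕ}
variable {κ ω m₁ m₂ p₁ p₂ : ℝ} {c b₁ b₂ : Space d} {P₁ P₂ : ENNReal}

/-- The second partial derivative `∂_j ∂_j θ`. -/
noncomputable def secondPartial (j : Fin d) (θ : Space d → ℂ) (x : Space d) : ℂ :=
  fderiv ℝ (fun y => fderiv ℝ θ y (EuclideanSpace.single j 1)) x (EuclideanSpace.single j 1)

theorem integrable_mul_test {f k : Space d → ℂ} (hf : LocallyIntegrable f) (hk : Continuous k)
    (hk' : HasCompactSupport k) : Integrable (fun x => k x * f x) :=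
  hf.integrable_smul_left_of_hasCompactSupport hk hk'

theorem contDiff_conj {θ : Space d → ℂ} (h : ContDiff ℝ (⊤ : ℕ∞) θ) :
    ContDiff ℝ (⊤ : ℕ∞) (fun x => conj (θ x)) :=
  Complex.conjCLE.contDiff.comp h

theorem hasCompactSupport_conj {θ : Space d → ℂ} (h : HasCompactSupport θ) :
    HasCompactSupport (fun x => conj (θ x)) :=
  h.comp_left (g := fun z : ℂ => conj z) (map_zero _)

theorem fderiv_conj_apply {θ : Space d → ℂ} (h : ContDiff ℝ (⊤ : ℕ∞) θ) (x v : Space d) :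
    fderiv ℝ (fun x => conj (θ x)) x v = conj (fderiv ℝ θ x v) := by
  have h1 := (h.differentiable (by simp) x).hasFDerivAt
  have h2 := (Complex.conjCLE : ℂ →L[ℝ] ℂ).hasFDerivAt (x := θ x) |>.comp x h1
  exact congrArg (fun L : Space d →L[ℝ] ℂ => L v) h2.fderiv

theorem fderiv_eq_sum_single {θ : Space d → ℂ} (x b : Space d) :
    fderiv ℝ θ x b = ∑ j, (b j : ℂ) * fderiv ℝ θ x (EuclideanSpace.single j 1) := by
  conv_lhs => rw [← (EuclideanSpace.basisFun (Fin d) ℝ).sum_repr b]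
  simp [map_sum]

theorem HasL2Grad.exists_weakPartial_of_modulate {f : Space d → ℂ} {b : Space d}
    (hf : HasL2Grad (modulate b f)) (j : Fin d) : ∃ g, HasWeakPartial j f g := by
  obtain ⟨G, hG, -⟩ := hf j
  have := hG.modulate (-b)
  rw [modulate_neg_modulate] at this
  exact ⟨_, this⟩

theorem conj_modulate_mul_modulate (b : Space d) (f g : Space d → ℂ) (x : Space d) :
    conj (modulate b f x) * modulate b g x = conj (f x) * g x := by
  simp only [modulate, map_mul]
  rw [← Complex.exp_conj, mul_mul_mul_comm, ← Complex.exp_add]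
  simp

/-- One summand of the quadratic form, paired with a test function, after integration by parts. -/
theorem integral_conj_weakPartial_modulate {f g : Space d → ℂ} {b : Space d} {j : Fin d}
    (hg : HasWeakPartial j f g) {θ : Space d → ℂ}
    (h : ContDiff ℝ (⊤ : ℕ∞) θ) (h' : HasCompactSupport θ) :
    ∫ x, conj (weakPartial j (modulate b (fun x => conj (θ x))) x) *
        weakPartial j (modulate b f) x =
      ∫ x, (-secondPartial j θ x +
        2 * Complex.I * (b j * fderiv ℝ θ x (EuclideanSpace.single j 1)) +
        (b j : ℂ) ^ 2 * θ x) * f x := by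
  have hd := contDiff_fderiv_single h j
  have hd' := hasCompactSupport_fderiv_single h' j
  have hdd := contDiff_fderiv_single hd j
  have hdd' := hasCompactSupport_fderiv_single hd' j
  have w1 := (hg.modulate b).weakPartial
  have w2 := ((hasWeakPartial_of_contDiff (contDiff_conj h) j).modulate b).weakPartial
  set D : Space d → ℂ := fun x => fderiv ℝ θ x (EuclideanSpace.single j 1) with hD
  have e1 : ∫ x, conj (weakPartial j (modulate b (fun x => conj (θ x))) x) *
        weakPartial j (modulate b f) x =
      ∫ x, (D x * g x + (Complex.I * b j) * (D x * f x)) +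
        (-(Complex.I * b j) * (θ x * g x) + (b j : ℂ) ^ 2 * (θ x * f x)) := by
    refine integral_congr_ae ?_
    filter_upwards [w1, w2] with x hx hx'
    rw [hx, hx', conj_modulate_mul_modulate]
    simp only [fderiv_conj_apply h, map_add, map_mul, Complex.conj_I, Complex.conj_ofReal,
      Complex.conj_conj, hD]
    linear_combination (-(b j : ℂ) ^ 2 * θ x * f x) * Complex.I_sq
  have i1 := integrable_mul_test hg.2.1 hd.continuous hd'
  have i2 := (integrable_mul_test hg.1 hd.continuous hd').const_mul (Complex.I * b j)
  have i3 := (integrable_mul_test hg.2.1 h.continuous h').const_mul (-(Complex.I * b j))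
  have i4 := (integrable_mul_test hg.1 h.continuous h').const_mul ((b j : ℂ) ^ 2)
  have i5 := integrable_mul_test hg.1 hdd.continuous hdd'
  have p1 := hg.integral_complex hd hd'
  have p2 := hg.integral_complex h h'
  have e2 : ∫ x, (D x * g x + (Complex.I * b j) * (D x * f x)) +
        (-(Complex.I * b j) * (θ x * g x) + (b j : ℂ) ^ 2 * (θ x * f x)) =
      ((∫ x, D x * g x) + (Complex.I * b j) * ∫ x, D x * f x) +
        (-(Complex.I * b j) * (∫ x, θ x * g x) + (b j : ℂ) ^ 2 * ∫ x, θ x * f x) := by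
    simp only [← integral_const_mul]
    refine (integral_add (i1.add i2) (i3.add i4)).trans ?_
    exact congrArg₂ (· + ·) (integral_add i1 i2) (integral_add i3 i4)
  have e3 : ∫ x, (-secondPartial j θ x + 2 * Complex.I * (b j * D x) +
        (b j : ℂ) ^ 2 * θ x) * f x =
      (-(∫ x, secondPartial j θ x * f x) + 2 * ((Complex.I * b j) * ∫ x, D x * f x)) +
        (b j : ℂ) ^ 2 * ∫ x, θ x * f x := by
    simp only [← integral_const_mul, ← integral_neg]
    refine Eq.trans ?_ ((integral_add (i5.neg.add (i2.const_mul 2)) i4).trans ?_)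
    · refine integral_congr_ae (Filter.Eventually.of_forall fun x => ?_)
      simp only [Pi.add_apply, Pi.neg_apply, hD, secondPartial]
      ring
    · exact congrArg (· + _) (integral_add i5.neg (i2.const_mul 2))
  rw [e1, e2, e3]
  rw [show ∫ x, secondPartial j θ x * f x = - ∫ x, D x * g x from p1]
  rw [show ∫ x, θ x * g x = - ∫ x, D x * f x by rw [show ∫ x, D x * f x = _ from p2, neg_neg]]
  ring

/-- The differential operator of the stationary equations, transposed to test functions. -/
noncomputable def stationaryOp (μ a : ℝ) (c : Space d) (θ : Space d → ℂ) (x : Space d) : ℂ :=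
  -(μ * ∑ j, secondPartial j θ x) + a * θ x - Complex.I * fderiv ℝ θ x c

theorem continuous_secondPartial {θ : Space d → ℂ} (h : ContDiff ℝ (⊤ : ℕ∞) θ) (j : Fin d) :
    Continuous (secondPartial j θ) :=
  (contDiff_fderiv_single (contDiff_fderiv_single h j) j).continuous

theorem hasCompactSupport_secondPartial {θ : Space d → ℂ} (h : HasCompactSupport θ) (j : Fin d) :
    HasCompactSupport (secondPartial j θ) :=
  hasCompactSupport_fderiv_single (hasCompactSupport_fderiv_single h j) j

theorem stationaryOp_const_mul {μ a : ℝ} {θ : Space d → ℂ} (h : ContDiff ℝ (⊤ : ℕ∞) θ) (z : ℂ)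
    (x : Space d) : stationaryOp μ a c (fun x => z * θ x) x = z * stationaryOp μ a c θ x := by
  have h1 : ∀ {η : Space d → ℂ}, ContDiff ℝ (⊤ : ℕ∞) η → ∀ x v : Space d,
      fderiv ℝ (fun x => z * η x) x v = z * fderiv ℝ η x v := by
    intro η hη x v
    rw [fderiv_const_mul (hη.differentiable (by simp) x)]
    rfl
  have h2 : ∀ j, secondPartial j (fun x => z * θ x) x = z * secondPartial j θ x := by
    intro j
    simp only [secondPartial, h1 h]
    exact h1 (contDiff_fderiv_single h j) _ _
  simp only [stationaryOp, h1 h, h2, ← Finset.mul_sum]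
  ring

/-- The derivative of the quadratic form in the direction of a test function. -/
theorem sobInner_modulate_conj {μ a m : ℝ} {f : Space d → ℂ} {b : Space d}
    (hf : LocallyIntegrable f) (hf' : HasL2Grad (modulate b f))
    (hb : (2 * μ) • b = -c) (hm : μ * (‖b‖ ^ 2 + m) = a) {θ : Space d → ℂ}
    (h : ContDiff ℝ (⊤ : ℕ∞) θ) (h' : HasCompactSupport θ) :
    μ * sobInner m (modulate b f) (modulate b (fun x => conj (θ x))) =
      (∫ x, f x * stationaryOp μ a c θ x).re := by
  have i0 := integrable_mul_test hf h.continuous h'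
  have i1 := fun j => integrable_mul_test hf (continuous_secondPartial h j)
    (hasCompactSupport_secondPartial h' j)
  have i2 := fun j => integrable_mul_test hf (contDiff_fderiv_single h j).continuous
    (hasCompactSupport_fderiv_single h' j)
  have ij : ∀ j, Integrable (fun x => (-secondPartial j θ x +
        2 * Complex.I * (b j * fderiv ℝ θ x (EuclideanSpace.single j 1)) +
        (b j : ℂ) ^ 2 * θ x) * f x) := fun j => by
    refine (((i1 j).neg.add ((i2 j).const_mul (2 * Complex.I * b j))).add
      (i0.const_mul ((b j : ℂ) ^ 2))).congr (Filter.Eventually.of_forall fun x => ?_)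
    simp only [Pi.add_apply, Pi.neg_apply]
    ring
  have e1 : ∀ j, ∫ x, conj (weakPartial j (modulate b (fun x => conj (θ x))) x) *
        weakPartial j (modulate b f) x = _ := fun j => by
    obtain ⟨g, hg⟩ := hf'.exists_weakPartial_of_modulate j
    exact integral_conj_weakPartial_modulate (b := b) hg h h'
  have e2 : ∫ x, conj (modulate b (fun x => conj (θ x)) x) * modulate b f x = ∫ x, θ x * f x := by
    simp only [conj_modulate_mul_modulate, Complex.conj_conj]
  have hcj : ∀ j, (c j : ℂ) = -(2 * μ * b j) := fun j => by
    have : c j = -(2 * μ * b j) := by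
      rw [← neg_neg c, ← hb]
      simp
    rw [this]
    push_cast
    ring
  have hma : (a : ℂ) = μ * (∑ j, (b j : ℂ) ^ 2 + m) := by
    rw [← hm, EuclideanSpace.norm_sq_eq]
    simp
  unfold sobInner
  rw [e2]
  simp only [e1]
  rw [← Complex.re_sum, ← Complex.re_ofReal_mul, ← Complex.add_re, ← Complex.re_ofReal_mul,
    ← integral_finsetSum _ fun j _ => ij j, ← integral_const_mul,
    ← integral_add (integrable_finsetSum _ fun j _ => ij j) (i0.const_mul _),
    ← integral_const_mul]
  congr 1
  refine integral_congr_ae (Filter.Eventually.of_forall fun x => ?_)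
  simp only [stationaryOp, fderiv_eq_sum_single x c, hcj, hma, ← Finset.sum_mul,
    Finset.sum_add_distrib, Finset.sum_neg_distrib, ← Finset.mul_sum, neg_mul, mul_assoc]
  ring

end

section

variable {d : ℕ}
variable {κ ω m₁ m₂ p₁ p₂ : ℝ} {c b₁ b₂ : Space d} {P₁ P₂ : ENNReal}

/-- `f` solves `-μ Δf + a f + i c·∇f = k` in the sense of distributions. -/
def IsWeakStationary (μ a : ℝ) (c : Space d) (f k : Space d → ℂ) : Prop :=
  ∀ θ : Space d → ℂ, ContDiff ℝ (⊤ : ℕ∞) θ → HasCompactSupport θ →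
    ∫ x, f x * stationaryOp μ a c θ x = ∫ x, k x * θ x

/-- It is enough to know the real parts, as `θ` can be replaced by `-i θ`. -/
theorem isWeakStationary_of_re {μ a : ℝ} {f k : Space d → ℂ}
    (h : ∀ θ : Space d → ℂ, ContDiff ℝ (⊤ : ℕ∞) θ → HasCompactSupport θ →
      (∫ x, f x * stationaryOp μ a c θ x).re = (∫ x, k x * θ x).re) :
    IsWeakStationary μ a c f k := by
  intro θ h1 h2
  refine Complex.ext (h θ h1 h2) ?_
  have := h (fun x => -Complex.I * θ x) (contDiff_const.mul h1) h2.mul_left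
  simp only [stationaryOp_const_mul h1] at this
  rw [show ∫ x, f x * (-Complex.I * stationaryOp μ a c θ x) =
      -Complex.I * ∫ x, f x * stationaryOp μ a c θ x by
    rw [← integral_const_mul]; congr 1; ext x; ring,
    show ∫ x, k x * (-Complex.I * θ x) = -Complex.I * ∫ x, k x * θ x by
    rw [← integral_const_mul]; congr 1; ext x; ring] at this
  simpa using this

/-- Critical points of the action solve the stationary system. -/
theorem PairSetting.isWeakStationary (S : PairSetting κ b₁ b₂ m₁ m₂ P₁ P₂ p₁ p₂)
    (hX : spaceX κ ω c = pairSpace b₁ b₂ P₁ P₂)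
    (hQ : ∀ p : Pair d, quadraticPart κ ω c p = pairEnergy κ b₁ b₂ m₁ m₂ p)
    (hb₁ : (2 * (1 : ℝ)) • b₁ = -c) (hb₂ : (2 * κ) • b₂ = -c)
    (hm₁ : 1 * (‖b₁‖ ^ 2 + m₁) = ω) (hm₂ : κ * (‖b₂‖ ^ 2 + m₂) = 2 * ω)
    {p : Pair d} (hp : p ∈ criticalPoints κ ω c) :
    IsWeakStationary 1 ω c p.1 (fun x => 2 * (p.2 x * conj (p.1 x))) ∧
      IsWeakStationary κ (2 * ω) c p.2 (fun x => p.1 x ^ 2) := by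
  have hpX : p ∈ pairSpace b₁ b₂ P₁ P₂ := hX ▸ hp.1
  have h1P : ∀ {m : ℝ} {P : ENNReal}, MassExponent d m P → 1 ≤ P := fun h =>
    (by norm_num : (1 : ENNReal) ≤ 2).trans h.two_le
  have hl₁ := locallyIntegrable_of_memLp (h1P S.mass₁) hpX.1.1
  have hl₂ := locallyIntegrable_of_memLp (h1P S.mass₂) hpX.2.1
  have hcrit : ∀ q ∈ pairSpace b₁ b₂ P₁ P₂,
      sobInner m₁ (modulate b₁ p.1) (modulate b₁ q.1) +
        κ * sobInner m₂ (modulate b₂ p.2) (modulate b₂ q.2) = interactionDeriv p q := fun q hq =>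
    sub_eq_zero.1 ((S.hasDerivAt_action hQ hpX hq).unique (hp.2.2 q (hX ▸ hq)))
  have hz : HasCompactSupport (0 : Space d → ℂ) := HasCompactSupport.zero
  have hz' : ContDiff ℝ (⊤ : ℕ∞) (0 : Space d → ℂ) := contDiff_const
  have hw0 : ∀ (b : Space d) (j : Fin d),
      weakPartial j (modulate b (0 : Space d → ℂ)) =ᵐ[volume] 0 := fun b j => by
    have : modulate b (0 : Space d → ℂ) = 0 := by ext x; simp [modulate]
    rw [this]
    exact HasWeakPartial.weakPartial ⟨locallyIntegrable_zero, locallyIntegrable_zero, by simp⟩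
  have hs0 : ∀ (b : Space d) (m : ℝ) (f : Space d → ℂ), sobInner m f (modulate b 0) = 0 := by
    intro b m f
    have h1 : ∀ j, ∫ x, conj (weakPartial j (modulate b 0) x) * weakPartial j f x = 0 := fun j => by
      rw [← integral_zero (Space d) ℂ]
      refine integral_congr_ae ?_
      filter_upwards [hw0 b j] with x hx
      simp [hx]
    have h2 : ∫ x, conj (modulate b 0 x) * f x = 0 := by simp [modulate]
    simp [sobInner, h1, h2]
  constructor
  · refine isWeakStationary_of_re fun θ h h' => ?_
    rw [← sobInner_modulate_conj hl₁ hpX.1.2 hb₁ hm₁ h h', one_mul]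
    have := hcrit (fun x => conj (θ x), 0)
      (mem_pairSpace_of_contDiff (contDiff_conj h) (hasCompactSupport_conj h') hz' hz)
    simp only [hs0, mul_zero, add_zero] at this
    rw [this, interactionDeriv, ← Complex.conj_re, ← integral_conj]
    congr 2
    ext x
    simp only [Pi.zero_apply, map_mul, map_zero, mul_zero, add_zero, Complex.conj_conj,
      Complex.conj_ofNat]
    ring
  · refine isWeakStationary_of_re fun θ h h' => ?_
    rw [← sobInner_modulate_conj hl₂ hpX.2.2 hb₂ hm₂ h h']
    have := hcrit (0, fun x => conj (θ x))
      (mem_pairSpace_of_contDiff hz' hz (contDiff_conj h) (hasCompactSupport_conj h'))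
    simp only [hs0, zero_add] at this
    rw [this, interactionDeriv]
    congr 2
    ext x
    simp only [Pi.zero_apply, mul_zero, zero_mul, zero_add, Complex.conj_conj]
    ring

end

/-! ### Traveling waves in space-time -/

section

variable {d : ℕ}
variable {κ ω m₁ m₂ p₁ p₂ : ℝ} {c b₁ b₂ : Space d} {P₁ P₂ : ENNReal}

/-- The shear `(t, y) ↦ (t, y + t c)`, passing from the moving frame to the fixed one. -/
noncomputable def shear (c : Space d) : (ℝ × Space d) ≃L[ℝ] (ℝ × Space d) :=
  ContinuousLinearEquiv.equivOfInverse
    ((ContinuousLinearMap.fst ℝ ℝ (Space d)).prod (ContinuousLinearMap.snd ℝ ℝ (Space d) +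
      (ContinuousLinearMap.fst ℝ ℝ (Space d)).smulRight c))
    ((ContinuousLinearMap.fst ℝ ℝ (Space d)).prod (ContinuousLinearMap.snd ℝ ℝ (Space d) +
      (ContinuousLinearMap.fst ℝ ℝ (Space d)).smulRight (-c)))
    (fun z => by ext <;> simp) (fun z => by ext <;> simp)

theorem shear_apply (c : Space d) (z : ℝ × Space d) : shear c z = (z.1, z.2 + z.1 • c) := rfl

theorem measurePreserving_shear (c : Space d) : MeasurePreserving (shear c) volume volume := by
  have := (MeasurePreserving.id (volume : Measure ℝ)).skew_product
    (μc := (volume : Measure (Space d)))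
    (μd := (volume : Measure (Space d))) (g := fun t y => y + t • c)
    (by unfold Function.uncurry; fun_prop)
    (Filter.Eventually.of_forall fun t => map_add_right_eq_self _ _)
  exact this

theorem integral_shear (c : Space d) (G : ℝ × Space d → ℂ) :
    ∫ z, G (shear c z) = ∫ z, G z :=
  (measurePreserving_shear c).integral_comp (shear c).toHomeomorph.measurableEmbedding G

theorem travelingWave_shear (a : ℝ) (c : Space d) (f : Space d → ℂ) (z : ℝ × Space d) :
    travelingWave a c f (shear c z) = Complex.exp (Complex.I * ((a * z.1 : ℝ) : ℂ)) * f z.2 := by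
  simp [travelingWave, shear_apply]

theorem locallyIntegrable_comp_snd {f : Space d → ℂ} (hf : LocallyIntegrable f) :
    LocallyIntegrable (fun z : ℝ × Space d => f z.2) := by
  rw [locallyIntegrable_iff]
  intro K hK
  have h1 : IsCompact (Prod.fst '' K) := hK.image continuous_fst
  have h2 : IsCompact (Prod.snd '' K) := hK.image continuous_snd
  have : IsFiniteMeasure ((volume : Measure ℝ).restrict (Prod.fst '' K)) :=
    ⟨by simpa using h1.measure_lt_top⟩
  have h3 := (hf.integrableOn_isCompact h2).integrable.comp_snd
    ((volume : Measure ℝ).restrict (Prod.fst '' K))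
  rw [Measure.prod_restrict] at h3
  exact IntegrableOn.mono_set h3 (Set.subset_fst_image_prod_snd_image)

theorem locallyIntegrable_travelingWave (a : ℝ) {f : Space d → ℂ} (hf : LocallyIntegrable f) :
    LocallyIntegrable (travelingWave a c f) := by
  have h1 : LocallyIntegrable (fun z : ℝ × Space d => travelingWave a c f (shear c z)) := by
    simp only [travelingWave_shear]
    refine (locallyIntegrable_comp_snd hf).mono ?_ (Filter.Eventually.of_forall fun z => ?_)
    · refine AEStronglyMeasurable.mul (Continuous.aestronglyMeasurable (by fun_prop))
        (locallyIntegrable_comp_snd hf).aestronglyMeasurable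
    · simp [Complex.norm_exp]
  have h2 := (locallyIntegrable_map_homeomorph (shear c).toHomeomorph
    (f := travelingWave a c f) (μ := (volume : Measure (ℝ × Space d)))).2 h1
  have h3 : Measure.map (shear c).toHomeomorph (volume : Measure (ℝ × Space d)) = volume :=
    (measurePreserving_shear c).map_eq
  rwa [h3] at h2

theorem fderiv_slice {w : ℝ × Space d → ℂ} (hw : ContDiff ℝ (⊤ : ℕ∞) w) (t : ℝ)
    (y v : Space d) : fderiv ℝ (fun y => w (t, y)) y v = fderiv ℝ w (t, y) (0, v) := by
  have h1 := (hw.differentiable (by simp) (t, y)).hasFDerivAt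
  have h2 := h1.comp y (hasFDerivAt_prodMk_right t y)
  exact congrArg (fun L : Space d →L[ℝ] ℂ => L v) h2.fderiv

theorem contDiff_slice {w : ℝ × Space d → ℂ} (hw : ContDiff ℝ (⊤ : ℕ∞) w) (t : ℝ) :
    ContDiff ℝ (⊤ : ℕ∞) (fun y => w (t, y)) :=
  hw.comp (contDiff_prodMk_right t)

theorem hasCompactSupport_slice {w : ℝ × Space d → ℂ} (hw : HasCompactSupport w) (t : ℝ) :
    HasCompactSupport (fun y => w (t, y)) :=
  hw.comp_isClosedEmbedding
    (Isometry.of_dist_eq fun _ _ => by simp [Prod.dist_eq]).isClosedEmbedding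

theorem contDiff_fderiv_apply {w : ℝ × Space d → ℂ} (hw : ContDiff ℝ (⊤ : ℕ∞) w)
    (v : ℝ × Space d) : ContDiff ℝ (⊤ : ℕ∞) (fun z => fderiv ℝ w z v) :=
  (hw.fderiv_right (m := (⊤ : ℕ∞)) (by simp)).clm_apply contDiff_const

theorem hasCompactSupport_fderiv_apply {w : ℝ × Space d → ℂ} (hw : HasCompactSupport w)
    (v : ℝ × Space d) : HasCompactSupport (fun z => fderiv ℝ w z v) :=
  (hw.fderiv (𝕜 := ℝ)).comp_left (g := fun L : (ℝ × Space d) →L[ℝ] ℂ => L v) (by simp)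

theorem laplacian_eq_sum_secondPartial {θ : Space d → ℂ} (h : ContDiff ℝ (⊤ : ℕ∞) θ)
    (x : Space d) : Δ θ x = ∑ j, secondPartial j θ x := by
  rw [InnerProductSpace.laplacian_eq_iteratedFDeriv_orthonormalBasis θ
    (EuclideanSpace.basisFun (Fin d) ℝ)]
  refine Finset.sum_congr rfl fun j _ => ?_
  have h1 : DifferentiableAt ℝ (fderiv ℝ θ) x :=
    (h.fderiv_right (m := (⊤ : ℕ∞)) (by simp)).differentiable (by simp) x
  rw [iteratedFDeriv_two_apply, secondPartial, fderiv_clm_apply h1 (by fun_prop)]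
  simp

theorem secondPartial_comp_add_right (j : Fin d) (θ : Space d → ℂ) (x v : Space d) :
    secondPartial j (fun y => θ (y + v)) x = secondPartial j θ (x + v) := by
  simp only [secondPartial, fderiv_comp_add_right]
  exact congrArg (fun L : Space d →L[ℝ] ℂ => L _)
    (fderiv_comp_add_right (f := fun y => fderiv ℝ θ y (EuclideanSpace.single j 1)) v)

/-- The stationary operator in the space variable, in terms of space-time derivatives. -/
theorem stationaryOp_slice {μ a : ℝ} {w : ℝ × Space d → ℂ} (hw : ContDiff ℝ (⊤ : ℕ∞) w)
    (z : ℝ × Space d) : stationaryOp μ a c (fun y => w (z.1, y)) z.2 =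
      -(μ * ∑ j, fderiv ℝ (fun z' => fderiv ℝ w z' (0, EuclideanSpace.single j 1)) z
        (0, EuclideanSpace.single j 1)) + a * w z - Complex.I * fderiv ℝ w z (0, c) := by
  have : ∀ j : Fin d, secondPartial j (fun y => w (z.1, y)) z.2 =
      fderiv ℝ (fun z' => fderiv ℝ w z' (0, EuclideanSpace.single j 1)) z
        (0, EuclideanSpace.single j 1) := fun j => by
    simp only [secondPartial, fderiv_slice hw]
    exact fderiv_slice (contDiff_fderiv_apply hw _) z.1 z.2 _
  simp only [stationaryOp, this, fderiv_slice hw]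

theorem continuous_stationaryOp_slice {μ a : ℝ} {w : ℝ × Space d → ℂ}
    (hw : ContDiff ℝ (⊤ : ℕ∞) w) :
    Continuous (fun z : ℝ × Space d => stationaryOp μ a c (fun y => w (z.1, y)) z.2) := by
  simp only [stationaryOp_slice hw]
  have h1 := fun j : Fin d => (contDiff_fderiv_apply (contDiff_fderiv_apply hw
    (0, EuclideanSpace.single j 1)) (0, EuclideanSpace.single j 1)).continuous
  have h2 := (contDiff_fderiv_apply hw (0, c)).continuous
  have h3 := hw.continuous
  exact ((continuous_const.mul (continuous_finsetSum _ fun j _ => h1 j)).neg.add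
    (continuous_const.mul h3)).sub (continuous_const.mul h2)

theorem hasCompactSupport_stationaryOp_slice {μ a : ℝ} {w : ℝ × Space d → ℂ}
    (hw : ContDiff ℝ (⊤ : ℕ∞) w) (hw' : HasCompactSupport w) :
    HasCompactSupport (fun z : ℝ × Space d => stationaryOp μ a c (fun y => w (z.1, y)) z.2) := by
  refine HasCompactSupport.intro' hw'.isCompact (isClosed_tsupport w) fun z hz => ?_
  have h1 : ∀ v, fderiv ℝ w z v = 0 := fun v => by
    rw [fderiv_of_notMem_tsupport ℝ hz]; rfl
  have h2 : ∀ v v', fderiv ℝ (fun z' => fderiv ℝ w z' v) z v' = 0 := fun v v' => by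
    have : z ∉ tsupport (fun z' => fderiv ℝ w z' v) := fun h' => hz
      (closure_minimal (fun x hx => by
        by_contra hx'
        exact hx (by simp [fderiv_of_notMem_tsupport ℝ hx'])) (isClosed_tsupport w) h')
    rw [fderiv_of_notMem_tsupport ℝ this]; rfl
  simp [stationaryOp_slice hw, h1, h2, image_eq_zero_of_notMem_tsupport hz]

/-- A time derivative integrates to zero against a function of space alone. -/
theorem integral_mul_timeDeriv {f : Space d → ℂ} (hf : LocallyIntegrable f)
    {w : ℝ × Space d → ℂ} (hw : ContDiff ℝ (⊤ : ℕ∞) w) (hw' : HasCompactSupport w) :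
    ∫ z : ℝ × Space d, fderiv ℝ w z (1, 0) * f z.2 = 0 := by
  have hi : Integrable (fun z : ℝ × Space d => fderiv ℝ w z (1, 0) * f z.2) :=
    (locallyIntegrable_comp_snd hf).integrable_smul_left_of_hasCompactSupport
      (contDiff_fderiv_apply hw _).continuous (hasCompactSupport_fderiv_apply hw' _)
  have h1 : ∀ y, ∫ t, fderiv ℝ w (t, y) (1, 0) = 0 := by
    intro y
    have hy : Topology.IsClosedEmbedding (fun t : ℝ => (t, y)) :=
      (Isometry.of_dist_eq fun _ _ => by simp [Prod.dist_eq]).isClosedEmbedding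
    have hc : HasCompactSupport (fun t => w (t, y)) :=
      hw'.comp_isClosedEmbedding hy
    have hc' : HasCompactSupport (fun t => fderiv ℝ w (t, y) (1, 0)) :=
      (hasCompactSupport_fderiv_apply hw' (1, 0)).comp_isClosedEmbedding
        hy
    have hcont : Continuous (fun t => w (t, y)) := hw.continuous.comp (by fun_prop)
    have hcont' : Continuous (fun t => fderiv ℝ w (t, y) (1, 0)) :=
      (contDiff_fderiv_apply hw (1, 0)).continuous.comp (by fun_prop)
    refine integral_eq_zero_of_hasDerivAt_of_integrable (f := fun t => w (t, y)) (fun t => ?_)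
      (hcont'.integrable_of_hasCompactSupport hc') (hcont.integrable_of_hasCompactSupport hc)
    have h1 := (hw.differentiable (by simp) (t, y)).hasFDerivAt
    exact (h1.comp t (hasFDerivAt_prodMk_left t y)).hasDerivAt
  rw [Measure.volume_eq_prod] at hi ⊢
  rw [integral_prod_symm _ hi]
  simp [integral_mul_const, h1]

/-- The test function `χ` in the moving frame, with the phase of the wave absorbed. -/
noncomputable def movingTest (a : ℝ) (c : Space d) (χ : ℝ × Space d → ℂ) : ℝ × Space d → ℂ :=
  fun z => Complex.exp (Complex.I * ((a * z.1 : ℝ) : ℂ)) * χ (shear c z)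

theorem contDiff_movingTest (a : ℝ) (c : Space d) {χ : ℝ × Space d → ℂ}
    (h : ContDiff ℝ (⊤ : ℕ∞) χ) : ContDiff ℝ (⊤ : ℕ∞) (movingTest a c χ) := by
  refine ContDiff.mul ?_ (h.comp (shear c).contDiff)
  exact Complex.contDiff_exp.comp (contDiff_const.mul
    (Complex.ofRealCLM.contDiff.comp (contDiff_const.mul contDiff_fst)))

theorem hasCompactSupport_movingTest (a : ℝ) (c : Space d) {χ : ℝ × Space d → ℂ}
    (h : HasCompactSupport χ) : HasCompactSupport (movingTest a c χ) :=
  HasCompactSupport.mul_left (h.comp_homeomorph (shear c).toHomeomorph)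

theorem fderiv_comp_shear {χ : ℝ × Space d → ℂ} (h : ContDiff ℝ (⊤ : ℕ∞) χ)
    (z v : ℝ × Space d) :
    fderiv ℝ (fun z => χ (shear c z)) z v = fderiv ℝ χ (shear c z) (shear c v) := by
  have h1 := (h.differentiable (by simp) (shear c z)).hasFDerivAt.comp z (shear c).hasFDerivAt
  exact congrArg (fun L : (ℝ × Space d) →L[ℝ] ℂ => L v) h1.fderiv

theorem fderiv_movingTest {a : ℝ} {χ : ℝ × Space d → ℂ} (h : ContDiff ℝ (⊤ : ℕ∞) χ)
    (z : ℝ × Space d) : fderiv ℝ (movingTest a c χ) z (1, 0) =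
      Complex.exp (Complex.I * ((a * z.1 : ℝ) : ℂ)) * (Complex.I * a * χ (shear c z) +
        fderiv ℝ χ (shear c z) (1, 0) + fderiv ℝ χ (shear c z) (0, c)) := by
  have he : HasDerivAt (fun t : ℝ => Complex.exp (Complex.I * ((a * t : ℝ) : ℂ)))
      (Complex.exp (Complex.I * ((a * z.1 : ℝ) : ℂ)) * (Complex.I * a)) z.1 := by
    have := ((hasDerivAt_id' z.1).const_mul a).ofReal_comp.const_mul Complex.I
    rw [mul_one] at this
    exact this.cexp
  have h1 := he.hasFDerivAt.comp z (hasFDerivAt_fst (𝕜 := ℝ) (E := ℝ) (F := Space d))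
  have h2 := h1.mul ((h.comp (shear c).contDiff).differentiable (by simp) z).hasFDerivAt
  have h3 : fderiv ℝ (fun z => χ (shear c z)) z (1, 0) =
      fderiv ℝ χ (shear c z) (1, 0) + fderiv ℝ χ (shear c z) (0, c) := by
    rw [fderiv_comp_shear h, ← map_add]
    simp [shear_apply]
  refine (congrArg (fun L : (ℝ × Space d) →L[ℝ] ℂ => L (1, 0)) h2.fderiv).trans ?_
  simp only [add_apply, smul_apply,
    ContinuousLinearMap.comp_apply, ContinuousLinearMap.coe_fst',
    ContinuousLinearMap.toSpanSingleton_apply, Function.comp_apply, smul_eq_mul, one_smul]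
  rw [show fderiv ℝ (χ ∘ shear c) z (1, 0) = _ from h3]
  ring

/-- In the moving frame the transport term `c·∇` of the stationary operator cancels against the one
produced by the time derivative in `fderiv_movingTest`. -/
theorem stationaryOp_movingTest {μ a : ℝ} {χ : ℝ × Space d → ℂ} (h : ContDiff ℝ (⊤ : ℕ∞) χ)
    (z : ℝ × Space d) : stationaryOp μ a c (fun y => movingTest a c χ (z.1, y)) z.2 =
      Complex.exp (Complex.I * ((a * z.1 : ℝ) : ℂ)) *
        (-(μ * Δ (fun y => χ ((shear c z).1, y)) (shear c z).2) + a * χ (shear c z) -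
          Complex.I * fderiv ℝ χ (shear c z) (0, c)) := by
  obtain ⟨t, y⟩ := z
  have hθ : ContDiff ℝ (⊤ : ℕ∞) (fun y => χ (t, y)) := contDiff_slice h t
  have hs : ContDiff ℝ (⊤ : ℕ∞) (fun y => χ (t, y + t • c)) :=
    hθ.comp (contDiff_id.add contDiff_const)
  have h1 : (fun y => movingTest a c χ (t, y)) = fun y =>
      Complex.exp (Complex.I * ((a * t : ℝ) : ℂ)) * χ (t, y + t • c) := by
    ext y
    rw [movingTest, shear_apply]
  have h2 : ∀ j, secondPartial j (fun y => χ (t, y + t • c)) y =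
      secondPartial j (fun y => χ (t, y)) (y + t • c) := fun j =>
    secondPartial_comp_add_right j (fun y => χ (t, y)) y (t • c)
  have h3 : fderiv ℝ (fun y => χ (t, y + t • c)) y c = fderiv ℝ χ (t, y + t • c) (0, c) := by
    rw [fderiv_comp_add_right (f := fun y => χ (t, y)), fderiv_slice h]
  simp only [shear_apply]
  rw [h1, stationaryOp_const_mul hs, stationaryOp, h3, laplacian_eq_sum_secondPartial hθ]
  simp only [h2]

/-- A weak solution of the stationary equation gives a traveling wave which solves the evolution
equation in the sense of distributions. -/
theorem IsWeakStationary.integral_travelingWave {μ a : ℝ} {f k : Space d → ℂ}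
    (h : IsWeakStationary μ a c f k) (hf : LocallyIntegrable f) (hk : LocallyIntegrable k)
    {χ : ℝ × Space d → ℂ} (hχ : ContDiff ℝ (⊤ : ℕ∞) χ) (hχ' : HasCompactSupport χ) :
    ∫ z, travelingWave a c f z *
        (-Complex.I * fderiv ℝ χ z (1, 0) + (μ : ℂ) * Δ (fun y => χ (z.1, y)) z.2) =
      ∫ z, -(travelingWave a c k z) * χ z := by
  have hw := contDiff_movingTest a c hχ
  have hw' := hasCompactSupport_movingTest a c hχ'
  have hpt : ∀ z : ℝ × Space d, travelingWave a c f (shear c z) *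
      (-Complex.I * fderiv ℝ χ (shear c z) (1, 0) +
        (μ : ℂ) * Δ (fun y => χ ((shear c z).1, y)) (shear c z).2) =
      -Complex.I * (fderiv ℝ (movingTest a c χ) z (1, 0) * f z.2) -
        stationaryOp μ a c (fun y => movingTest a c χ (z.1, y)) z.2 * f z.2 := fun z => by
    rw [stationaryOp_movingTest hχ, fderiv_movingTest hχ, travelingWave_shear]
    linear_combination (a * Complex.exp (Complex.I * ((a * z.1 : ℝ) : ℂ)) * χ (shear c z) *
      f z.2) * Complex.I_sq
  have hlf := locallyIntegrable_comp_snd hf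
  have i1 : Integrable (fun z : ℝ × Space d =>
      fderiv ℝ (movingTest a c χ) z (1, 0) * f z.2) :=
    hlf.integrable_smul_left_of_hasCompactSupport
      (contDiff_fderiv_apply hw _).continuous (hasCompactSupport_fderiv_apply hw' _)
  have i2 : Integrable (fun z : ℝ × Space d =>
      stationaryOp μ a c (fun y => movingTest a c χ (z.1, y)) z.2 * f z.2) :=
    hlf.integrable_smul_left_of_hasCompactSupport (continuous_stationaryOp_slice hw)
      (hasCompactSupport_stationaryOp_slice hw hw')
  have i3 : Integrable (fun z : ℝ × Space d => movingTest a c χ z * k z.2) :=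
    (locallyIntegrable_comp_snd hk).integrable_smul_left_of_hasCompactSupport hw.continuous hw'
  have key : ∫ z : ℝ × Space d,
      stationaryOp μ a c (fun y => movingTest a c χ (z.1, y)) z.2 * f z.2 =
      ∫ z : ℝ × Space d, movingTest a c χ z * k z.2 := by
    rw [Measure.volume_eq_prod] at i2 i3 ⊢
    rw [integral_prod _ i2, integral_prod _ i3]
    congr 1
    ext t
    have := h (fun y => movingTest a c χ (t, y)) (contDiff_slice hw t)
      (hasCompactSupport_slice hw' t)
    simpa only [mul_comm] using this
  rw [← integral_shear c, ← integral_shear c (fun z => -(travelingWave a c k z) * χ z)]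
  simp only [hpt]
  rw [integral_sub (i1.const_mul _) i2, integral_const_mul, integral_mul_timeDeriv hf hw hw', key,
    mul_zero, zero_sub, ← integral_neg]
  congr 1
  ext z
  rw [travelingWave_shear, movingTest]
  ring

theorem locallyIntegrable_mul_of_memLp {f g : Space d → ℂ} {p q : ENNReal} (hp : 2 ≤ p)
    (hq : 2 ≤ q) (hf : MemLp f p) (hg : MemLp g q) : LocallyIntegrable (fun x => f x * g x) := by
  rw [locallyIntegrable_iff]
  intro K hK
  have : IsFiniteMeasure ((volume : Measure (Space d)).restrict K) :=
    ⟨by simpa using hK.measure_lt_top⟩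
  exact MemLp.integrable_mul (hf.restrict K |>.mono_exponent hp) (hg.restrict K |>.mono_exponent hq)

/-- Critical points of the action give traveling waves. -/
theorem PairSetting.isNLSSolution (S : PairSetting κ b₁ b₂ m₁ m₂ P₁ P₂ p₁ p₂)
    (hX : spaceX κ ω c = pairSpace b₁ b₂ P₁ P₂)
    {p : Pair d} (hp : p ∈ criticalPoints κ ω c)
    (h1 : IsWeakStationary 1 ω c p.1 (fun x => 2 * (p.2 x * conj (p.1 x))))
    (h2 : IsWeakStationary κ (2 * ω) c p.2 (fun x => p.1 x ^ 2)) :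
    IsNLSSolution κ (travelingWave ω c p.1) (travelingWave (2 * ω) c p.2) := by
  have hpX : p ∈ pairSpace b₁ b₂ P₁ P₂ := hX ▸ hp.1
  have h2₁ := S.mass₁.two_le
  have h2₂ := S.mass₂.two_le
  have h12 : (1 : ENNReal) ≤ 2 := by norm_num
  have l1 := locallyIntegrable_of_memLp (h12.trans h2₁) hpX.1.1
  have l2 := locallyIntegrable_of_memLp (h12.trans h2₂) hpX.2.1
  have hc : MemLp (fun x => conj (p.1 x)) P₁ := hpX.1.1.star
  have l3 : LocallyIntegrable (fun x => p.2 x * conj (p.1 x)) :=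
    locallyIntegrable_mul_of_memLp h2₂ h2₁ hpX.2.1 hc
  have l4 : LocallyIntegrable (fun x => p.1 x ^ 2) := by
    simpa only [sq] using locallyIntegrable_mul_of_memLp h2₁ h2₁ hpX.1.1 hpX.1.1
  have e1 : (fun z => travelingWave (2 * ω) c p.2 z * conj (travelingWave ω c p.1 z)) =
      travelingWave ω c (fun x => p.2 x * conj (p.1 x)) := by
    ext z
    simp only [travelingWave, map_mul]
    rw [← Complex.exp_conj, mul_mul_mul_comm, ← Complex.exp_add]
    congr 2
    simp only [map_mul, Complex.conj_I, Complex.conj_ofReal]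
    push_cast
    ring
  have e2 : (fun z => travelingWave ω c p.1 z ^ 2) =
      travelingWave (2 * ω) c (fun x => p.1 x ^ 2) := by
    ext z
    simp only [travelingWave, mul_pow]
    rw [← Complex.exp_nat_mul]
    congr 2
    push_cast
    ring
  refine ⟨locallyIntegrable_travelingWave _ l1, locallyIntegrable_travelingWave _ l2,
    e1 ▸ locallyIntegrable_travelingWave _ l3, e2 ▸ locallyIntegrable_travelingWave _ l4,
    fun χ hχ hχ' => ⟨?_, ?_⟩⟩
  · have h := h1.integral_travelingWave l1 (l3.smul (2 : ℂ)) hχ hχ'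
    simp only [Complex.ofReal_one, one_mul] at h
    rw [h]
    congr 1
    ext z
    rw [show travelingWave (2 * ω) c p.2 z * conj (travelingWave ω c p.1 z) = _ from
      congrFun e1 z]
    simp only [travelingWave]
    ring
  · rw [h2.integral_travelingWave l2 l4 hχ hχ']
    congr 1
    ext z
    rw [show travelingWave ω c p.1 z ^ 2 = _ from congrFun e2 z]

end

end QuadraticNLS

theorem theorem1p1 (d : ℕ) (κ ω : ℝ) (c : Space d)
    (h : (1 ≤ d ∧ d ≤ 5 ∧ CaseA κ ω c) ∨ (3 ≤ d ∧ d ≤ 5 ∧ CaseB κ ω c) ∨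
      (d = 5 ∧ CaseC κ ω c)) :
    (groundStates κ ω c).Nonempty ∧
    groundStates κ ω c = nehariMinimizers κ ω c ∧
    ∀ p ∈ groundStates κ ω c,
      IsNLSSolution κ (travelingWave ω c p.1) (travelingWave (2 * ω) c p.2) := by
  obtain ⟨hκ, P₁, P₂, p₁, p₂, S, hX⟩ := exists_pairSetting h
  have hQ := quadraticPart_eq_pairEnergy hκ ω c
  obtain ⟨h1, h2⟩ := groundStates_eq_nehariMinimizers S hX hQ exists_interaction_pos
  refine ⟨h1, h2, fun p hp => ?_⟩
  obtain ⟨w1, w2⟩ := S.isWeakStationary hX hQ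
    (by rw [smul_smul]; norm_num)
    (by rw [smul_smul, show 2 * κ * -(1 / (2 * κ)) = -1 by field_simp, neg_one_smul])
    (by rw [norm_smul, mul_pow]; norm_num; ring)
    (by rw [norm_smul, mul_pow, Real.norm_eq_abs, sq_abs]; field_simp; ring) hp.1
  exact S.isNLSSolution hX hp.1 w1 w2
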